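/- **Conventions.** In a virtual double category, a cell $\phi\colon(P_1,\dots,P_n)\Rightarrow Q$ with left frame $f$ and right frame $g$ has as source a composable string of $n\ge 0$ proarrows and as target one proarrow; write ${}_f\mathbb{D}_g(P_1,\dots,P_n;Q)$ for the set of these cells. Proarrows are written $P\colon x\nrightarrow y$, vertical arrows $f\colon x\to y$, and vertical arrows are composed as functions. A cell $\theta\colon(P_1,\dots,P_n)\Rightarrow Q$ with identity frames is *opcartesian* if composition with $\theta$ (next to identity cells) is a bijection ${}_f\mathbb{D}_g(\vec R,Q,\vec S;T)\to{}_f\mathbb{D}_g(\vec R,\vec P,\vec S;T)$ for all $f,g,T,\vec R,\vec S$; a *unit* of an object $x$ is a proarrow $U_x\colon x\nrightarrow x$ with an opcartesian cell $()\Rightarrow U_x$. A cell $\phi\colon P\Rightarrow Q$ with frames $f,g$ is *cartesian* if composition with it is a bijection ${}_h\mathbb{D}_k(\vec R;P)\to{}_{fh}\mathbb{D}_{gk}(\vec R;Q)$ for all $h,k,\vec R$; then $P$ is a restriction $Q(g,f)$ of $Q$. A *virtual equipment* is a virtual double category in which every object has a unit and every restriction $Q(g,f)$ exists. A *monoid*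 $M$ on an object $c$ is a proarrow $M\colon c\nrightarrow c$ with unit and multiplication cells $()\Rightarrow M$ and $(M,M)\Rightarrow M$ (identity frames) that are associative and unital. A *monoid homomorphism* is a vertical arrow $f$ with a cell $\vec f\colon M\Rightarrow N$, with both frames $f$, that respects units and multiplications. *Bimodules* between monoids are proarrows with compatible, associative and unital left and right actions. A *bimodule homomorphism* $(B_1,\dots,B_n)\Rightarrow C$ over monoid homomorphisms $f,g$ is a cell, with the underlying vertical arrows as frames, that respects the outer actions and equalizes the two actions of each intermediate monoid (for $n=0$: the left and the right action of the monoid on the target of the cell agree). For a virtual equipment $\mathbb{D}$, $\mathbb{M}\mathrm{od}(\mathbb{D})$ is the virtual double category of monoids, monoid homomorphisms, bimodules and bimodule homomorphisms in $\mathbb{D}$. In a virtual equipment, $U_x$ is a monoid (the *trivial monoid* on $x$), every proarrow is a bimodule between trivial monoids, and every vertical arrow induces a homomorphism of trivial monoids. An *embedding* of a monoid $M$ into $x$ is a monoid homomorphism $i=(i,\vec\imath\,)\colon M\to U_x$. An *embedding* of an $(M,N)$-bimodule $B$ into a proarrow $P\colon x\nrightarrow y$, over embeddings $i\colon M\to x$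 and $j\colon N\to y$, is a bimodule homomorphism $\phi\colon B\Rightarrow P$ over $i,j$; it is *cartesian* if $\vec\imath,\vec\jmath,\phi$ are cartesian. A *collapse* of $M$ is an embedding $i\colon M\to x$ such that every embedding $M\to y$ equals $fi$ for a unique $f\colon x\to y$. A *collapse* of $B$ is an embedding $\phi\colon B\Rightarrow P$ over collapses $i,j$ of $M$ and $N$ such that, for all $f\colon x\to x'$, $g\colon y\to y'$, $Q\colon x'\nrightarrow y'$, every embedding $B\Rightarrow Q$ over $fi,gj$ is $\chi\phi$ for a unique $\chi\in{}_f\mathbb{D}_g(P;Q)$. A collapse $i\colon M\to x$ is *normal* if $\vec\imath\colon M\Rightarrow U_x$ is moreover a collapse of $M$ regarded as an $(M,M)$-bimodule. The *kernel* of $f\colon c\to d$ is the monoid $U_d(f,f)$ on $c$ for which the cartesian cell $U_d(f,f)\Rightarrow U_d$ is an embedding over $f$; $f$ is a *regular cover* if this embedding is a normal collapse. A monoid is *effective* if it is the kernel of a vertical arrow, that is, if it has an embedding $i$ with $\vec\imath$ cartesian; a bimodule is *effective* if it has a cartesian embedding into some proarrow. A virtual equipment is *regular* if (1) every effective monoid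 has a normal collapse, and (2) for all regular covers $f\colon c\to d$, $g\colon c'\to d'$ and every proarrow $B\colon d\nrightarrow d'$, the cartesian embedding of $B(g,f)$ (as a bimodule between the kernels of $f$ and $g$) into $B$ is a collapse. It is *exact* if it is regular and every monoid and every bimodule in it is effective. **Proposition.** For every virtual equipment $\mathbb{D}$, the virtual double category $\mathbb{M}\mathrm{od}(\mathbb{D})$ is a virtual equipment, and it is exact. Moreover, every monoid $M$ in $\mathbb{M}\mathrm{od}(\mathbb{D})$ has a collapse $i$ with $\vec\imath$ cartesian, and every bimodule in $\mathbb{M}\mathrm{od}(\mathbb{D})$ has a collapse that is a cartesian embedding. -/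

import Mathlib

open CategoryTheory

universe u v w z

/-- Composable strings `a ⇸ ⋯ ⇸ b` of proarrows, possibly empty. -/
inductive ProPath {O : Type u} (P : O → O → Type w) : O → O → Type (max u w)
  | nil (a : O) : ProPath P a a
  | cons {a b c : O} (A : P a b) (p : ProPath P b c) : ProPath P a c

namespace ProPath

variable {O : Type u} {P : O → O → Type w}

/-- The string consisting of one proarrow. -/
abbrev single {a b : O} (A : P a b) : ProPath P a b := cons A (nil b)

/-- The string consisting of two proarrows. -/
abbrev pair {a b c : O} (A : P a b) (B : P b c) : ProPath P a c := cons A (cons B (nil c))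

/-- Concatenation of strings. -/
def append {a b c : O} : ProPath P a b → ProPath P b c → ProPath P a c
  | nil _, q => q
  | cons A p, q => cons A (append p q)

@[simp] theorem nil_append {a b : O} (q : ProPath P a b) : (nil a).append q = q := rfl

@[simp] theorem cons_append {a b c d : O} (A : P a b) (p : ProPath P b c) (q : ProPath P c d) :
    (cons A p).append q = cons A (p.append q) := rfl

@[simp] theorem append_nil {a b : O} : ∀ p : ProPath P a b, p.append (nil b) = p
  | nil _ => rfl
  | cons A p => congrArg (cons A) (append_nil p)

theorem append_assoc {a b c d : O} : ∀ (p : ProPath P a b) (q : ProPath P b c)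
    (r : ProPath P c d), (p.append q).append r = p.append (q.append r)
  | nil _, _, _ => rfl
  | cons A p, q, r => congrArg (cons A) (append_assoc p q r)

/-- The image of a string under a map of objects and proarrows. -/
def map {O' : Type*} {P' : O' → O' → Type*} (F : O → O') (G : ∀ {a b}, P a b → P' (F a) (F b))
    {a b : O} : ProPath P a b → ProPath P' (F a) (F b)
  | nil a => nil (F a)
  | cons A p => cons (G A) (map F G p)

theorem map_append {O' : Type*} {P' : O' → O' → Type*} (F : O → O')
    (G : ∀ {a b}, P a b → P' (F a) (F b)) {a b c : O} : ∀ (p : ProPath P a b) (q : ProPath P b c),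
    (p.append q).map F G = (p.map F G).append (q.map F G)
  | nil _, _ => rfl
  | cons A p, q => congrArg (cons (G A)) (map_append F G p q)

end ProPath

/-- The shape of a virtual double category: a vertical category, proarrows, and 2-cells
`Cell f g p B` with left frame `f`, right frame `g`, source the string `p` and target `B`. -/
structure VDShape where
  Obj : Type u
  [cat : Category.{v} Obj]
  Pro : Obj → Obj → Type w
  Cell : ∀ {a b c d : Obj}, (a ⟶ c) → (b ⟶ d) → ProPath Pro a b → Pro c d → Type z

attribute [instance] VDShape.cat

namespace VDShape

/-- Strings of proarrows of `S`. -/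
abbrev Path (S : VDShape.{u, v, w, z}) : S.Obj → S.Obj → Type (max u w) := ProPath S.Pro

/-- Strings of horizontally adjacent 2-cells. `CellSeq f g p q` has outer frames `f` and `g`; the
targets of its cells form the string `q`, and the concatenation of their sources is `p`. -/
inductive CellSeq (S : VDShape.{u, v, w, z}) : ∀ {a b c d : S.Obj}, (a ⟶ c) → (b ⟶ d) →
    S.Path a b → S.Path c d → Type (max u v w z)
  | nil {a c : S.Obj} (f : a ⟶ c) : CellSeq S f f (.nil a) (.nil c)
  | cons {a b c a' b' c' : S.Obj} {f : a ⟶ a'} {g : b ⟶ b'} {h : c ⟶ c'} {p : S.Path a b}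
      {q : S.Path b c} {s : S.Path a c} {A : S.Pro a' b'} {r : S.Path b' c'}
      (φ : S.Cell f g p A) (Φ : CellSeq S g h q r) (e : s = p.append q) :
      CellSeq S f h s (.cons A r)

namespace CellSeq

variable {S : VDShape.{u, v, w, z}}

/-- Transport along equalities of the source and target strings. -/
def cast {a b c d : S.Obj} {f : a ⟶ c} {g : b ⟶ d} {p p' : S.Path a b} {q q' : S.Path c d}
    (Φ : S.CellSeq f g p q) (ep : p' = p) (eq : q' = q) : S.CellSeq f g p' q' := by
  subst ep eq; exact Φ

@[simp] theorem cast_rfl {a b c d : S.Obj} {f : a ⟶ c} {g : b ⟶ d} {p : S.Path a b}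
    {q : S.Path c d} (Φ : S.CellSeq f g p q) (ep : p = p) (eq : q = q) : Φ.cast ep eq = Φ := rfl

/-- Concatenation of strings of cells. -/
def append {a b c a' b' c' : S.Obj} {f : a ⟶ a'} {g : b ⟶ b'} {h : c ⟶ c'} {p : S.Path a b}
    {p' : S.Path b c} {q : S.Path a' b'} {q' : S.Path b' c'} :
    S.CellSeq f g p q → S.CellSeq g h p' q' → S.CellSeq f h (p.append p') (q.append q')
  | nil _, Ψ => Ψ
  | cons φ Φ e, Ψ => cons φ (append Φ Ψ) (by rw [e, ProPath.append_assoc])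

/-- A string consisting of one cell. -/
def single {a b c d : S.Obj} {f : a ⟶ c} {g : b ⟶ d} {p : S.Path a b} {A : S.Pro c d}
    (φ : S.Cell f g p A) : S.CellSeq f g p (.single A) :=
  cons φ (nil g) (ProPath.append_nil p).symm

/-- A string consisting of two cells. -/
def pair {a b c a' b' c' : S.Obj} {f : a ⟶ a'} {g : b ⟶ b'} {h : c ⟶ c'} {p : S.Path a b}
    {q : S.Path b c} {s : S.Path a c} {A : S.Pro a' b'} {B : S.Pro b' c'} (φ : S.Cell f g p A)
    (ψ : S.Cell g h q B) (e : s = p.append q := by rfl) : S.CellSeq f h s (.pair A B) :=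
  cons φ (single ψ) e

/-- A string of cells cut into two strings. -/
structure Cut {a b c c' c'' : S.Obj} (f : a ⟶ c) (g : b ⟶ c'') (p : S.Path a b)
    (q₁ : S.Path c c') (q₂ : S.Path c' c'') where
  {mid : S.Obj}
  {frame : mid ⟶ c'}
  {src₁ : S.Path a mid}
  {src₂ : S.Path mid b}
  fst : S.CellSeq f frame src₁ q₁
  snd : S.CellSeq frame g src₂ q₂
  eq : p = src₁.append src₂

/-- Putting one more cell in front of a string that has been cut. -/
def Cut.cons {a a₁ b c c₁ c' c'' : S.Obj} {f : a ⟶ c} {f₁ : a₁ ⟶ c₁} {g : b ⟶ c''}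
    {p : S.Path a a₁} {q : S.Path a₁ b} {s : S.Path a b} {A : S.Pro c c₁} {q₁ : S.Path c₁ c'}
    {q₂ : S.Path c' c''} (φ : S.Cell f f₁ p A) (C : Cut f₁ g q q₁ q₂) (e : s = p.append q) :
    Cut f g s (.cons A q₁) q₂ :=
  ⟨.cons φ C.fst rfl, C.snd, by
    rw [e, ProPath.append_assoc]; exact congrArg _ C.eq⟩

/-- Cutting a string of cells according to a decomposition of its target. -/
def cut : ∀ {a b c c' c'' : S.Obj} {f : a ⟶ c} {g : b ⟶ c''} {p : S.Path a b}
    (q₁ : S.Path c c') {q₂ : S.Path c' c''}, S.CellSeq f g p (q₁.append q₂) → Cut f g p q₁ q₂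
  | _, _, _, _, _, f, _, _, .nil _, _, Φ => ⟨nil f, Φ, rfl⟩
  | _, _, _, _, _, _, _, _, .cons A q₁, q₂, Φ =>
    match (Φ : S.CellSeq _ _ _ (.cons A (q₁.append q₂))) with
    | cons φ Φ e => .cons φ (cut q₁ Φ) e

theorem cut_append {a b c a' b' c' : S.Obj} {f : a ⟶ a'} {g : b ⟶ b'} {h : c ⟶ c'}
    {p : S.Path a b} {p' : S.Path b c} {q : S.Path a' b'} {q' : S.Path b' c'}
    (Φ : S.CellSeq f g p q) (Ψ : S.CellSeq g h p' q') :
    cut q (Φ.append Ψ) = ⟨Φ, Ψ, rfl⟩ := by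
  induction Φ with
  | nil f => rfl
  | cons φ Φ e ih =>
    subst e
    change Cut.cons φ (cut _ (append Φ Ψ)) (ProPath.append_assoc _ _ _) = _
    rw [ih]
    rfl

end CellSeq

end VDShape

/-- The operations of a virtual double category: identity 2-cells, and the composition of a 2-cell
with a string of 2-cells whose targets form its source. The frames of the composite are recorded up
to an equality, as composition of vertical arrows is associative and unital only propositionally. -/
structure VDOps extends VDShape.{u, v, w, z} where
  idCell : ∀ {a b : Obj} (A : Pro a b), Cell (𝟙 a) (𝟙 b) (.single A) A
  comp : ∀ {a b c d e e' : Obj} {h : a ⟶ c} {k : b ⟶ d} {f : c ⟶ e} {g : d ⟶ e'}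
    {p : ProPath Pro a b} {q : ProPath Pro c d} {B : Pro e e'} {f' : a ⟶ e} {g' : b ⟶ e'},
    toVDShape.CellSeq h k p q → Cell f g q B → f' = h ≫ f → g' = k ≫ g → Cell f' g' p B

namespace VDOps

variable (D : VDOps.{u, v, w, z})

/-- The string of identity cells on a string of proarrows. -/
def idSeq : ∀ {a b : D.Obj} (p : D.Path a b), D.CellSeq (𝟙 a) (𝟙 b) p p
  | _, _, .nil a => .nil (𝟙 a)
  | _, _, .cons A p => .cons (D.idCell A) (idSeq p) rfl

variable {D}

/-- Composition of a string of cells `Φ` with a string of cells `Ψ` whose source is the target of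
`Φ`: each cell of `Ψ` is composed with the corresponding part of `Φ`. -/
def compSeq : ∀ {a b c d e e' : D.Obj} {h : a ⟶ c} {k : b ⟶ d} {f : c ⟶ e} {g : d ⟶ e'}
    {p : D.Path a b} {q : D.Path c d} {r : D.Path e e'} {f' : a ⟶ e} {g' : b ⟶ e'},
    D.CellSeq h k p q → D.CellSeq f g q r → f' = h ≫ f → g' = k ≫ g → D.CellSeq f' g' p r
  | _, _, _, _, _, _, _, _, _, _, _, _, _, _, _, .nil h, .nil f, ef, eg => by
    subst ef eg; exact .nil (h ≫ f)
  | _, _, _, _, _, _, _, _, _, _, _, _, _, _, _, Φ, .cons (p := q₁) ψ Ψ e, ef, eg =>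
    let C := (Φ.cast rfl e.symm).cut q₁
    .cons (D.comp C.fst ψ ef rfl) (compSeq C.snd Ψ rfl eg) C.eq

end VDOps

/-- A virtual double category. -/
structure VirtualDoubleCategory extends VDOps.{u, v, w, z} where
  id_comp : ∀ {a b c d : Obj} {f : a ⟶ c} {g : b ⟶ d} {p : ProPath Pro a b} {B : Pro c d}
    (φ : Cell f g p B), comp (toVDOps.idSeq p) φ (Category.id_comp f).symm
      (Category.id_comp g).symm = φ
  comp_id : ∀ {a b c d : Obj} {f : a ⟶ c} {g : b ⟶ d} {p : ProPath Pro a b} {B : Pro c d}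
    (φ : Cell f g p B), comp (.single φ) (idCell B) (Category.comp_id f).symm
      (Category.comp_id g).symm = φ
  assoc : ∀ {a b a₁ b₁ a₂ b₂ a₃ b₃ : Obj} {f₁ : a ⟶ a₁} {g₁ : b ⟶ b₁} {f₂ : a₁ ⟶ a₂}
    {g₂ : b₁ ⟶ b₂} {f₃ : a₂ ⟶ a₃} {g₃ : b₂ ⟶ b₃} {p : ProPath Pro a b} {q : ProPath Pro a₁ b₁}
    {r : ProPath Pro a₂ b₂} {B : Pro a₃ b₃} (Φ : toVDShape.CellSeq f₁ g₁ p q)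
    (Ψ : toVDShape.CellSeq f₂ g₂ q r) (χ : Cell f₃ g₃ r B),
    comp (VDOps.compSeq (D := toVDOps) Φ Ψ rfl rfl) χ (Category.assoc f₁ f₂ f₃).symm
      (Category.assoc g₁ g₂ g₃).symm = comp Φ (comp Ψ χ rfl rfl) rfl rfl

namespace ProPath

variable {O : Type u} {P : O → O → Type w}

theorem append_left_cancel {a b c : O} : ∀ (p : ProPath P a b) {q q' : ProPath P b c},
    p.append q = p.append q' → q = q'
  | nil _, _, _, h => h
  | cons A p, _, _, h => append_left_cancel p (by
      simp only [cons_append] at h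
      injection h)

end ProPath

namespace VDShape

variable {S : VDShape.{u, v, w, z}}

/-- A 2-cell together with its boundary. -/
structure AnyCell (S : VDShape.{u, v, w, z}) where
  {a b c d : S.Obj}
  {f : a ⟶ c}
  {g : b ⟶ d}
  {p : S.Path a b}
  {B : S.Pro c d}
  cell : S.Cell f g p B

namespace CellSeq

/-- The list of the cells of a string of cells. -/
def toList {a b c d : S.Obj} {f : a ⟶ c} {g : b ⟶ d} {p : S.Path a b} {q : S.Path c d} :
    S.CellSeq f g p q → List S.AnyCell
  | nil _ => []
  | cons φ Φ _ => ⟨φ⟩ :: toList Φ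

@[simp] theorem toList_nil {a c : S.Obj} (f : a ⟶ c) : (nil f : S.CellSeq _ _ _ _).toList = [] := rfl

@[simp] theorem toList_cons {a b c a' b' c' : S.Obj} {f : a ⟶ a'} {g : b ⟶ b'} {h : c ⟶ c'}
    {p : S.Path a b} {q : S.Path b c} {s : S.Path a c} {A : S.Pro a' b'} {r : S.Path b' c'}
    (φ : S.Cell f g p A) (Φ : CellSeq S g h q r) (e : s = p.append q) :
    (cons φ Φ e).toList = ⟨φ⟩ :: Φ.toList := rfl

@[simp] theorem toList_single {a b c d : S.Obj} {f : a ⟶ c} {g : b ⟶ d} {p : S.Path a b}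
    {A : S.Pro c d} (φ : S.Cell f g p A) : (single φ).toList = [⟨φ⟩] := rfl

@[simp] theorem toList_pair {a b c a' b' c' : S.Obj} {f : a ⟶ a'} {g : b ⟶ b'} {h : c ⟶ c'}
    {p : S.Path a b} {q : S.Path b c} {s : S.Path a c} {A : S.Pro a' b'} {B : S.Pro b' c'}
    (φ : S.Cell f g p A) (ψ : S.Cell g h q B) (e : s = p.append q) : (pair φ ψ e).toList = [⟨φ⟩, ⟨ψ⟩] := rfl

@[simp] theorem toList_cast {a b c d : S.Obj} {f : a ⟶ c} {g : b ⟶ d} {p p' : S.Path a b}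
    {q q' : S.Path c d} (Φ : S.CellSeq f g p q) (ep : p' = p) (eq : q' = q) :
    (Φ.cast ep eq).toList = Φ.toList := by
  subst ep eq; rfl

@[simp] theorem toList_append {a b c a' b' c' : S.Obj} {f : a ⟶ a'} {g : b ⟶ b'} {h : c ⟶ c'}
    {p : S.Path a b} {p' : S.Path b c} {q : S.Path a' b'} {q' : S.Path b' c'}
    (Φ : S.CellSeq f g p q) (Ψ : S.CellSeq g h p' q') :
    (Φ.append Ψ).toList = Φ.toList ++ Ψ.toList := by
  induction Φ with
  | nil f => rfl
  | cons φ Φ e ih => exact congrArg _ (ih Ψ)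

theorem ext_toList {a b c d : S.Obj} {f : a ⟶ c} {g : b ⟶ d} {p : S.Path a b} {q : S.Path c d}
    {Φ Ψ : S.CellSeq f g p q} (h : Φ.toList = Ψ.toList) : Φ = Ψ := by
  induction Φ with
  | nil f => cases Ψ; rfl
  | cons φ Φ e ih =>
    cases Ψ with
    | cons ψ Ψ e' =>
      simp only [toList_cons, List.cons.injEq, AnyCell.mk.injEq] at h
      obtain ⟨⟨-, h₁, -, -, -, h₂, h₃, -, h₄⟩, h₅⟩ := h
      subst h₁ h₂ h₃ h₄ e
      obtain rfl := ProPath.append_left_cancel _ e'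
      rw [ih h₅]

end CellSeq

end VDShape

namespace VDOps

variable {D : VDOps.{u, v, w, z}}

theorem compSeq_nil {a b c : D.Obj} (h : a ⟶ b) (f : b ⟶ c) {f' g' : a ⟶ c} (ef : f' = h ≫ f)
    (eg : g' = h ≫ f) : (compSeq (D := D) (.nil h) (.nil f) ef eg).toList = [] := by
  subst ef eg; rfl

theorem compSeq_cons {a b b₁ c d d₁ e e' e₁ : D.Obj} {h : a ⟶ c} {k₁ : b₁ ⟶ d₁} {k : b ⟶ d}
    {f : c ⟶ e} {g₁ : d₁ ⟶ e₁} {g : d ⟶ e'} {p : D.Path a b₁} {p₁ : D.Path b₁ b}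
    {q : D.Path c d₁} {q₁ : D.Path d₁ d} {s : D.Path a b} {t : D.Path c d} {A : D.Pro e e₁}
    {r : D.Path e₁ e'} {f' : a ⟶ e} {g' : b ⟶ e'} (X : D.CellSeq h k s t) (Φ : D.CellSeq h k₁ p q)
    (Φ₁ : D.CellSeq k₁ k p₁ q₁) (hX : X.toList = Φ.toList ++ Φ₁.toList)
    (ψ : D.Cell f g₁ q A) (Ψ : D.CellSeq g₁ g q₁ r)
    (es : s = p.append p₁) (et : t = q.append q₁) (ef : f' = h ≫ f) (eg : g' = k ≫ g)
    {w : b₁ ⟶ e₁} (ew : w = k₁ ≫ g₁) :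
    compSeq X (.cons ψ Ψ et) ef eg = .cons (D.comp Φ ψ ef ew) (compSeq Φ₁ Ψ ew eg) es := by
  obtain rfl : X = (Φ.append Φ₁).cast es et := VDShape.CellSeq.ext_toList (by simpa using hX)
  subst es et ew
  have key : ∀ C : VDShape.CellSeq.Cut h k (p.append p₁) q q₁, C = ⟨Φ, Φ₁, rfl⟩ →
      VDShape.CellSeq.cons (D.comp C.fst ψ ef rfl) (compSeq C.snd Ψ rfl eg) C.eq =
        .cons (D.comp Φ ψ ef rfl) (compSeq Φ₁ Ψ rfl eg) rfl := by
    rintro _ rfl; rfl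
  rw [compSeq]
  exact key _ (VDShape.CellSeq.cut_append Φ Φ₁)

end VDOps

namespace VDOps

variable {D : VDOps.{u, v, w, z}}

@[simp] theorem idSeq_nil (a : D.Obj) : D.idSeq (.nil a) = .nil (𝟙 a) := rfl

@[simp] theorem idSeq_cons {a b c : D.Obj} (A : D.Pro a b) (p : D.Path b c) :
    D.idSeq (.cons A p) = .cons (D.idCell A) (D.idSeq p) rfl := rfl

@[simp] theorem toList_idSeq_append {a b c : D.Obj} (p : D.Path a b) (q : D.Path b c) :
    (D.idSeq (p.append q)).toList = (D.idSeq p).toList ++ (D.idSeq q).toList := by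
  induction p with
  | nil a => rfl
  | cons A p ih => exact congrArg _ (ih q)

theorem exists_cut {S : VDShape.{u, v, w, z}} {a b c c' c'' : S.Obj} {f : a ⟶ c} {g : b ⟶ c''}
    {p : S.Path a b} {t : S.Path c c''} (Φ : S.CellSeq f g p t) (q₁ : S.Path c c')
    (q₂ : S.Path c' c'') (et : t = q₁.append q₂) :
    ∃ (m : S.Obj) (k : m ⟶ c') (p₁ : S.Path a m) (p₂ : S.Path m b) (Φ₁ : S.CellSeq f k p₁ q₁)
      (Φ₂ : S.CellSeq k g p₂ q₂), p = p₁.append p₂ ∧ Φ.toList = Φ₁.toList ++ Φ₂.toList := by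
  induction q₁ generalizing a with
  | nil => exact ⟨_, f, .nil _, p, .nil f, Φ.cast rfl et.symm, rfl,
    (VDShape.CellSeq.toList_cast Φ rfl et.symm).symm⟩
  | cons A q ih =>
    rw [ProPath.cons_append] at et
    cases Φ with
    | nil f => cases et
    | cons φ Φ e =>
      cases et
      obtain ⟨m, k, p₁, p₂, Φ₁, Φ₂, h₁, h₂⟩ := ih Φ q₂ rfl
      exact ⟨m, k, _, p₂, .cons φ Φ₁ rfl, Φ₂, by rw [e, h₁, ProPath.append_assoc], by
        simp [h₂]⟩

theorem compSeq_append {a b c a₁ b₁ c₁ a₂ b₂ c₂ : D.Obj} {f : a ⟶ a₁} {g : b ⟶ b₁} {h : c ⟶ c₁}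
    {f₁ : a₁ ⟶ a₂} {g₁ : b₁ ⟶ b₂} {h₁ : c₁ ⟶ c₂} {f₂ : a ⟶ a₂} {g₂ : b ⟶ b₂} {h₂ : c ⟶ c₂}
    {p : D.Path a b} {p' : D.Path b c} {q : D.Path a₁ b₁} {q' : D.Path b₁ c₁} {r : D.Path a₂ b₂}
    {r' : D.Path b₂ c₂} {s : D.Path a c} {t : D.Path a₁ c₁} {x : D.Path a₂ c₂}
    (X : D.CellSeq f h s t) (Y : D.CellSeq f₁ h₁ t x)
    (Φ : D.CellSeq f g p q) (Φ' : D.CellSeq g h p' q') (Ψ : D.CellSeq f₁ g₁ q r)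
    (Ψ' : D.CellSeq g₁ h₁ q' r') (es : s = p.append p') (et : t = q.append q')
    (ex : x = r.append r') (hX : X.toList = Φ.toList ++ Φ'.toList)
    (hY : Y.toList = Ψ.toList ++ Ψ'.toList) (ef : f₂ = f ≫ f₁) (eg : g₂ = g ≫ g₁)
    (eh : h₂ = h ≫ h₁) :
    (compSeq X Y ef eh).toList = (compSeq Φ Ψ ef eg).toList ++ (compSeq Φ' Ψ' eg eh).toList := by
  induction Ψ generalizing a with
  | nil k =>
    cases Φ with
    | nil k' =>
      subst es et ex ef eg
      rw [compSeq_nil]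
      obtain rfl : X = Φ' := VDShape.CellSeq.ext_toList hX
      obtain rfl : Y = Ψ' := VDShape.CellSeq.ext_toList hY
      rfl
  | cons ψ Ψ e ih =>
    rename_i qa qb _ _ _
    obtain ⟨m, k, p₁, p₂, Φ₁, Φ₂, h₁, h₂⟩ := exists_cut Φ _ _ e
    subst e ex
    rw [compSeq_cons Φ Φ₁ Φ₂ h₂ ψ Ψ h₁ rfl ef eg rfl]
    subst et
    obtain rfl : Y = .cons ψ (Ψ.append Ψ') (ProPath.append_assoc _ _ _) :=
      VDShape.CellSeq.ext_toList (by simpa using hY)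
    refine (congrArg VDShape.CellSeq.toList (compSeq_cons X Φ₁ (Φ₂.append Φ') (by simp [hX, h₂]) ψ
      (Ψ.append Ψ') (by rw [es, h₁, ProPath.append_assoc]) _ ef eh rfl)).trans ?_
    simp only [VDShape.CellSeq.toList_cons, List.cons_append]
    rw [ih (X := Φ₂.append Φ') (Y := Ψ.append Ψ') (Φ := Φ₂) Φ' Ψ' rfl rfl rfl (by simp) (by simp)
      rfl eg]

theorem toList_compSeq_single {a b c a₁ b₁ : D.Obj} {b₂ : D.Obj} {f : a ⟶ a₁} {g : b ⟶ b₁}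
    {f₁ : a₁ ⟶ c} {g₁ : b₁ ⟶ b₂} {f₂ : a ⟶ c} {g₂ : b ⟶ b₂} {p : D.Path a b} {q : D.Path a₁ b₁}
    {A : D.Pro c b₂} (Φ : D.CellSeq f g p q) (ψ : D.Cell f₁ g₁ q A) (ef : f₂ = f ≫ f₁)
    (eg : g₂ = g ≫ g₁) :
    compSeq Φ (.single ψ) ef eg = .single (D.comp Φ ψ ef eg) := by
  rw [VDShape.CellSeq.single, compSeq_cons Φ Φ (.nil g) (by simp) ψ (.nil g₁) (by simp) _ ef eg eg]
  exact VDShape.CellSeq.ext_toList (by simp [compSeq_nil])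

end VDOps

namespace VirtualDoubleCategory

variable {D : VirtualDoubleCategory.{u, v, w, z}}

theorem id_compSeq {a b c d : D.Obj} {f f' : a ⟶ c} {g g' : b ⟶ d} {p : D.Path a b}
    {q : D.Path c d} (Φ : D.CellSeq f g p q) (ef : f' = 𝟙 a ≫ f) (eg : g' = 𝟙 b ≫ g) :
    (VDOps.compSeq (D.idSeq p) Φ ef eg).toList = Φ.toList := by
  induction Φ with
  | nil f => exact VDOps.compSeq_nil _ _ _ _
  | cons φ Φ e ih =>
    subst e
    obtain rfl := ef.trans (Category.id_comp _)
    rw [VDOps.compSeq_cons (D.idSeq _) (D.idSeq _) (D.idSeq _) (by simp) φ Φ rfl rfl _ eg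
      (Category.id_comp _).symm, D.id_comp]
    exact congrArg _ (ih _ _)

theorem compSeq_id {a b c d : D.Obj} {f f' : a ⟶ c} {g g' : b ⟶ d} {p : D.Path a b}
    {q : D.Path c d} (Φ : D.CellSeq f g p q) (ef : f' = f ≫ 𝟙 c) (eg : g' = g ≫ 𝟙 d) :
    (VDOps.compSeq Φ (D.idSeq q) ef eg).toList = Φ.toList := by
  induction Φ with
  | nil f => exact VDOps.compSeq_nil _ _ _ _
  | cons φ Φ e ih =>
    subst e
    obtain rfl := ef.trans (Category.comp_id _)
    rw [VDOps.idSeq_cons, VDOps.compSeq_cons (.cons φ Φ rfl) (.single φ) Φ (by simp) _ _ rfl rfl _ eg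
      (Category.comp_id _).symm, D.comp_id]
    exact congrArg _ (ih _ _)

theorem comp_comp {a b a₁ b₁ a₂ b₂ a₃ b₃ : D.Obj} {f₁ : a ⟶ a₁} {g₁ : b ⟶ b₁} {f₂ : a₁ ⟶ a₂}
    {g₂ : b₁ ⟶ b₂} {f₃ : a₂ ⟶ a₃} {g₃ : b₂ ⟶ b₃} {p : D.Path a b} {q : D.Path a₁ b₁}
    {r : D.Path a₂ b₂} {B : D.Pro a₃ b₃} {f₂₃ : a₁ ⟶ a₃} {g₂₃ : b₁ ⟶ b₃} {f : a ⟶ a₃} {g : b ⟶ b₃}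
    {f₁₂ : a ⟶ a₂} {g₁₂ : b ⟶ b₂} (Φ : D.CellSeq f₁ g₁ p q) (Ψ : D.CellSeq f₂ g₂ q r)
    (χ : D.Cell f₃ g₃ r B) (e₁ : f₂₃ = f₂ ≫ f₃) (e₂ : g₂₃ = g₂ ≫ g₃) (e₃ : f = f₁ ≫ f₂₃)
    (e₄ : g = g₁ ≫ g₂₃) (Ω : D.CellSeq f₁₂ g₁₂ p r) (e₅ : f₁₂ = f₁ ≫ f₂) (e₆ : g₁₂ = g₁ ≫ g₂)
    (hΩ : (VDOps.compSeq Φ Ψ e₅ e₆).toList = Ω.toList) :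
    D.comp Φ (D.comp Ψ χ e₁ e₂) e₃ e₄ =
      D.comp Ω χ (by rw [e₃, e₁, e₅, Category.assoc]) (by rw [e₄, e₂, e₆, Category.assoc]) := by
  obtain rfl := VDShape.CellSeq.ext_toList hΩ
  subst e₁ e₂ e₃ e₄ e₅ e₆
  exact (D.assoc Φ Ψ χ).symm

end VirtualDoubleCategory

namespace VirtualDoubleCategory

open VDShape (CellSeq)

variable {D : VirtualDoubleCategory.{u, v, w, z}}

theorem comp_single {a b a₁ b₁ a₂ b₂ a₃ b₃ : D.Obj} {f₁ : a ⟶ a₁} {g₁ : b ⟶ b₁} {f₂ : a₁ ⟶ a₂}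
    {g₂ : b₁ ⟶ b₂} {f₃ : a₂ ⟶ a₃} {g₃ : b₂ ⟶ b₃} {p : D.Path a b} {q : D.Path a₁ b₁}
    {A : D.Pro a₂ b₂} {B : D.Pro a₃ b₃} {f₂₃ : a₁ ⟶ a₃} {g₂₃ : b₁ ⟶ b₃} {f : a ⟶ a₃} {g : b ⟶ b₃}
    {f₁₂ : a ⟶ a₂} {g₁₂ : b ⟶ b₂} (Φ : D.CellSeq f₁ g₁ p q) (ψ : D.Cell f₂ g₂ q A)
    (χ : D.Cell f₃ g₃ (.single A) B) (e₁ : f₂₃ = f₂ ≫ f₃) (e₂ : g₂₃ = g₂ ≫ g₃) (e₃ : f = f₁ ≫ f₂₃)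
    (e₄ : g = g₁ ≫ g₂₃) (e₅ : f₁₂ = f₁ ≫ f₂) (e₆ : g₁₂ = g₁ ≫ g₂) :
    D.comp Φ (D.comp (.single ψ) χ e₁ e₂) e₃ e₄ =
      D.comp (.single (D.comp Φ ψ e₅ e₆)) χ (by rw [e₃, e₁, e₅, Category.assoc])
        (by rw [e₄, e₂, e₆, Category.assoc]) :=
  comp_comp Φ _ χ e₁ e₂ e₃ e₄ _ e₅ e₆ (by rw [VDOps.toList_compSeq_single])

theorem comp_pair {a b c a₁ b₁ c₁ a₂ b₂ c₂ a₃ c₃ : D.Obj} {f₁ : a ⟶ a₁} {g₁ : b ⟶ b₁}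
    {h₁ : c ⟶ c₁} {f₂ : a₁ ⟶ a₂} {g₂ : b₁ ⟶ b₂} {h₂ : c₁ ⟶ c₂} {f₃ : a₂ ⟶ a₃} {h₃ : c₂ ⟶ c₃}
    {p : D.Path a b} {p' : D.Path b c} {q : D.Path a₁ b₁} {q' : D.Path b₁ c₁} {s : D.Path a c}
    {A : D.Pro a₂ b₂} {A' : D.Pro b₂ c₂} {B : D.Pro a₃ c₃} {f₂₃ : a₁ ⟶ a₃} {h₂₃ : c₁ ⟶ c₃}
    {f : a ⟶ a₃} {h : c ⟶ c₃} {f₁₂ : a ⟶ a₂} {g₁₂ : b ⟶ b₂} {h₁₂ : c ⟶ c₂}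
    {t : D.Path a₁ c₁}
    (X : D.CellSeq f₁ h₁ s t) (Φ : D.CellSeq f₁ g₁ p q) (Φ' : D.CellSeq g₁ h₁ p' q')
    (ψ : D.Cell f₂ g₂ q A) (ψ' : D.Cell g₂ h₂ q' A')
    (χ : D.Cell f₃ h₃ (.pair A A') B) (es : s = p.append p') (et : t = q.append q')
    (hX : X.toList = Φ.toList ++ Φ'.toList) (e₁ : f₂₃ = f₂ ≫ f₃) (e₂ : h₂₃ = h₂ ≫ h₃)
    (e₃ : f = f₁ ≫ f₂₃) (e₄ : h = h₁ ≫ h₂₃) (e₅ : f₁₂ = f₁ ≫ f₂) (e₆ : g₁₂ = g₁ ≫ g₂)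
    (e₇ : h₁₂ = h₁ ≫ h₂) :
    D.comp X (D.comp (.pair ψ ψ' et) χ e₁ e₂) e₃ e₄ =
      D.comp (.pair (D.comp Φ ψ e₅ e₆) (D.comp Φ' ψ' e₆ e₇) es) χ
        (by rw [e₃, e₁, e₅, Category.assoc]) (by rw [e₄, e₂, e₇, Category.assoc]) := by
  refine comp_comp X _ χ e₁ e₂ e₃ e₄ _ e₅ e₇ ?_
  rw [CellSeq.pair, VDOps.compSeq_cons X Φ Φ' hX ψ (.single ψ') es et e₅ e₇ e₆,
    VDOps.toList_compSeq_single]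
  rfl

variable (D)

/-- Monoids `(c, M, e, m)` in a virtual double category. -/
structure Mon where
  obj : D.Obj
  pro : D.Pro obj obj
  unit : D.Cell (𝟙 obj) (𝟙 obj) (.nil obj) pro
  mul : D.Cell (𝟙 obj) (𝟙 obj) (.pair pro pro) pro
  unit_mul : D.comp (.pair unit (D.idCell pro)) mul (by simp) (by simp) = D.idCell pro
  mul_unit : D.comp (.pair (D.idCell pro) unit) mul (by simp) (by simp) = D.idCell pro
  mul_assoc : D.comp (p := .cons pro (.pair pro pro)) (f' := 𝟙 obj) (g' := 𝟙 obj) (.pair mul (D.idCell pro)) mul (by simp) (by simp) =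
    D.comp (.pair (D.idCell pro) mul) mul (by simp) (by simp)

variable {D}

namespace Mon

/-- Monoid homomorphisms. -/
@[ext] structure Hom (M N : D.Mon) where
  hom : M.obj ⟶ N.obj
  cell : D.Cell hom hom (.single M.pro) N.pro
  unit_cell : D.comp (f' := hom) (g' := hom) (.single M.unit) cell (by simp) (by simp) =
    D.comp (.nil hom) N.unit (by simp) (by simp)
  mul_cell : D.comp (f' := hom) (g' := hom) (.single M.mul) cell (by simp) (by simp) =
    D.comp (.pair cell cell) N.mul (by simp) (by simp)

theorem Hom.ext' {M N : D.Mon} {f g : Hom M N} (h : f.hom = g.hom)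
    (hc : D.comp (f' := g.hom) (g' := g.hom) (.single f.cell) (D.idCell N.pro) (by simp [h])
      (by simp [h]) = g.cell) : f = g := by
  obtain ⟨f, φ, _, _⟩ := f
  obtain ⟨g, ψ, _, _⟩ := g
  obtain rfl : f = g := h
  obtain rfl : φ = ψ := (D.comp_id φ).symm.trans hc
  rfl

/-- The identity homomorphism. -/
def Hom.id (M : D.Mon) : Hom M M where
  hom := 𝟙 M.obj
  cell := D.idCell M.pro
  unit_cell := (D.comp_id M.unit).trans (D.id_comp M.unit).symm
  mul_cell := (D.comp_id M.mul).trans (D.id_comp M.mul).symm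

/-- Composition of monoid homomorphisms. -/
def Hom.comp {M N P : D.Mon} (f : Hom M N) (g : Hom N P) : Hom M P where
  hom := f.hom ≫ g.hom
  cell := D.comp (.single f.cell) g.cell rfl rfl
  unit_cell := by
    rw [comp_single (f₁₂ := f.hom) (g₁₂ := f.hom) _ _ _ _ _ _ _ (by simp) (by simp), f.unit_cell,
      ← comp_single (f₂₃ := g.hom) (g₂₃ := g.hom) _ _ _ (by simp) (by simp) rfl rfl, g.unit_cell]
    exact comp_comp _ _ _ _ _ _ _ _ rfl rfl (VDOps.compSeq_nil _ _ _ _)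
  mul_cell := by
    rw [comp_single (f₁₂ := f.hom) (g₁₂ := f.hom) _ _ _ _ _ _ _ (by simp) (by simp), f.mul_cell,
      ← comp_single (f₂₃ := g.hom) (g₂₃ := g.hom) _ _ _ (by simp) (by simp) rfl rfl, g.mul_cell]
    exact comp_pair _ (.single f.cell) (.single f.cell) _ _ _ rfl rfl rfl _ _ _ _ _ _ _

instance : Category D.Mon where
  Hom := Hom
  id := Hom.id
  comp := Hom.comp
  id_comp {M N} f := Hom.ext' (Category.id_comp _) ((comp_single (f₂₃ := f.hom) (g₂₃ := f.hom)
    (.single (D.idCell M.pro)) f.cell (D.idCell N.pro) (by simp) (by simp) (by simp) (by simp) rfl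
    rfl).symm.trans ((congrArg (fun x => D.comp _ x _ _) (D.comp_id _)).trans (D.id_comp f.cell)))
  comp_id {M N} f := Hom.ext' (Category.comp_id _) ((comp_single (f₂₃ := 𝟙 _) (g₂₃ := 𝟙 _)
    (.single f.cell) (D.idCell N.pro) (D.idCell N.pro) (by simp) (by simp) (by simp) (by simp) rfl
    rfl).symm.trans ((congrArg (fun x => D.comp _ x _ _) (D.comp_id _)).trans (D.comp_id f.cell)))
  assoc {M N P Q} f g h := Hom.ext' (Category.assoc _ _ _) ((comp_single (f₂₃ := h.hom)
    (g₂₃ := h.hom) (.single (f.comp g).cell) h.cell (D.idCell Q.pro) (by simp) (by simp)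
    (by simp [Hom.comp]) (by simp [Hom.comp]) rfl rfl).symm.trans
    ((congrArg (fun x => D.comp _ x _ _) (D.comp_id _)).trans
      (comp_single _ _ _ _ _ _ _ rfl rfl).symm))

end Mon

end VirtualDoubleCategory

namespace VDOps

/-- The string of cells `Ξ`, with identity frames, surrounded by identity cells. -/
def whisker (D : VDOps.{u, v, w, z}) {a b c d : D.Obj} (q : D.Path a b) {s t : D.Path b c}
    (Ξ : D.CellSeq (𝟙 b) (𝟙 c) s t) (r : D.Path c d) {s' t' : D.Path a d}
    (es : s' = q.append (s.append r)) (et : t' = q.append (t.append r)) :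
    D.CellSeq (𝟙 a) (𝟙 d) s' t' :=
  ((D.idSeq q).append (Ξ.append (D.idSeq r))).cast es et

end VDOps

namespace VirtualDoubleCategory

open VDShape (CellSeq)

variable {D : VirtualDoubleCategory.{u, v, w, z}}

/-- Bimodules between monoids. -/
structure Bimod (M N : D.Mon) where
  pro : D.Pro M.obj N.obj
  l : D.Cell (𝟙 M.obj) (𝟙 N.obj) (.pair M.pro pro) pro
  r : D.Cell (𝟙 M.obj) (𝟙 N.obj) (.pair pro N.pro) pro
  unit_l : D.comp (.pair M.unit (D.idCell pro)) l (by simp) (by simp) = D.idCell pro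
  unit_r : D.comp (.pair (D.idCell pro) N.unit) r (by simp) (by simp) = D.idCell pro
  assoc_l : D.comp (p := .cons M.pro (.pair M.pro pro)) (f' := 𝟙 _) (g' := 𝟙 _)
      (.pair M.mul (D.idCell pro)) l (by simp) (by simp) =
    D.comp (.pair (D.idCell M.pro) l) l (by simp) (by simp)
  assoc_r : D.comp (p := .cons pro (.pair N.pro N.pro)) (f' := 𝟙 _) (g' := 𝟙 _)
      (.pair (D.idCell pro) N.mul) r (by simp) (by simp) =
    D.comp (.pair r (D.idCell N.pro)) r (by simp) (by simp)
  assoc_lr : D.comp (p := .cons M.pro (.pair pro N.pro)) (f' := 𝟙 _) (g' := 𝟙 _)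
      (.pair l (D.idCell N.pro)) r (by simp) (by simp) =
    D.comp (.pair (D.idCell M.pro) r) l (by simp) (by simp)

/-- The string of proarrows underlying a string of bimodules. -/
def und {M N : D.Mon} (p : ProPath (Bimod (D := D)) M N) : D.Path M.obj N.obj :=
  p.map Mon.obj Bimod.pro

@[simp] theorem und_nil (M : D.Mon) : und (.nil M) = .nil M.obj := rfl

@[simp] theorem und_cons {M N P : D.Mon} (B : Bimod M N) (p : ProPath (Bimod (D := D)) N P) :
    und (.cons B p) = .cons B.pro (und p) := rfl

@[simp] theorem und_append {M N P : D.Mon} (p : ProPath (Bimod (D := D)) M N)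
    (q : ProPath (Bimod (D := D)) N P) : und (p.append q) = (und p).append (und q) :=
  ProPath.map_append _ _ p q

/-- Compatibility with the actions for a cell `φ` whose source is an empty string of bimodules:
letting `M` act on the target of `φ` from the left or from the right gives the same. -/
def NilCompat {M' N' : D.Mon} (C : Bimod M' N') : ∀ {M N : D.Mon}
    (p : ProPath (Bimod (D := D)) M N) (f : Mon.Hom M M') (g : Mon.Hom N N'),
    D.Cell f.hom g.hom (und p) C.pro → Prop
  | _, _, .nil M, f, g, φ =>
    D.comp (p := .single M.pro) (f' := f.hom) (g' := g.hom) (.pair f.cell φ) C.l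
        (by simp) (by simp) =
      D.comp (.pair φ g.cell) C.r (by simp) (by simp)
  | _, _, .cons _ _, _, _, _ => True

/-- Bimodule homomorphisms: a cell from (the underlying proarrows of) a string of bimodules to a
bimodule, with frames underlying monoid homomorphisms, is compatible with the outer actions and
equalizes the inner actions. -/
structure IsBimodHom {M N M' N' : D.Mon} (f : Mon.Hom M M') (g : Mon.Hom N N')
    (p : ProPath (Bimod (D := D)) M N) (C : Bimod M' N') (φ : D.Cell f.hom g.hom (und p) C.pro) :
    Prop where
  left : ∀ {L : D.Mon} (B : Bimod M L) (q : ProPath (Bimod (D := D)) L N) (e : p = .cons B q),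
    D.comp (p := .cons M.pro (und p)) (f' := f.hom) (g' := g.hom)
        (D.whisker (.nil _) (.single B.l) (und q) (by rw [e]; rfl) (by rw [e]; rfl)) φ
        (by simp) (by simp) =
      D.comp (.pair f.cell φ) C.l (by simp) (by simp)
  right : ∀ {L : D.Mon} (q : ProPath (Bimod (D := D)) M L) (B : Bimod L N)
    (e : p = q.append (.single B)),
    D.comp (p := (und p).append (.single N.pro)) (f' := f.hom) (g' := g.hom)
        (D.whisker (und q) (.single B.r) (.nil _) (by rw [e, und_append, ProPath.append_assoc]; rfl)
          (by rw [e, und_append]; rfl)) φ (by simp) (by simp) =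
      D.comp (.pair φ g.cell) C.r (by simp) (by simp)
  inner : ∀ {K L K' : D.Mon} (q : ProPath (Bimod (D := D)) M K) (B : Bimod K L) (B' : Bimod L K')
    (r : ProPath (Bimod (D := D)) K' N) (e : p = q.append (.cons B (.cons B' r))),
    D.comp (p := (und q).append (.cons B.pro (.cons L.pro (.cons B'.pro (und r)))))
        (f' := f.hom) (g' := g.hom)
        (D.whisker (und q) (s := .cons B.pro (.pair L.pro B'.pro)) (.pair B.r (D.idCell B'.pro))
          (und r) rfl (by rw [e, und_append]; rfl)) φ (by simp) (by simp) =
      D.comp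
        (D.whisker (und q) (s := .cons B.pro (.pair L.pro B'.pro)) (.pair (D.idCell B.pro) B'.l)
          (und r) rfl (by rw [e, und_append]; rfl)) φ (by simp) (by simp)
  nil : NilCompat C p f g φ

variable (D)

/-- The objects, vertical arrows, proarrows and 2-cells of the virtual double category of monoids
and modules. -/
@[reducible] def modShape : VDShape.{max u w z, max v z, max w z, z} where
  Obj := D.Mon
  Pro := Bimod
  Cell {_ _ _ _} f g p C :=
    {φ : D.Cell (Mon.Hom.hom f) (Mon.Hom.hom g) (und p) C.pro // IsBimodHom f g p C φ}

end VirtualDoubleCategory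

namespace VirtualDoubleCategory

open VDShape (CellSeq)

variable {D : VirtualDoubleCategory.{u, v, w, z}}

theorem exists_append {S : VDShape.{u, v, w, z}} {a b c a' b' c' : S.Obj} {f : a ⟶ a'} {g : b ⟶ b'}
    {h : c ⟶ c'} {p : S.Path a b} {p' : S.Path b c} {q : S.Path a' b'} {q' : S.Path b' c'}
    {s : S.Path a c} {t : S.Path a' c'} (Φ : S.CellSeq f g p q) (Ψ : S.CellSeq g h p' q')
    (es : s = p.append p') (et : t = q.append q') :
    ∃ Z : S.CellSeq f h s t, Z.toList = Φ.toList ++ Ψ.toList :=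
  ⟨(Φ.append Ψ).cast es et, by simp⟩

theorem toList_compSeq_pair {a b c a₁ b₁ c₁ a₂ b₂ c₂ : D.Obj} {f₁ : a ⟶ a₁} {g₁ : b ⟶ b₁}
    {h₁ : c ⟶ c₁} {f₂ : a₁ ⟶ a₂} {g₂ : b₁ ⟶ b₂} {h₂ : c₁ ⟶ c₂} {p : D.Path a b} {p' : D.Path b c}
    {q : D.Path a₁ b₁} {q' : D.Path b₁ c₁} {s : D.Path a c} {t : D.Path a₁ c₁} {A : D.Pro a₂ b₂}
    {A' : D.Pro b₂ c₂} {f₁₂ : a ⟶ a₂} {g₁₂ : b ⟶ b₂} {h₁₂ : c ⟶ c₂} (X : D.CellSeq f₁ h₁ s t)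
    (Φ : D.CellSeq f₁ g₁ p q) (Φ' : D.CellSeq g₁ h₁ p' q') (ψ : D.Cell f₂ g₂ q A)
    (ψ' : D.Cell g₂ h₂ q' A') (es : s = p.append p') (et : t = q.append q')
    (hX : X.toList = Φ.toList ++ Φ'.toList) (e₅ : f₁₂ = f₁ ≫ f₂) (e₆ : g₁₂ = g₁ ≫ g₂)
    (e₇ : h₁₂ = h₁ ≫ h₂) :
    (VDOps.compSeq X (CellSeq.pair ψ ψ' et) e₅ e₇).toList =
      [⟨D.comp Φ ψ e₅ e₆⟩, ⟨D.comp Φ' ψ' e₆ e₇⟩] := by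
  rw [CellSeq.pair, VDOps.compSeq_cons X Φ Φ' hX ψ (.single ψ') es et e₅ e₇ e₆,
    VDOps.toList_compSeq_single]
  rfl

theorem compSeq_whisker {a b c d a₁ b₁ c₁ d₁ : D.Obj} {f : a ⟶ a₁} {g : b ⟶ b₁} {h : c ⟶ c₁}
    {k : d ⟶ d₁} {f' : a ⟶ a₁} {k' : d ⟶ d₁} {p₁ : D.Path a b} {p₂ : D.Path b c} {p₃ : D.Path c d}
    {q : D.Path a₁ b₁} {s t : D.Path b₁ c₁} {r : D.Path c₁ d₁} {S : D.Path a d} {T T' : D.Path a₁ d₁}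
    (Z : D.CellSeq f k S T') (Γ₁ : D.CellSeq f g p₁ q) (Γ₂ : D.CellSeq g h p₂ s)
    (Γ₃ : D.CellSeq h k p₃ r) (Ξ : D.CellSeq (𝟙 b₁) (𝟙 c₁) s t) (es : T' = q.append (s.append r))
    (et : T = q.append (t.append r)) (eS : S = p₁.append (p₂.append p₃))
    (hZ : Z.toList = Γ₁.toList ++ (Γ₂.toList ++ Γ₃.toList)) (ef : f' = f ≫ 𝟙 a₁)
    (ek : k' = k ≫ 𝟙 d₁) :
    (VDOps.compSeq Z (D.whisker q Ξ r es et) ef ek).toList =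
      Γ₁.toList ++ ((VDOps.compSeq Γ₂ Ξ (Category.comp_id g).symm (Category.comp_id h).symm).toList ++
        Γ₃.toList) := by
  rw [VDOps.compSeq_append Z _ Γ₁ (Γ₂.append Γ₃) (D.idSeq q) (Ξ.append (D.idSeq r)) eS es et
    (by simpa using hZ) (by simp [VDOps.whisker]) ef (Category.comp_id g).symm ek, compSeq_id,
    VDOps.compSeq_append (Γ₂.append Γ₃) _ Γ₂ Γ₃ Ξ (D.idSeq r) rfl rfl rfl (by simp) (by simp) _
    (Category.comp_id h).symm ek, compSeq_id]

theorem whisker_compSeq {a b c d a₁ b₁ c₁ d₁ : D.Obj} {f : a ⟶ a₁} {g : b ⟶ b₁} {h : c ⟶ c₁}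
    {k : d ⟶ d₁} {f' : a ⟶ a₁} {k' : d ⟶ d₁} {q : D.Path a b} {s t : D.Path b c} {r : D.Path c d}
    {q₁ : D.Path a₁ b₁} {q₂ : D.Path b₁ c₁} {q₃ : D.Path c₁ d₁} {S S' : D.Path a d} {T : D.Path a₁ d₁}
    (Z : D.CellSeq f k S T) (Γ₁ : D.CellSeq f g q q₁) (Γ₂ : D.CellSeq g h t q₂)
    (Γ₃ : D.CellSeq h k r q₃) (Ξ : D.CellSeq (𝟙 b) (𝟙 c) s t) (es : S' = q.append (s.append r))
    (et : S = q.append (t.append r)) (eT : T = q₁.append (q₂.append q₃))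
    (hZ : Z.toList = Γ₁.toList ++ (Γ₂.toList ++ Γ₃.toList)) (ef : f' = 𝟙 a ≫ f)
    (ek : k' = 𝟙 d ≫ k) :
    (VDOps.compSeq (D.whisker q Ξ r es et) Z ef ek).toList =
      Γ₁.toList ++ ((VDOps.compSeq Ξ Γ₂ (Category.id_comp g).symm (Category.id_comp h).symm).toList ++
        Γ₃.toList) := by
  rw [VDOps.compSeq_append _ Z (D.idSeq q) (Ξ.append (D.idSeq r)) Γ₁ (Γ₂.append Γ₃) es et eT
    (by simp [VDOps.whisker]) (by simpa using hZ) ef (Category.id_comp g).symm ek, id_compSeq,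
    VDOps.compSeq_append _ (Γ₂.append Γ₃) Ξ (D.idSeq r) Γ₂ Γ₃ rfl rfl rfl (by simp) (by simp) _
    (Category.id_comp h).symm ek, id_compSeq]

/-- Two strings of cells with the same list of cells have the same composites. -/
theorem comp_congr {a b c d e e' : D.Obj} {h : a ⟶ c} {k : b ⟶ d} {f : c ⟶ e} {g : d ⟶ e'}
    {p : D.Path a b} {q : D.Path c d} {B : D.Pro e e'} {f' : a ⟶ e} {g' : b ⟶ e'}
    {X Y : D.CellSeq h k p q} (H : X.toList = Y.toList) (χ : D.Cell f g q B) (ef : f' = h ≫ f)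
    (eg : g' = k ≫ g) : D.comp X χ ef eg = D.comp Y χ ef eg := by
  rw [CellSeq.ext_toList H]

/-- The string of cells underlying a string of bimodule homomorphisms. -/
def undSeq {M N M' N' : D.Mon} {f : M ⟶ M'} {g : N ⟶ N'} {p : ProPath (Bimod (D := D)) M N}
    {q : ProPath (Bimod (D := D)) M' N'} :
    D.modShape.CellSeq f g p q → D.CellSeq (Mon.Hom.hom f) (Mon.Hom.hom g) (und p) (und q)
  | .nil f => .nil (Mon.Hom.hom f)
  | .cons φ Φ e => .cons φ.1 (undSeq Φ) (by rw [e, und_append])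

variable {M' N' M'' N'' : D.Mon} {h : Mon.Hom M' M''} {k : Mon.Hom N' N''}
  {T : ProPath (Bimod (D := D)) M' N'} {C : Bimod M'' N''}
  {χ : D.Cell h.hom k.hom (und T) C.pro}

/-- A bimodule homomorphism equalizes the inner actions on arbitrary cells. -/
theorem IsBimodHom.inner_comp (hχ : IsBimodHom h k T C χ) {K L K' : D.Mon}
    {t₀ : ProPath (Bimod (D := D)) M' K} {A : Bimod K L} {A' : Bimod L K'}
    {t₁ : ProPath (Bimod (D := D)) K' N'} (eT : T = t₀.append (.cons A (.cons A' t₁)))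
    {a b c c' b' a' : D.Obj} {f : a ⟶ M'.obj} {g : b ⟶ K.obj} {l : c ⟶ L.obj} {l' : c' ⟶ L.obj}
    {g' : b' ⟶ K'.obj} {f' : a' ⟶ N'.obj}
    {s₀ : D.Path a b} {s₁ : D.Path b c} {s₂ : D.Path c c'} {s₃ : D.Path c' b'} {s₄ : D.Path b' a'}
    {s₁₂ : D.Path b c'} {s₂₃ : D.Path c b'}
    (Γ₀ : D.CellSeq f g s₀ (und t₀)) (α : D.Cell g l s₁ A.pro) (μ : D.Cell l l' s₂ L.pro)
    (α' : D.Cell l' g' s₃ A'.pro) (Γ₁ : D.CellSeq g' f' s₄ (und t₁))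
    {S : D.Path a a'} (eS : S = s₀.append (s₁.append (s₂.append (s₃.append s₄))))
    (e₁₂ : s₁₂ = s₁.append s₂) (e₂₃ : s₂₃ = s₂.append s₃)
    (X Y : D.CellSeq f f' S (und T)) {u : a ⟶ M''.obj} {v : a' ⟶ N''.obj}
    (hX : X.toList = Γ₀.toList ++ ⟨D.comp (.pair α μ e₁₂) A.r (Category.comp_id g).symm
      (Category.comp_id l').symm⟩ :: ⟨α'⟩ :: Γ₁.toList)
    (hY : Y.toList = Γ₀.toList ++ ⟨α⟩ :: ⟨D.comp (.pair μ α' e₂₃) A'.l (Category.comp_id l).symm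
      (Category.comp_id g').symm⟩ :: Γ₁.toList)
    (eu : u = f ≫ h.hom) (ev : v = f' ≫ k.hom) : D.comp X χ eu ev = D.comp Y χ eu ev := by
  subst eT e₁₂ e₂₃ eS
  let Ξ : D.CellSeq g g' (s₁.append (s₂.append s₃)) (.cons A.pro (.pair L.pro A'.pro)) :=
    .cons α (.pair μ α' rfl) rfl
  have eZ : s₀.append (s₁.append (s₂.append (s₃.append s₄))) =
      s₀.append ((s₁.append (s₂.append s₃)).append s₄) := by simp only [ProPath.append_assoc]
  obtain ⟨Z₀, hZ₀⟩ := exists_append Ξ Γ₁ rfl rfl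
  obtain ⟨Z, hZ⟩ := exists_append (t := (und t₀).append (.cons A.pro (.cons L.pro (.cons A'.pro
    (und t₁))))) Γ₀ Z₀ eZ rfl
  rw [hZ₀] at hZ
  have hr : (VDOps.compSeq Ξ (CellSeq.pair A.r (D.idCell A'.pro)) (Category.comp_id g).symm
      (Category.comp_id g').symm).toList = [⟨D.comp (.pair α μ rfl) A.r (Category.comp_id g).symm
      (Category.comp_id l').symm⟩, ⟨α'⟩] := by
    refine (toList_compSeq_pair Ξ (.pair α μ rfl) (.single α') A.r (D.idCell A'.pro)
      (ProPath.append_assoc _ _ _).symm rfl rfl _ (Category.comp_id l').symm _).trans ?_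
    rw [D.comp_id]
  have hl : (VDOps.compSeq Ξ (CellSeq.pair (D.idCell A.pro) A'.l) (Category.comp_id g).symm
      (Category.comp_id g').symm).toList = [⟨α⟩, ⟨D.comp (.pair μ α' rfl) A'.l
      (Category.comp_id l).symm (Category.comp_id g').symm⟩] := by
    refine (toList_compSeq_pair Ξ (.single α) (.pair μ α' rfl) (D.idCell A.pro) A'.l
      rfl rfl rfl _ (Category.comp_id l).symm _).trans ?_
    rw [D.comp_id]
  have := congrArg (fun x => D.comp Z x eu ev) (hχ.inner t₀ A A' t₁ rfl)
  refine (comp_comp _ _ _ _ _ _ _ X (Category.comp_id f).symm (Category.comp_id f').symm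
    ?_).symm.trans (this.trans (comp_comp _ _ _ _ _ _ _ Y (Category.comp_id f).symm
      (Category.comp_id f').symm ?_))
  · refine (compSeq_whisker _ Γ₀ Ξ Γ₁ _ _ _ eZ hZ _ _).trans ?_
    rw [hr, hX]
    rfl
  · refine (compSeq_whisker _ Γ₀ Ξ Γ₁ _ _ _ eZ hZ _ _).trans ?_
    rw [hl, hY]
    rfl

/-- A bimodule homomorphism is compatible with the left action on arbitrary cells. -/
theorem IsBimodHom.left_comp (hχ : IsBimodHom h k T C χ) {K : D.Mon}
    {A : Bimod M' K} {t₁ : ProPath (Bimod (D := D)) K N'} (eT : T = .cons A t₁)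
    {a b c d : D.Obj} {l : a ⟶ M'.obj} {l' : b ⟶ M'.obj} {g : c ⟶ K.obj} {f' : d ⟶ N'.obj}
    {s₁ : D.Path a b} {s₂ : D.Path b c} {s₃ : D.Path c d} {s₁₂ : D.Path a c} {s₂₃ : D.Path b d}
    (μ : D.Cell l l' s₁ M'.pro) (α : D.Cell l' g s₂ A.pro) (Γ₁ : D.CellSeq g f' s₃ (und t₁))
    {S : D.Path a d} (eS : S = s₁.append s₂₃) (e₁₂ : s₁₂ = s₁.append s₂)
    (e₂₃ : s₂₃ = s₂.append s₃)
    (X : D.CellSeq l f' S (und T)) (Y : D.CellSeq l' f' s₂₃ (und T)) {u : a ⟶ M''.obj}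
    {v : d ⟶ N''.obj} {x : b ⟶ M''.obj}
    (hX : X.toList = ⟨D.comp (.pair μ α e₁₂) A.l (Category.comp_id l).symm
      (Category.comp_id g).symm⟩ :: Γ₁.toList) (hY : Y.toList = ⟨α⟩ :: Γ₁.toList)
    (eu : u = l ≫ h.hom) (ev : v = f' ≫ k.hom) (ex : x = l' ≫ h.hom) :
    D.comp X χ eu ev = D.comp (.pair (D.comp (.single μ) h.cell eu ex) (D.comp Y χ ex ev) eS) C.l
      (Category.comp_id u).symm (Category.comp_id v).symm := by
  subst eT e₁₂ e₂₃ eS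
  obtain ⟨Z, hZ⟩ := exists_append (t := .cons M'.pro (und (.cons A t₁))) (.single μ) Y rfl rfl
  have hl : (VDOps.compSeq (CellSeq.pair μ α rfl) (CellSeq.single A.l) (Category.comp_id l).symm
      (Category.comp_id g).symm).toList = [⟨D.comp (.pair μ α rfl) A.l (Category.comp_id l).symm
      (Category.comp_id g).symm⟩] := by
    rw [VDOps.toList_compSeq_single]; rfl
  have := congrArg (fun x => D.comp Z x eu ev) (hχ.left A t₁ rfl)
  refine (comp_comp _ _ _ _ _ _ _ X (Category.comp_id l).symm (Category.comp_id f').symm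
    ?_).symm.trans (this.trans (comp_pair Z (.single μ) Y h.cell χ C.l rfl rfl hZ _ _ _ _ _ _ _))
  refine (compSeq_whisker Z (.nil l) (.pair μ α rfl) Γ₁ _ _ _ (ProPath.append_assoc _ _ _).symm
    (by rw [hZ, hY]; rfl) _ _).trans ?_
  rw [hl, hX]
  rfl

/-- A bimodule homomorphism is compatible with the right action on arbitrary cells. -/
theorem IsBimodHom.right_comp (hχ : IsBimodHom h k T C χ) {K : D.Mon}
    {t₀ : ProPath (Bimod (D := D)) M' K} {A : Bimod K N'} (eT : T = t₀.append (.single A))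
    {a b c d : D.Obj} {f : a ⟶ M'.obj} {g : b ⟶ K.obj} {l : c ⟶ N'.obj} {l' : d ⟶ N'.obj}
    {s₁ : D.Path a b} {s₂ : D.Path b c} {s₃ : D.Path c d} {s₁₂ : D.Path a c} {s₂₃ : D.Path b d}
    (Γ₀ : D.CellSeq f g s₁ (und t₀)) (α : D.Cell g l s₂ A.pro) (μ : D.Cell l l' s₃ N'.pro)
    {S : D.Path a d} (eS : S = s₁₂.append s₃) (e₁₂ : s₁₂ = s₁.append s₂)
    (e₂₃ : s₂₃ = s₂.append s₃)
    (X : D.CellSeq f l' S (und T)) (Y : D.CellSeq f l s₁₂ (und T)) {u : a ⟶ M''.obj}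
    {v : d ⟶ N''.obj} {x : c ⟶ N''.obj}
    (hX : X.toList = Γ₀.toList ++ [⟨D.comp (.pair α μ e₂₃) A.r (Category.comp_id g).symm
      (Category.comp_id l').symm⟩]) (hY : Y.toList = Γ₀.toList ++ [⟨α⟩])
    (eu : u = f ≫ h.hom) (ev : v = l' ≫ k.hom) (ex : x = l ≫ k.hom) :
    D.comp X χ eu ev = D.comp (.pair (D.comp Y χ eu ex) (D.comp (.single μ) k.cell ex ev) eS) C.r
      (Category.comp_id u).symm (Category.comp_id v).symm := by
  subst eT e₁₂ e₂₃ eS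
  obtain ⟨Z, hZ⟩ := exists_append (t := (und (t₀.append (.single A))).append (.single N'.pro))
    Y (.single μ) rfl rfl
  have hr : (VDOps.compSeq (CellSeq.pair α μ rfl) (CellSeq.single A.r) (Category.comp_id g).symm
      (Category.comp_id l').symm).toList = [⟨D.comp (.pair α μ rfl) A.r (Category.comp_id g).symm
      (Category.comp_id l').symm⟩] := by
    rw [VDOps.toList_compSeq_single]; rfl
  have := congrArg (fun x => D.comp Z x eu ev) (hχ.right t₀ A rfl)
  refine (comp_comp _ _ _ _ _ _ _ X (Category.comp_id f).symm (Category.comp_id l').symm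
    ?_).symm.trans (this.trans (comp_pair Z Y (.single μ) χ k.cell C.r rfl rfl hZ _ _ _ _ _ _ _))
  refine (compSeq_whisker Z Γ₀ (.pair α μ rfl) (.nil l') _ _ _
    (by rw [ProPath.append_assoc, ProPath.append_nil]) (by rw [hZ, hY]; simp) _ _).trans ?_
  rw [hr, hX]
  rfl

theorem toList_whisker {a b c d : D.Obj} (q : D.Path a b) {s t : D.Path b c}
    (Ξ : D.CellSeq (𝟙 b) (𝟙 c) s t) (r : D.Path c d) {s' t' : D.Path a d}
    (es : s' = q.append (s.append r)) (et : t' = q.append (t.append r)) :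
    (D.whisker q Ξ r es et).toList = (D.idSeq q).toList ++ (Ξ.toList ++ (D.idSeq r).toList) := by
  simp [VDOps.whisker]

theorem toList_idSeq_und_append {M N P : D.Mon} (p : ProPath (Bimod (D := D)) M N)
    (q : ProPath (Bimod (D := D)) N P) :
    (D.idSeq (und (p.append q))).toList = (D.idSeq (und p)).toList ++ (D.idSeq (und q)).toList := by
  rw [und_append, VDOps.toList_idSeq_append]

@[simp] theorem undSeq_nil {M M' : D.Mon} (f : M ⟶ M') :
    undSeq (.nil f : D.modShape.CellSeq _ _ _ _) = .nil (Mon.Hom.hom f) := rfl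

@[simp] theorem toList_undSeq_cons {M N P M' N' P' : D.Mon} {f : M ⟶ M'} {g : N ⟶ N'} {h : P ⟶ P'}
    {p : ProPath (Bimod (D := D)) M N} {q : ProPath (Bimod (D := D)) N P}
    {s : ProPath (Bimod (D := D)) M P} {A : Bimod M' N'} {r : ProPath (Bimod (D := D)) N' P'}
    (φ : D.modShape.Cell f g p A) (Φ : D.modShape.CellSeq g h q r) (e : s = p.append q) :
    (undSeq (.cons φ Φ e)).toList = ⟨φ.1⟩ :: (undSeq Φ).toList := rfl

theorem left_head {M N N₁ L P' Q' R' : D.Mon} {f : M ⟶ P'} {f₁ : N₁ ⟶ Q'} {g : N ⟶ R'}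
    {p' : ProPath (Bimod (D := D)) N₁ N} {t' : ProPath (Bimod (D := D)) Q' R'}
    (Φ' : D.modShape.CellSeq f₁ g p' t') {p₁ : ProPath (Bimod (D := D)) L N₁} {A : Bimod P' Q'}
    {B : Bimod M L} (φ : D.modShape.Cell f f₁ (.cons B p₁) A)
    {q : ProPath (Bimod (D := D)) L N} (eq : q = p₁.append p')
    (e : ProPath.cons B q = (ProPath.cons B p₁).append p') :
    (VDOps.compSeq (D.whisker (.nil _) (.single B.l) (und q) rfl rfl)
      (undSeq (.cons φ Φ' e)) (Category.id_comp _).symm (Category.id_comp _).symm).toList =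
    ⟨D.comp (.pair (Mon.Hom.cell f) φ.1 rfl) A.l
      (Category.comp_id _).symm (Category.comp_id _).symm⟩ :: (undSeq Φ').toList := by
  subst eq
  refine (congrArg CellSeq.toList (VDOps.compSeq_cons _
    (D.whisker (.nil _) (.single B.l) (und p₁) rfl rfl) (D.idSeq (und p')) ?_ φ.1 (undSeq Φ')
    (by rw [und_append]; rfl) (congrArg (ProPath.cons B.pro) (und_append p₁ p')) _ _ (Category.id_comp _).symm)).trans ?_
  · refine (toList_whisker _ _ _ _ _).trans (Eq.trans ?_ (congrArg (· ++ _)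
      (toList_whisker _ _ _ _ _)).symm)
    rw [toList_idSeq_und_append]; rfl
  · rw [CellSeq.toList_cons, id_compSeq]
    exact congrArg (fun x => CellSeq.toList (CellSeq.cons x (undSeq Φ') rfl)) (φ.2.left B p₁ rfl)

theorem nil_head {M N P' Q' R' : D.Mon} {f : M ⟶ P'} {f₁ : M ⟶ Q'} {g : N ⟶ R'}
    {p : ProPath (Bimod (D := D)) M N} {t' : ProPath (Bimod (D := D)) Q' R'}
    (Φ' : D.modShape.CellSeq f₁ g p t') {A : Bimod P' Q'}
    (φ : D.modShape.Cell f f₁ (.nil M) A) (e : p = (ProPath.nil M).append p)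
    {S : D.Path M.obj N.obj} (W : D.CellSeq (𝟙 _) (𝟙 _) S (und p)) :
    (VDOps.compSeq W
      (undSeq (.cons φ Φ' e)) (Category.id_comp _).symm (Category.id_comp _).symm).toList =
    ⟨φ.1⟩ :: (VDOps.compSeq W (undSeq Φ') (Category.id_comp _).symm
      (Category.id_comp _).symm).toList := by
  refine (congrArg CellSeq.toList (VDOps.compSeq_cons W (.nil _) W rfl φ.1 (undSeq Φ')
    rfl rfl _ _ (Category.id_comp _).symm)).trans ?_
  exact congrArg (fun x => VDShape.AnyCell.mk x :: (VDOps.compSeq W (undSeq Φ')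
    (Category.id_comp _).symm (Category.id_comp _).symm).toList) (D.id_comp φ.1)

/-- The left action on the source of a string of bimodule homomorphisms can be moved to the
target of its first cell. -/
theorem IsBimodHom.left_seq {N N₁ Q' N' : D.modShape.Obj} {f₁ : N₁ ⟶ Q'} {g : N ⟶ N'}  {k : Mon.Hom N' N''}  {T : ProPath (Bimod (D := D)) M' N'} {χ : D.Cell h.hom k.hom (und T) C.pro}
    {p' : ProPath (Bimod (D := D)) N₁ N} {t' : ProPath (Bimod (D := D)) Q' N'}
    (Φ' : D.modShape.CellSeq f₁ g p' t') (hχ : IsBimodHom h k T C χ) {M L P' : D.Mon} {f : M ⟶ P'}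
    {p₁ : ProPath (Bimod (D := D)) M N₁} {A : Bimod P' Q'} (φ : D.modShape.Cell f f₁ p₁ A)
    {B : Bimod M L} {q : ProPath (Bimod (D := D)) L N} (e : .cons B q = p₁.append p')
    {t₀ : ProPath (Bimod (D := D)) M' P'} (eT : T = t₀.append (.cons A t')) {a : D.Obj}
    {x : a ⟶ M'.obj} {s₀ : D.Path a M.obj} (Γ₀ : D.CellSeq x (Mon.Hom.hom f) s₀ (und t₀))
    {S : D.Path a N.obj} (eS : S = s₀.append (.cons M.pro (und (.cons B q))))
    (X Y : D.CellSeq x (Mon.Hom.hom g) S (und T))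
    (hX : X.toList = Γ₀.toList ++ (VDOps.compSeq (D.whisker (.nil _) (.single B.l) (und q) rfl rfl)
      (undSeq (.cons φ Φ' e)) (Category.id_comp _).symm (Category.id_comp _).symm).toList)
    (hY : Y.toList = Γ₀.toList ++ ⟨D.comp (.pair (Mon.Hom.cell f) φ.1 rfl) A.l
      (Category.comp_id _).symm (Category.comp_id _).symm⟩ :: (undSeq Φ').toList)
    {u : a ⟶ M''.obj} {v : N.obj ⟶ N''.obj} (eu : u = x ≫ h.hom)
    (ev : v = Mon.Hom.hom g ≫ k.hom) : D.comp X χ eu ev = D.comp Y χ eu ev := by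
  induction Φ' generalizing M L P' t₀ a with
  | nil f₁ =>
    cases p₁ with
    | nil => cases e
    | cons B₁ p₁ =>
      cases e
      exact comp_congr (hX.trans ((congrArg (Γ₀.toList ++ ·)
        (left_head (.nil f₁) φ rfl rfl)).trans hY.symm)) _ _ _
  | cons φ₂ Φ'' e₂ ih =>
    cases p₁ with
    | nil =>
      rename_i p₂ q₂ p' A₂ t'
      obtain rfl : p' = .cons B q := e.symm
      obtain ⟨Γ, hΓ⟩ := exists_append (t := und (t₀.append (.single A))) Γ₀ (.single φ.1)
        (ProPath.append_nil _).symm (und_append _ _)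
      obtain ⟨Y', hY'⟩ := exists_append (s := S) (t := und T) Γ
        (.cons (s := .cons _ (und (.cons B q))) (D.comp (.pair (Mon.Hom.cell _) φ₂.1 rfl) A₂.l
          (Category.comp_id _).symm (Category.comp_id _).symm) (undSeq Φ'')
          (by rw [e₂, und_append]; rfl)) eS
        (by rw [eT]; simp [ProPath.append_assoc])
      rw [ih hχ φ₂ e₂ (by rw [eT, ProPath.append_assoc]; rfl) Γ eS X Y'
        (hX.trans ((congrArg (Γ₀.toList ++ ·) (nil_head (.cons φ₂ Φ'' e₂) φ e _)).trans
          (by rw [hΓ]; simp))) hY' eu ev]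
      symm
      refine hχ.inner_comp eT Γ₀ φ.1 (Mon.Hom.cell _) φ₂.1 (undSeq Φ'') ?_ rfl rfl Y Y' ?_ ?_ eu ev
      · rw [eS, e₂, und_append]; rfl
      · rw [hY]
        exact congrArg (fun x => Γ₀.toList ++ VDShape.AnyCell.mk x :: (⟨φ₂.1⟩ ::
          (undSeq Φ'').toList)) φ.2.nil
      · rw [hY', hΓ, List.append_assoc]; rfl
    | cons B₁ p₁ =>
      cases e
      exact comp_congr (hX.trans ((congrArg (Γ₀.toList ++ ·)
        (left_head (.cons φ₂ Φ'' e₂) φ rfl rfl)).trans hY.symm)) _ _ _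

/-- The string of proarrows is empty. -/
def _root_.ProPath.IsNil {O : Type*} {P : O → O → Type*} {a b : O} : ProPath P a b → Prop
  | .nil _ => True
  | .cons _ _ => False

theorem _root_.ProPath.append_eq_append {O : Type*} {P : O → O → Type*} {a b c d : O}
    (p : ProPath P a b) (p' : ProPath P b c) (q : ProPath P a d) (q' : ProPath P d c)
    (e : p.append p' = q.append q') :
    (∃ s : ProPath P b d, q = p.append s ∧ p' = s.append q') ∨
      ∃ s : ProPath P d b, p = q.append s ∧ q' = s.append p' := by
  induction p with
  | nil a => exact .inl ⟨q, rfl, e⟩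
  | cons A p ih =>
    cases q with
    | nil => exact .inr ⟨.cons A p, rfl, e.symm⟩
    | cons B q =>
      simp only [ProPath.cons_append, ProPath.cons.injEq] at e
      obtain ⟨rfl, h₁, h₂⟩ := e
      obtain rfl := eq_of_heq h₁
      rcases ih p' q (eq_of_heq h₂) with ⟨s, rfl, rfl⟩ | ⟨s, rfl, rfl⟩
      · exact .inl ⟨s, rfl, rfl⟩
      · exact .inr ⟨s, rfl, rfl⟩

theorem whisker_hit {a b c d d' a₁ d₁ e₁ : D.Obj} {q : D.Path a b} {s t : D.Path b c}
    (Ξ : D.CellSeq (𝟙 b) (𝟙 c) s t) {r : D.Path c d'} {r₁ : D.Path c d} {r₂ : D.Path d d'}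
    (er : r = r₁.append r₂) {S T : D.Path a d'} (es : S = q.append (s.append r))
    (et : T = q.append (t.append r)) {P P' : D.Path a d} (eP : P = q.append (t.append r₁))
    (eP' : P' = q.append (s.append r₁)) {f f' : a ⟶ a₁} {g : d ⟶ d₁} {h h' : d' ⟶ e₁}
    {A : D.Pro a₁ d₁} {x : D.Path d₁ e₁} (ψ : D.Cell f g P A) (Ψ : D.CellSeq g h r₂ x)
    (e : T = P.append r₂) (ef : f' = 𝟙 a ≫ f) (eh : h' = 𝟙 d' ≫ h) :
    (VDOps.compSeq (D.whisker q Ξ r es et) (.cons ψ Ψ e) ef eh).toList =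
      ⟨D.comp (D.whisker q Ξ r₁ eP' eP) ψ ef (Category.id_comp g).symm⟩ :: Ψ.toList := by
  subst er eP eP'
  rw [VDOps.compSeq_cons _ (D.whisker q Ξ r₁ rfl rfl) (D.idSeq r₂)
    (by simp [toList_whisker]) ψ Ψ (by rw [es]; simp [ProPath.append_assoc]) e ef eh
    (Category.id_comp g).symm, CellSeq.toList_cons, id_compSeq]

theorem whisker_skip {a b b' c d a₁ b₁ d₁ : D.Obj} {q : D.Path a b} {q₁ : D.Path a b'}
    {q₂ : D.Path b' b} (eq : q = q₁.append q₂) {s t : D.Path b c}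
    (Ξ : D.CellSeq (𝟙 b) (𝟙 c) s t) {r : D.Path c d} {S T : D.Path a d}
    (es : S = q.append (s.append r)) (et : T = q.append (t.append r)) {S₂ T₂ : D.Path b' d}
    (es₂ : S₂ = q₂.append (s.append r)) (et₂ : T₂ = q₂.append (t.append r))
    {f f' : a ⟶ a₁} {g : b' ⟶ b₁} {h h' : d ⟶ d₁}
    {A : D.Pro a₁ b₁} {x : D.Path b₁ d₁} (ψ : D.Cell f g q₁ A) (Ψ : D.CellSeq g h T₂ x)
    (e : T = q₁.append T₂) (ef : f' = 𝟙 a ≫ f) (eh : h' = 𝟙 d ≫ h) :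
    (VDOps.compSeq (D.whisker q Ξ r es et) (.cons ψ Ψ e) ef eh).toList =
      ⟨ψ⟩ :: (VDOps.compSeq (D.whisker q₂ Ξ r es₂ et₂) Ψ (Category.id_comp g).symm eh).toList := by
  subst eq
  obtain rfl := ef.trans (Category.id_comp f)
  rw [VDOps.compSeq_cons _ (D.idSeq q₁) (D.whisker q₂ Ξ r es₂ et₂)
    (by simp [toList_whisker]) ψ Ψ (by rw [es, es₂]; simp [ProPath.append_assoc]) e ef eh
    (Category.id_comp g).symm, CellSeq.toList_cons, D.id_comp]

/-- A right action can be moved to the right past cells with empty source. -/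
theorem IsBimodHom.nil_seq {N N₁ Q' N' : D.modShape.Obj} {f₁ : N₁ ⟶ Q'} {g : N ⟶ N'}
    {k : Mon.Hom N' N''} {T : ProPath (Bimod (D := D)) M' N'}
    {χ : D.Cell h.hom k.hom (und T) C.pro}
    {p' : ProPath (Bimod (D := D)) N₁ N} {t' : ProPath (Bimod (D := D)) Q' N'}
    (Φ' : D.modShape.CellSeq f₁ g p' t') (hp' : p'.IsNil) (hχ : IsBimodHom h k T C χ) {P' : D.Mon}
    {A : Bimod P' Q'} {t₀ : ProPath (Bimod (D := D)) M' P'}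
    (eT : T = t₀.append (.cons A t')) {a b : D.Obj} {x : a ⟶ M'.obj} {f : b ⟶ P'.obj}
    {s₀ : D.Path a b} {s₁ : D.Path b N₁.obj} (Γ₀ : D.CellSeq x f s₀ (und t₀))
    (α : D.Cell f (Mon.Hom.hom f₁) s₁ A.pro) {s₁' : D.Path b N₁.obj}
    (e₁ : s₁' = s₁.append (.single N₁.pro))
    {S S' : D.Path a N.obj} (eS : S = S'.append (.single N.pro))
    (eS₁ : S = s₀.append (s₁'.append (und p')))
    (eS' : S' = s₀.append (s₁.append (und p')))
    (X : D.CellSeq x (Mon.Hom.hom g) S (und T)) (Y : D.CellSeq x (Mon.Hom.hom g) S' (und T))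
    (hX : X.toList = Γ₀.toList ++ ⟨D.comp (.pair α (Mon.Hom.cell f₁) e₁) A.r
      (Category.comp_id _).symm (Category.comp_id _).symm⟩ :: (undSeq Φ').toList)
    (hY : Y.toList = Γ₀.toList ++ ⟨α⟩ :: (undSeq Φ').toList)
    {u : a ⟶ M''.obj} {v : N.obj ⟶ N''.obj} (eu : u = x ≫ h.hom)
    (ev : v = Mon.Hom.hom g ≫ k.hom) : D.comp X χ eu ev =
      D.comp (.pair (D.comp Y χ eu ev) (D.comp (.single (Mon.Hom.cell g)) k.cell ev ev) eS) C.r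
      (Category.comp_id u).symm (Category.comp_id v).symm := by
  induction Φ' generalizing P' t₀ b with
  | nil f₁ =>
    exact hχ.right_comp eT Γ₀ α (Mon.Hom.cell f₁) eS (by rw [eS']; simp) e₁ X Y hX hY eu ev ev
  | cons φ₂ Φ'' e₂ ih =>
    rename_i p₂ q₂ p' A₂ t'
    cases p₂ with
    | cons => subst e₂; exact hp'.elim
    | nil =>
      obtain rfl : p' = q₂ := e₂
      obtain ⟨Γ, hΓ⟩ := exists_append (t := und (t₀.append (.single A))) Γ₀ (.single α)
        rfl (und_append _ _)
      have eT' : T = (t₀.append (.single A)).append (.cons A₂ t') := by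
        rw [eT, ProPath.append_assoc]; rfl
      obtain ⟨X', hX'⟩ := exists_append (s := S) (t := und T) Γ
        (.cons (s := .cons _ (und p')) (D.comp (.pair φ₂.1 (Mon.Hom.cell _) rfl) A₂.r
          (Category.comp_id _).symm (Category.comp_id _).symm) (undSeq Φ'') rfl)
          (by rw [eS₁, e₁]; simp [ProPath.append_assoc])
        (by rw [eT']; simp [ProPath.append_assoc])
      rw [← ih hp' hχ eT' Γ φ₂.1 rfl eS (by rw [eS₁, e₁]; simp [ProPath.append_assoc])
        (by rw [eS']; simp [ProPath.append_assoc]) X' Y hX'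
        (by rw [hY, hΓ, List.append_assoc]; rfl) ev]
      refine hχ.inner_comp eT Γ₀ α (Mon.Hom.cell _) φ₂.1 (undSeq Φ'') ?_ e₁ rfl X X' hX ?_ eu ev
      · rw [eS₁, e₁]; simp [ProPath.append_assoc]
      · rw [hX', hΓ, List.append_assoc]
        exact congrArg (fun x => Γ₀.toList ++ ⟨α⟩ :: VDShape.AnyCell.mk x ::
          (undSeq Φ'').toList) φ₂.2.nil.symm

/-- The right action on the source of a string of bimodule homomorphisms can be moved to the
target. -/
theorem IsBimodHom.right_seq {M N P' N' : D.modShape.Obj} {f : M ⟶ P'} {g : N ⟶ N'}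
    {k : Mon.Hom N' N''} {T : ProPath (Bimod (D := D)) M' N'}
    {χ : D.Cell h.hom k.hom (und T) C.pro}
    {p : ProPath (Bimod (D := D)) M N} {t : ProPath (Bimod (D := D)) P' N'}
    (Φ : D.modShape.CellSeq f g p t) (hχ : IsBimodHom h k T C χ) {L : D.Mon}
    {q : ProPath (Bimod (D := D)) M L} {B : Bimod L N} (e : p = q.append (.single B))
    {t₀ : ProPath (Bimod (D := D)) M' P'} (eT : T = t₀.append t) {a : D.Obj}
    {x : a ⟶ M'.obj} {s₀ : D.Path a M.obj} (Γ₀ : D.CellSeq x (Mon.Hom.hom f) s₀ (und t₀))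
    {S₁ : D.Path M.obj N.obj} (es : S₁ = (und q).append ((ProPath.pair B.pro N.pro).append (.nil _)))
    (et : und p = (und q).append ((ProPath.single B.pro).append (.nil _)))
    {S S' : D.Path a N.obj} (eS : S = S'.append (.single N.pro)) (eS₁ : S = s₀.append S₁)
    (eS' : S' = s₀.append (und p))
    (X : D.CellSeq x (Mon.Hom.hom g) S (und T)) (Y : D.CellSeq x (Mon.Hom.hom g) S' (und T))
    (hX : X.toList = Γ₀.toList ++ (VDOps.compSeq (D.whisker (und q) (.single B.r) (.nil _) es et)
      (undSeq Φ) (Category.id_comp _).symm (Category.id_comp _).symm).toList)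
    (hY : Y.toList = Γ₀.toList ++ (undSeq Φ).toList)
    {u : a ⟶ M''.obj} {v : N.obj ⟶ N''.obj} (eu : u = x ≫ h.hom)
    (ev : v = Mon.Hom.hom g ≫ k.hom) : D.comp X χ eu ev =
      D.comp (.pair (D.comp Y χ eu ev) (D.comp (.single (Mon.Hom.cell g)) k.cell ev ev) eS) C.r
      (Category.comp_id u).symm (Category.comp_id v).symm := by
  induction Φ generalizing a with
  | nil f => cases q <;> cases e
  | cons φ Φ' e₂ ih =>
    rename_i p₁ p' p A t'
    have skip : ∀ s : ProPath (Bimod (D := D)) _ L, q = p₁.append s → p' = s.append (.single B) →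
        D.comp X χ eu ev = D.comp (.pair (D.comp Y χ eu ev)
          (D.comp (.single (Mon.Hom.cell _)) k.cell ev ev) eS) C.r
          (Category.comp_id u).symm (Category.comp_id v).symm := by
      rintro s rfl rfl
      obtain ⟨Γ, hΓ⟩ := exists_append (t := und (t₀.append (.single A))) Γ₀ (.single φ.1)
        rfl (und_append _ _)
      refine ih hχ rfl (t₀ := t₀.append (.single A)) (by rw [eT, ProPath.append_assoc]; rfl) Γ
        (S₁ := (und s).append (ProPath.pair B.pro _)) rfl (by simp) eS
        (by rw [eS₁, es]; simp [ProPath.append_assoc])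
        (by rw [eS', e₂]; simp [ProPath.append_assoc]) X Y ?_ ?_ eu ev
      · rw [hX, hΓ, List.append_assoc]
        refine congrArg (Γ₀.toList ++ ·) ?_
        exact whisker_skip (und_append _ _) _ _ _ _ _ φ.1 (undSeq Φ') _ _ _
      · rw [hY, hΓ, List.append_assoc]; rfl
    rcases ProPath.append_eq_append p₁ p' q (.single B) (e₂.symm.trans e) with
      ⟨s, hq, hp⟩ | ⟨s, hq, hp⟩
    · exact skip s hq hp
    · cases s with
      | nil => exact skip (.nil _) (by rw [hq]; simp) hp.symm
      | cons B₁ s =>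
        cases s with
        | cons => cases hp
        | nil =>
          cases hp
          subst hq
          have hd := φ.2.right q B₁ rfl
          refine hχ.nil_seq Φ' trivial eT Γ₀ φ.1 rfl eS ?_ ?_ X Y ?_ hY eu ev
          · rw [eS₁, es]; simp [ProPath.append_assoc]
          · rw [eS', e₂]; simp
          · rw [hX]
            refine congrArg (Γ₀.toList ++ ·) ?_
            refine (whisker_hit (r₁ := .nil _) (r₂ := .nil _)
              (P' := (und (q.append (.single B₁))).append (.single _)) _ rfl es _ (by simp)
              (by rw [und_append, ProPath.append_assoc]; rfl) φ.1 (undSeq Φ') _ _ _).trans ?_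
            exact congrArg (fun x => VDShape.AnyCell.mk x :: (undSeq Φ').toList) hd

/-- A string of bimodule homomorphisms equalizes the inner actions. -/
theorem IsBimodHom.inner_seq {M N P' N' : D.modShape.Obj} {f : M ⟶ P'} {g : N ⟶ N'}
    {k : Mon.Hom N' N''} {T : ProPath (Bimod (D := D)) M' N'}
    {χ : D.Cell h.hom k.hom (und T) C.pro}
    {p : ProPath (Bimod (D := D)) M N} {t : ProPath (Bimod (D := D)) P' N'}
    (Φ : D.modShape.CellSeq f g p t) (hχ : IsBimodHom h k T C χ) {K L K' : D.Mon}
    {q : ProPath (Bimod (D := D)) M K} {B : Bimod K L} {B' : Bimod L K'}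
    {r : ProPath (Bimod (D := D)) K' N} (e : p = q.append (.cons B (.cons B' r)))
    {t₀ : ProPath (Bimod (D := D)) M' P'} (eT : T = t₀.append t) {a : D.Obj}
    {x : a ⟶ M'.obj} {s₀ : D.Path a M.obj} (Γ₀ : D.CellSeq x (Mon.Hom.hom f) s₀ (und t₀))
    {S₁ : D.Path M.obj N.obj}
    (es : S₁ = (und q).append (.append (.cons B.pro (.pair L.pro B'.pro)) (und r)))
    (et : und p = (und q).append (.append (.pair B.pro B'.pro) (und r)))
    {S : D.Path a N.obj} (eS₁ : S = s₀.append S₁)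
    (X Y : D.CellSeq x (Mon.Hom.hom g) S (und T))
    (hX : X.toList = Γ₀.toList ++ (VDOps.compSeq
      (D.whisker (und q) (.pair B.r (D.idCell B'.pro)) (und r) es et)
      (undSeq Φ) (Category.id_comp _).symm (Category.id_comp _).symm).toList)
    (hY : Y.toList = Γ₀.toList ++ (VDOps.compSeq
      (D.whisker (und q) (.pair (D.idCell B.pro) B'.l) (und r) es et)
      (undSeq Φ) (Category.id_comp _).symm (Category.id_comp _).symm).toList)
    {u : a ⟶ M''.obj} {v : N.obj ⟶ N''.obj} (eu : u = x ≫ h.hom)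
    (ev : v = Mon.Hom.hom g ≫ k.hom) : D.comp X χ eu ev = D.comp Y χ eu ev := by
  induction Φ generalizing a with
  | nil f => cases q <;> cases e
  | cons φ Φ' e₂ ih =>
    rename_i p₁ p' p A t'
    obtain ⟨Γ, hΓ⟩ := exists_append (t := und (t₀.append (.single A))) Γ₀ (.single φ.1)
      rfl (und_append _ _)
    have eT' : T = (t₀.append (.single A)).append t' := by rw [eT, ProPath.append_assoc]; rfl
    have skip : ∀ s : ProPath (Bimod (D := D)) _ K, q = p₁.append s →
        p' = s.append (.cons B (.cons B' r)) → D.comp X χ eu ev = D.comp Y χ eu ev := by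
      rintro s rfl rfl
      refine ih hχ rfl eT' Γ
        (S₁ := (und s).append (.append (.cons B.pro (.pair L.pro B'.pro)) (und r))) rfl (by simp)
        (by rw [eS₁, es]; simp [ProPath.append_assoc]) X Y ?_ ?_ eu ev
      · rw [hX, hΓ, List.append_assoc]
        refine congrArg (Γ₀.toList ++ ·) ?_
        exact whisker_skip (und_append _ _) _ _ _ _ _ φ.1 (undSeq Φ') _ _ _
      · rw [hY, hΓ, List.append_assoc]
        refine congrArg (Γ₀.toList ++ ·) ?_
        exact whisker_skip (und_append _ _) _ _ _ _ _ φ.1 (undSeq Φ') _ _ _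
    rcases ProPath.append_eq_append p₁ p' q _ (e₂.symm.trans e) with
      ⟨s, hq, hp⟩ | ⟨s, hq, hp⟩
    · exact skip s hq hp
    · cases s with
      | nil => exact skip (.nil _) (by rw [hq]; simp) hp.symm
      | cons B₁ s =>
        cases s with
        | nil =>
          clear ih skip
          cases Φ' with
          | nil => cases hp
          | cons φ₂ Φ'' e₃ =>
            rename_i p₂ p₃ A₂ t''
            cases hp
            subst hq
            have hd := φ.2.right q B rfl
            have eW : und p = (und (q.append (.single B))).append (.append (.single B'.pro) (und r)) := by
              rw [e₂, und_append]; rfl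
            have hW : ∀ es' et', D.whisker (und q) (.pair B.r (D.idCell B'.pro)) (und r) es et =
                D.whisker (und q) (.single B.r) (und (.cons B' r)) es' et' := fun es' et' =>
              CellSeq.ext_toList (by simp [toList_whisker]; rfl)
            have hW' : ∀ es' et', D.whisker (und q) (.pair (D.idCell B.pro) B'.l) (und r) es et =
                D.whisker (und (q.append (.single B))) (.single B'.l) (und r) es' et' := fun es' et' =>
              CellSeq.ext_toList (by simp [toList_whisker]; rfl)
            rw [hW es et] at hX
            rw [hW' (by rw [es]; simp [ProPath.append_assoc]) eW] at hY
            have hX₁ := hX.trans (congrArg (Γ₀.toList ++ ·) ((whisker_hit (r₁ := .nil _)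
              (r₂ := und (.cons B' r)) (P' := (und (q.append (.single B))).append (.single _)) _ rfl es
              et (by simp) (by rw [und_append, ProPath.append_assoc]; rfl) φ.1 (undSeq (.cons φ₂ Φ'' e₃)) _ _ _).trans
              (congrArg (fun x => VDShape.AnyCell.mk x :: (undSeq (.cons φ₂ Φ'' e₃)).toList) hd)))
            have hY₁ := hY.trans (congrArg (Γ₀.toList ++ ·) (whisker_skip (q₂ := .nil _)
              (S₂ := .cons _ (.cons B'.pro (und r))) (T₂ := und (.cons B' r))
              (ProPath.append_nil _).symm _ _ _ rfl rfl φ.1 (undSeq (.cons φ₂ Φ'' e₃)) _ _ _))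
            obtain ⟨Y', hY'⟩ := exists_append (s := S) (t := und T) Γ
              (.cons (s := .cons _ (und (.cons B' r))) (D.comp (.pair (Mon.Hom.cell _) φ₂.1 rfl) A₂.l
                (Category.comp_id _).symm (Category.comp_id _).symm) (undSeq Φ'')
                (by rw [e₃, und_append]; rfl)) (by rw [eS₁, es]; simp [ProPath.append_assoc])
              (by rw [eT']; simp [ProPath.append_assoc])
            refine Eq.trans ?_ (hχ.left_seq Φ'' φ₂ e₃ eT' Γ
              (by rw [eS₁, es]; simp [ProPath.append_assoc]) Y Y' ?_ hY' eu ev).symm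
            · refine hχ.inner_comp eT Γ₀ φ.1 (Mon.Hom.cell _) φ₂.1 (undSeq Φ'') ?_ rfl rfl X Y'
                hX₁ ?_ eu ev
              · rw [eS₁, es]
                have := congrArg und e₃
                rw [und_append, und_cons] at this
                rw [← this]
                simp [ProPath.append_assoc]
              · rw [hY', hΓ, List.append_assoc]; rfl
            · rw [hY₁, hΓ, List.append_assoc]; rfl
        | cons B₂ s =>
          cases hp
          subst hq
          have hd := φ.2.inner q B B' s rfl
          refine comp_congr (hX.trans (Eq.trans (congrArg (Γ₀.toList ++ ·) ?_) hY.symm)) _ _ _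
          refine (whisker_hit (r₁ := und s) (r₂ := und p') _ (und_append _ _) es _ (by simp) rfl φ.1
            (undSeq Φ') _ _ _).trans (Eq.trans ?_ (whisker_hit (r₁ := und s) (r₂ := und p') _
            (und_append _ _) es _ (by simp) rfl φ.1 (undSeq Φ') _ _ _).symm)
          exact congrArg (fun x => VDShape.AnyCell.mk x :: (undSeq Φ').toList) hd

/-- Bimodule homomorphisms are closed under composition. -/
theorem IsBimodHom.comp {M N M' N' M'' N'' : D.modShape.Obj} {f : M ⟶ M'} {g : N ⟶ N'}
    {p : ProPath (Bimod (D := D)) M N} {T : ProPath (Bimod (D := D)) M' N'}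
    (Φ : D.modShape.CellSeq f g p T) {h : M' ⟶ M''} {k : N' ⟶ N''} {C : Bimod M'' N''}
    {χ : D.Cell (Mon.Hom.hom h) (Mon.Hom.hom k) (und T) C.pro} (hχ : IsBimodHom h k T C χ) :
    IsBimodHom (f ≫ h) (g ≫ k) p C (D.comp (undSeq Φ) χ rfl rfl) where
  left {L} B q e := by
    cases Φ with
    | nil => cases e
    | cons φ Φ' e₂ =>
      subst e
      rename_i p₁ p' A t'
      let Y : D.CellSeq (Mon.Hom.hom f) (Mon.Hom.hom g) (.cons M.pro (und (.cons B q)))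
          (und (.cons A t')) := .cons (D.comp (p := .cons M.pro (und p₁))
          (.pair (Mon.Hom.cell f) φ.1 rfl) A.l
          (Category.comp_id _).symm (Category.comp_id _).symm) (undSeq Φ')
          (by rw [e₂, und_append]; rfl)
      refine (comp_comp _ _ _ _ _ _ _ _ (Category.id_comp _).symm (Category.id_comp _).symm
        rfl).trans ((hχ.left_seq Φ' φ e₂ (t₀ := .nil _) rfl (.nil _) rfl _ Y rfl rfl _ _).trans ?_)
      exact hχ.left_comp rfl (Mon.Hom.cell f) φ.1 (undSeq Φ') rfl rfl
        ((congrArg und e₂).trans (und_append p₁ p')) Y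
        (undSeq (.cons φ Φ' e₂)) rfl rfl _ _ _
  right {L} q B e := by
    refine (comp_comp _ _ _ _ _ _ _ _ (Category.id_comp _).symm (Category.id_comp _).symm
        rfl).trans ?_
    exact hχ.right_seq Φ e (t₀ := .nil _) rfl (.nil _) _ _ rfl rfl rfl _ _ rfl rfl _ _
  inner {K L K'} q B B' r e := by
    refine (comp_comp _ _ _ _ _ _ _ _ (Category.id_comp _).symm (Category.id_comp _).symm
        rfl).trans (Eq.trans ?_ (comp_comp _ _ _ _ _ _ _ _ (Category.id_comp _).symm
        (Category.id_comp _).symm rfl).symm)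
    exact hχ.inner_seq Φ e (t₀ := .nil _) rfl (.nil _) _ _ rfl _ _ rfl rfl _ _
  nil := by
    cases Φ with
    | nil f =>
      have := congrArg (fun x => D.comp (.single (Mon.Hom.cell f)) x rfl rfl) hχ.nil
      refine Eq.trans ?_ (this.trans ?_)
      · exact (comp_pair _ (.single (Mon.Hom.cell f)) (.nil _) _ _ _ rfl rfl rfl _ _ _ _ _ _ _).symm
      · exact comp_pair _ (.nil _) (.single (Mon.Hom.cell f)) _ _ _ rfl rfl rfl _ _ _ _ _ _ _
    | cons φ Φ' e₂ =>
      rename_i p₁ p' A t'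
      cases p with
      | cons => trivial
      | nil =>
        cases p₁ with
        | cons => cases e₂
        | nil =>
          cases e₂
          let X : D.CellSeq (Mon.Hom.hom f) (Mon.Hom.hom g) (.single M.pro)
              (und (.cons A t')) := .cons (D.comp (p := .single M.pro)
              (.pair (Mon.Hom.cell f) φ.1 rfl) A.l
              (Category.comp_id _).symm (Category.comp_id _).symm) (undSeq Φ') rfl
          refine (hχ.left_comp rfl (Mon.Hom.cell f) φ.1 (undSeq Φ') rfl rfl rfl X
            (undSeq (.cons φ Φ' rfl)) rfl rfl rfl rfl rfl).symm.trans ?_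
          refine hχ.nil_seq Φ' trivial (t₀ := .nil _) rfl (.nil _) φ.1 rfl rfl rfl rfl X
            (undSeq (.cons φ Φ' rfl)) ?_ rfl _ _
          exact congrArg (fun x => VDShape.AnyCell.mk x :: (undSeq Φ').toList) φ.2.nil

/-- Identity cells are bimodule homomorphisms. -/
theorem IsBimodHom.id {M N : D.Mon} (B : Bimod M N) :
    IsBimodHom (𝟙 M : M ⟶ M) (𝟙 N : N ⟶ N) (.single B) B (D.idCell B.pro) where
  left {L} B' q e := by
    cases e
    exact (comp_congr rfl _ _ _).trans ((D.comp_id B.l).trans (D.id_comp B.l).symm)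
  right {L} q B' e := by
    cases q with
    | nil =>
      cases e
      exact (comp_congr rfl _ _ _).trans ((D.comp_id B.r).trans (D.id_comp B.r).symm)
    | cons _ q => cases q <;> cases e
  inner {K L K'} q B₁ B₂ r e := by
    cases q with
    | nil => cases e
    | cons _ q => cases q <;> cases e
  nil := trivial

theorem toList_undSeq_append {a b c a' b' c' : D.modShape.Obj} {f : a ⟶ a'} {g : b ⟶ b'}
    {h : c ⟶ c'} {s : D.modShape.Path a c} {t : D.modShape.Path a' c'}
    {p : D.modShape.Path a b} {p' : D.modShape.Path b c} {q : D.modShape.Path a' b'}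
    {q' : D.modShape.Path b' c'} (X : D.modShape.CellSeq f h s t) (Φ : D.modShape.CellSeq f g p q)
    (Ψ : D.modShape.CellSeq g h p' q') (es : s = p.append p') (et : t = q.append q')
    (hX : X.toList = Φ.toList ++ Ψ.toList) :
    (undSeq X).toList = (undSeq Φ).toList ++ (undSeq Ψ).toList := by
  subst es et
  obtain rfl : X = Φ.append Ψ := CellSeq.ext_toList (by simpa using hX)
  clear hX
  induction Φ with
  | nil => rfl
  | cons φ Φ e ih => exact congrArg _ (ih Ψ)

variable (D)

/-- The operations of the virtual double category of monoids and modules, which are those of `D`. -/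
@[reducible] def modOps : VDOps.{max u w z, max v z, max w z, z} where
  toVDShape := D.modShape
  idCell B := ⟨D.idCell B.pro, IsBimodHom.id B⟩
  comp Φ χ ef eg := ⟨D.comp (undSeq Φ) χ.1 (congrArg Mon.Hom.hom ef) (congrArg Mon.Hom.hom eg), by
    subst ef eg; exact χ.2.comp Φ⟩

variable {D}

theorem undSeq_idSeq {M N : D.modShape.Obj} (p : D.modShape.Path M N) :
    (undSeq (D.modOps.idSeq p)).toList = (D.idSeq (und p)).toList := by
  induction p with
  | nil => rfl
  | cons B p ih => exact congrArg (List.cons _) ih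

theorem undSeq_compSeq {a b c d e e' : D.modShape.Obj} {h : a ⟶ c} {k : b ⟶ d} {f : c ⟶ e}
    {g : d ⟶ e'} {p : D.modShape.Path a b} {q : D.modShape.Path c d} {r : D.modShape.Path e e'}
    {f' : a ⟶ e} {g' : b ⟶ e'} (Φ : D.modShape.CellSeq h k p q) (Ψ : D.modShape.CellSeq f g q r)
    (ef : f' = h ≫ f) (eg : g' = k ≫ g) :
    (VDOps.compSeq (undSeq Φ) (undSeq Ψ) (congrArg Mon.Hom.hom ef)
      (congrArg Mon.Hom.hom eg)).toList =
      (undSeq (VDOps.compSeq (D := D.modOps) Φ Ψ ef eg)).toList := by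
  induction Ψ generalizing a with
  | nil f =>
    cases Φ
    subst ef eg
    exact VDOps.compSeq_nil _ _ _ _
  | cons ψ Ψ e₁ ih =>
    obtain ⟨m, l, p₁, p₂, Φ₁, Φ₂, h₁, h₂⟩ := VDOps.exists_cut Φ _ _ e₁
    refine Eq.trans ?_ (congrArg (fun x => (undSeq x).toList) (VDOps.compSeq_cons (D := D.modOps) Φ
      Φ₁ Φ₂ h₂ ψ Ψ h₁ e₁ ef eg rfl)).symm
    refine (congrArg CellSeq.toList (VDOps.compSeq_cons (undSeq Φ) (undSeq Φ₁) (undSeq Φ₂)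
      (toList_undSeq_append Φ Φ₁ Φ₂ h₁ e₁ h₂) ψ.1 (undSeq Ψ) ((congrArg und h₁).trans
        (und_append p₁ p₂)) _ _ _ rfl)).trans ?_
    exact congrArg (List.cons _) (ih Φ₂ rfl eg)

variable (D)

/-- The virtual double category of monoids and modules in `D`. -/
@[reducible] def Mod : VirtualDoubleCategory.{max u w z, max v z, max w z, z} where
  toVDOps := D.modOps
  id_comp φ := Subtype.ext ((comp_congr (undSeq_idSeq _) _ _ _).trans (D.id_comp φ.1))
  comp_id φ := Subtype.ext ((comp_congr rfl _ _ _).trans (D.comp_id φ.1))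
  assoc Φ Ψ χ := Subtype.ext (comp_comp (undSeq Φ) (undSeq Ψ) χ.1 rfl rfl rfl rfl _ rfl rfl
    (undSeq_compSeq Φ Ψ rfl rfl)).symm

variable {D}

end VirtualDoubleCategory

namespace VirtualDoubleCategory

open VDShape (CellSeq)

variable {D : VirtualDoubleCategory.{u, v, w, z}}

/-- A cell with identity frames is opcartesian if composing with it, surrounded by identity cells,
is a bijection on cells with arbitrary frames and target. -/
def IsOpcartesian {a b : D.Obj} {p : D.Path a b} {B : D.Pro a b} (θ : D.Cell (𝟙 a) (𝟙 b) p B) :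
    Prop :=
  ∀ ⦃a' b' c d : D.Obj⦄ (q : D.Path a' a) (r : D.Path b b') (f : a' ⟶ c) (g : b' ⟶ d)
    (C : D.Pro c d), Function.Bijective fun χ : D.Cell f g (q.append (.cons B r)) C =>
      (D.comp (D.whisker q (.single θ) r rfl rfl) χ (Category.id_comp f).symm
        (Category.id_comp g).symm : D.Cell f g (q.append (p.append r)) C)

/-- A cell whose source is a single proarrow is cartesian if composing with it is a bijection onto
the cells whose frames factor through its frames. -/
def IsCartesian {a b c d : D.Obj} {f : a ⟶ c} {g : b ⟶ d} {A : D.Pro a b} {B : D.Pro c d}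
    (φ : D.Cell f g (.single A) B) : Prop :=
  ∀ ⦃a' b' : D.Obj⦄ (h : a' ⟶ a) (k : b' ⟶ b) (p : D.Path a' b'),
    Function.Bijective fun χ : D.Cell h k p A =>
      (D.comp (.single χ) φ rfl rfl : D.Cell (h ≫ f) (k ≫ g) p B)

variable (D)

/-- Every object has a unit. -/
def HasUnits : Prop :=
  ∀ x : D.Obj, ∃ (A : D.Pro x x) (η : D.Cell (𝟙 x) (𝟙 x) (.nil x) A), IsOpcartesian η

/-- Every proarrow has a restriction along every pair of vertical arrows into its ends. -/
def HasRestrictions : Prop :=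
  ∀ ⦃a b c d : D.Obj⦄ (f : a ⟶ c) (g : b ⟶ d) (B : D.Pro c d),
    ∃ (A : D.Pro a b) (φ : D.Cell f g (.single A) B), IsCartesian φ

/-- Virtual equipments. -/
structure IsVirtualEquipment : Prop where
  hasUnits : D.HasUnits
  hasRestrictions : D.HasRestrictions

/-- A choice of a unit for each object. -/
structure Units where
  pro : ∀ x : D.Obj, D.Pro x x
  cell : ∀ x : D.Obj, D.Cell (𝟙 x) (𝟙 x) (.nil x) (pro x)
  opcart : ∀ x : D.Obj, IsOpcartesian (cell x)

variable {D}

theorem IsOpcartesian.existsUnique {a b : D.Obj} {p : D.Path a b} {B : D.Pro a b}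
    {θ : D.Cell (𝟙 a) (𝟙 b) p B} (hθ : IsOpcartesian θ) {a' b' c d : D.Obj} (q : D.Path a' a)
    (r : D.Path b b') {f : a' ⟶ c} {g : b' ⟶ d} {C : D.Pro c d} {S T : D.Path a' b'}
    (eS : S = q.append (p.append r)) (eT : T = q.append (.cons B r))
    (X : D.CellSeq (𝟙 a') (𝟙 b') S T)
    (hX : X.toList = (D.idSeq q).toList ++ ⟨θ⟩ :: (D.idSeq r).toList) (γ : D.Cell f g S C) :
    ∃! χ : D.Cell f g T C, D.comp X χ (Category.id_comp f).symm (Category.id_comp g).symm = γ := by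
  subst eS eT
  obtain rfl : X = D.whisker q (.single θ) r rfl rfl := CellSeq.ext_toList
    (hX.trans (toList_whisker q (.single θ) r rfl rfl).symm)
  exact (hθ q r f g C).existsUnique γ

theorem pair_congr {a b c a' b' c' x y : D.Obj} {f : a ⟶ a'} {g : b ⟶ b'} {h : c ⟶ c'}
    {p : D.Path a b} {q : D.Path b c} {s : D.Path a c} {A : D.Pro a' b'} {B : D.Pro b' c'}
    {φ φ' : D.Cell f g p A} {ψ ψ' : D.Cell g h q B} (h₁ : φ = φ') (h₂ : ψ = ψ')
    (e : s = p.append q) {k : a' ⟶ x} {l : c' ⟶ y} {C : D.Pro x y} (χ : D.Cell k l (.pair A B) C)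
    {k' : a ⟶ x} {l' : c ⟶ y} (ek : k' = f ≫ k) (el : l' = h ≫ l) :
    D.comp (.pair φ ψ e) χ ek el = D.comp (.pair φ' ψ' e) χ ek el := by
  rw [h₁, h₂]

/-- The unit bimodule of a monoid. -/
def Mon.self (M : D.Mon) : Bimod M M where
  pro := M.pro
  l := M.mul
  r := M.mul
  unit_l := M.unit_mul
  unit_r := M.mul_unit
  assoc_l := M.mul_assoc
  assoc_r := M.mul_assoc.symm
  assoc_lr := M.mul_assoc

namespace Units

variable (U : D.Units)

theorem exists_lact {x y : D.Obj} (P : D.Pro x y) :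
    ∃! χ : D.Cell (𝟙 x) (𝟙 y) (.pair (U.pro x) P) P,
      D.comp (.pair (U.cell x) (D.idCell P)) χ (by simp) (by simp) = D.idCell P :=
  (U.opcart x).existsUnique (.nil x) (.single P) rfl rfl _ rfl _

theorem exists_ract {x y : D.Obj} (P : D.Pro x y) :
    ∃! χ : D.Cell (𝟙 x) (𝟙 y) (.pair P (U.pro y)) P,
      D.comp (.pair (D.idCell P) (U.cell y)) χ (by simp) (by simp) = D.idCell P :=
  (U.opcart y).existsUnique (.single P) (.nil y) rfl rfl _ rfl _

/-- The left action of the unit on a proarrow, induced by the universal property of the unit. -/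
noncomputable def lact {x y : D.Obj} (P : D.Pro x y) :
    D.Cell (𝟙 x) (𝟙 y) (.pair (U.pro x) P) P := (U.exists_lact P).choose

/-- The right action of the unit on a proarrow, induced by the universal property of the unit. -/
noncomputable def ract {x y : D.Obj} (P : D.Pro x y) :
    D.Cell (𝟙 x) (𝟙 y) (.pair P (U.pro y)) P := (U.exists_ract P).choose

theorem lact_spec {x y : D.Obj} (P : D.Pro x y) :
    D.comp (.pair (U.cell x) (D.idCell P)) (U.lact P) (by simp) (by simp) = D.idCell P :=
  (U.exists_lact P).choose_spec.1

theorem ract_spec {x y : D.Obj} (P : D.Pro x y) :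
    D.comp (.pair (D.idCell P) (U.cell y)) (U.ract P) (by simp) (by simp) = D.idCell P :=
  (U.exists_ract P).choose_spec.1

/-- Acting by the unit cell on the target of a cell does nothing. -/
theorem lact_comp {a b x y : D.Obj} {f : a ⟶ x} {g : b ⟶ y} {p : D.Path a b} {P : D.Pro x y}
    (ψ : D.Cell f g p P) (ν : D.Cell f f (.nil a) (U.pro x))
    (hν : D.comp (.nil f) (U.cell x) (by simp) (by simp) = ν) :
    D.comp (.pair ν ψ) (U.lact P) (by simp) (by simp) = ψ := by
  subst hν
  have := congrArg (fun x => D.comp (.single ψ) x (Category.comp_id _).symm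
    (Category.comp_id _).symm) (U.lact_spec P)
  refine Eq.trans (Eq.symm ?_) (this.trans (D.comp_id ψ))
  refine (comp_pair (.single ψ) (.nil f) (.single ψ) _ _ _ rfl rfl rfl _ _ _ _ (Category.comp_id _).symm (Category.comp_id _).symm
    (Category.comp_id _).symm).trans ?_
  rw [D.comp_id]

theorem ract_comp {a b x y : D.Obj} {f : a ⟶ x} {g : b ⟶ y} {p : D.Path a b} {P : D.Pro x y}
    (ψ : D.Cell f g p P) (ν : D.Cell g g (.nil b) (U.pro y))
    (hν : D.comp (.nil g) (U.cell y) (by simp) (by simp) = ν) :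
    D.comp (.pair ψ ν (by simp)) (U.ract P) (by simp) (by simp) = ψ := by
  subst hν
  have := congrArg (fun x => D.comp (.single ψ) x (Category.comp_id _).symm
    (Category.comp_id _).symm) (U.ract_spec P)
  refine Eq.trans (Eq.symm ?_) (this.trans (D.comp_id ψ))
  refine (comp_pair (.single ψ) (.single ψ) (.nil g) _ _ _ (by simp) rfl rfl _ _ _ _
    (Category.comp_id _).symm (Category.comp_id _).symm (Category.comp_id _).symm).trans ?_
  rw [D.comp_id]

theorem lact_assoc {x y y' : D.Obj} {P : D.Pro x y} {Q : D.Pro y y'} {R : D.Pro x y'}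
    (ψ : D.Cell (𝟙 x) (𝟙 y') (.pair P Q) R) :
    D.comp (p := .cons (U.pro x) (.pair P Q)) (f' := 𝟙 _) (g' := 𝟙 _)
        (.pair (U.lact P) (D.idCell Q)) ψ (by simp) (by simp) =
      D.comp (.pair (D.idCell (U.pro x)) ψ) (U.lact R) (by simp) (by simp) := by
  let X : D.CellSeq (𝟙 x) (𝟙 y') (.pair P Q) (.cons (U.pro x) (.pair P Q)) :=
    .cons (U.cell x) (.pair (D.idCell P) (D.idCell Q)) rfl
  refine ((U.opcart x).existsUnique (.nil x) (.pair P Q) rfl rfl X rfl ψ).unique ?_ ?_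
  · refine (comp_pair X (.pair (U.cell x) (D.idCell P)) (.single (D.idCell Q)) _ _ _ rfl rfl rfl _ _
      _ _ (Category.comp_id _).symm (Category.comp_id _).symm (Category.comp_id _).symm).trans ?_
    exact (pair_congr (U.lact_spec P) (D.comp_id _) _ _ _ _).trans (D.id_comp ψ)
  · refine (comp_pair X (.single (U.cell x)) (.pair (D.idCell P) (D.idCell Q)) _ _ _ rfl rfl rfl _ _
      _ _ (Category.comp_id _).symm (Category.comp_id _).symm (Category.comp_id _).symm).trans ?_
    exact (pair_congr (D.comp_id _) (D.id_comp ψ) _ _ _ _).trans (U.lact_comp ψ _ (D.id_comp _))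

theorem ract_assoc {x y y' : D.Obj} {P : D.Pro x y} {Q : D.Pro y y'} {R : D.Pro x y'}
    (ψ : D.Cell (𝟙 x) (𝟙 y') (.pair P Q) R) :
    D.comp (p := .cons P (.pair Q (U.pro y'))) (f' := 𝟙 _) (g' := 𝟙 _)
        (.pair (D.idCell P) (U.ract Q)) ψ (by simp) (by simp) =
      D.comp (.pair ψ (D.idCell (U.pro y'))) (U.ract R) (by simp) (by simp) := by
  let X : D.CellSeq (𝟙 x) (𝟙 y') (.pair P Q) (.cons P (.pair Q (U.pro y'))) :=
    .cons (D.idCell P) (.pair (D.idCell Q) (U.cell y')) rfl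
  refine ((U.opcart y').existsUnique (.pair P Q) (.nil y') rfl rfl X rfl ψ).unique ?_ ?_
  · refine (comp_pair X (.single (D.idCell P)) (.pair (D.idCell Q) (U.cell y')) _ _ _ rfl rfl rfl _ _
      _ _ (Category.comp_id _).symm (Category.comp_id _).symm (Category.comp_id _).symm).trans ?_
    exact (pair_congr (D.comp_id _) (U.ract_spec Q) _ _ _ _).trans (D.id_comp ψ)
  · refine (comp_pair X (.pair (D.idCell P) (D.idCell Q)) (.single (U.cell y')) _ _ _ rfl rfl rfl _ _
      _ _ (Category.comp_id _).symm (Category.comp_id _).symm (Category.comp_id _).symm).trans ?_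
    exact (pair_congr (D.id_comp ψ) (D.comp_id _) _ _ _ _).trans (U.ract_comp ψ _ (D.id_comp _))

theorem ract_eq_lact (x : D.Obj) : U.ract (U.pro x) = U.lact (U.pro x) := by
  refine (U.exists_ract (U.pro x)).unique (U.ract_spec _) ?_
  refine ((U.opcart x).existsUnique (.nil x) (.nil x) rfl rfl (.single (U.cell x)) rfl
    (U.cell x)).unique ?_ (D.comp_id _)
  refine (comp_pair (.single (U.cell x)) (.single (U.cell x)) (.nil _) _ _ _ rfl rfl rfl _ _
      _ _ (Category.comp_id _).symm (Category.comp_id _).symm (Category.comp_id _).symm).trans ?_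
  rw [D.comp_id, show D.comp (.nil (𝟙 x)) (U.cell x) (Category.comp_id _).symm
      (Category.comp_id _).symm = U.cell x from D.id_comp _]
  exact U.lact_comp (U.cell x) _ (D.id_comp _)

/-- The trivial monoid on an object. -/
noncomputable def triv (x : D.Obj) : D.Mon where
  obj := x
  pro := U.pro x
  unit := U.cell x
  mul := U.lact (U.pro x)
  unit_mul := U.lact_spec _
  mul_unit := by rw [← U.ract_eq_lact]; exact U.ract_spec _
  mul_assoc := U.lact_assoc _

/-- A proarrow as a bimodule between trivial monoids. -/
noncomputable def trivBimod {x y : D.Obj} (P : D.Pro x y) : Bimod (U.triv x) (U.triv y) where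
  pro := P
  l := U.lact P
  r := U.ract P
  unit_l := U.lact_spec P
  unit_r := U.ract_spec P
  assoc_l := U.lact_assoc _
  assoc_r := by
    refine Eq.trans ?_ (U.ract_assoc (U.ract P))
    rw [U.ract_eq_lact]; rfl
  assoc_lr := U.lact_assoc _

theorem exists_trivCell {x y : D.Obj} (f : x ⟶ y) :
    ∃! χ : D.Cell f f (.single (U.pro x)) (U.pro y),
      D.comp (.single (U.cell x)) χ (Category.id_comp f).symm (Category.id_comp f).symm =
        D.comp (.nil f) (U.cell y) (Category.comp_id f).symm (Category.comp_id f).symm :=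
  (U.opcart x).existsUnique (.nil x) (.nil x) rfl rfl _ rfl _

/-- The unit cell on a vertical arrow. -/
noncomputable def trivCell {x y : D.Obj} (f : x ⟶ y) : D.Cell f f (.single (U.pro x)) (U.pro y) :=
  (U.exists_trivCell f).choose

theorem trivCell_spec {x y : D.Obj} (f : x ⟶ y) :
    D.comp (.single (U.cell x)) (U.trivCell f) (Category.id_comp f).symm
        (Category.id_comp f).symm =
      D.comp (.nil f) (U.cell y) (Category.comp_id f).symm (Category.comp_id f).symm :=
  (U.exists_trivCell f).choose_spec.1

/-- The homomorphism of trivial monoids given by a vertical arrow. -/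
noncomputable def trivMap {x y : D.Obj} (f : x ⟶ y) : U.triv x ⟶ U.triv y :=
  show Mon.Hom _ _ from
  { hom := f
    cell := U.trivCell f
    unit_cell := U.trivCell_spec f
    mul_cell := by
      refine ((U.opcart x).existsUnique (.nil x) (.single (U.pro x)) rfl rfl
        (.pair (U.cell x) (D.idCell (U.pro x))) rfl (U.trivCell f)).unique ?_ ?_
      · refine (comp_single _ _ _ _ _ _ _ (Category.comp_id _).symm
          (Category.comp_id _).symm).trans ?_
        refine (congrArg (fun x => D.comp (.single x) _ _ _) (U.lact_spec _)).trans ?_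
        exact D.id_comp _
      · refine (comp_pair _ (.single (U.cell x)) (.single (D.idCell _)) _ _ _ rfl rfl rfl _ _
          _ _ (Category.id_comp _).symm (Category.id_comp _).symm (Category.id_comp _).symm).trans ?_
        exact (pair_congr rfl (D.id_comp (U.trivCell f)) _ _ _ _).trans
          (U.lact_comp _ _ (U.trivCell_spec f).symm) }

end Units

end VirtualDoubleCategory

namespace VirtualDoubleCategory

open VDShape (CellSeq)

variable {D : VirtualDoubleCategory.{u, v, w, z}}

namespace Units

variable (U : D.Units)

/-- Embeddings of a monoid into an object: homomorphisms to the trivial monoid. -/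
abbrev Emb (M : D.Mon) (x : D.Obj) : Type (max v z) := Mon.Hom M (U.triv x)

variable {U}

/-- The composite of an embedding with (the unit cell on) a vertical arrow. -/
noncomputable def Emb.comp {M : D.Mon} {x y : D.Obj} (i : U.Emb M x) (f : x ⟶ y) : U.Emb M y :=
  Mon.Hom.comp i (U.trivMap f)

variable (U)

/-- Embeddings `φ` of a bimodule into a proarrow, for given embeddings `i` and `j` of monoids. -/
def IsBimodEmb {M N : D.Mon} {x y : D.Obj} (i : U.Emb M x) (j : U.Emb N y) (B : Bimod M N)
    (P : D.Pro x y) (φ : D.Cell i.hom j.hom (.single B.pro) P) : Prop :=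
  IsBimodHom i j (.single B) (U.trivBimod P) φ

/-- Collapses of monoids: universal embeddings. -/
def IsCollapse {M : D.Mon} {x : D.Obj} (i : U.Emb M x) : Prop :=
  ∀ ⦃y : D.Obj⦄ (j : U.Emb M y), ∃! f : x ⟶ y, i.comp f = j

/-- Collapses of bimodules: universal embeddings over given collapses of the monoids. -/
structure IsBimodCollapse {M N : D.Mon} {x y : D.Obj} (i : U.Emb M x) (j : U.Emb N y)
    (B : Bimod M N) (P : D.Pro x y) (φ : D.Cell i.hom j.hom (.single B.pro) P) : Prop where
  left : U.IsCollapse i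
  right : U.IsCollapse j
  emb : U.IsBimodEmb i j B P φ
  universal : ∀ ⦃x' y' : D.Obj⦄ (f : x ⟶ x') (g : y ⟶ y') (Q : D.Pro x' y')
    (ψ : D.Cell (i.hom ≫ f) (j.hom ≫ g) (.single B.pro) Q),
    U.IsBimodEmb (i.comp f) (j.comp g) B Q ψ →
      ∃! χ : D.Cell f g (.single P) Q, D.comp (.single φ) χ rfl rfl = ψ

/-- Normal collapses: the collapse `i` of `M` also exhibits the unit proarrow of the target as a
collapse of the unit bimodule of `M`. -/
def IsNormalCollapse {M : D.Mon} {x : D.Obj} (i : U.Emb M x) : Prop :=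
  U.IsCollapse i ∧ U.IsBimodCollapse i i M.self (U.pro x) i.cell

/-- Kernels of a vertical arrow `f : c ⟶ d`: monoids on `c` obtained by restricting the trivial
monoid on `d`. -/
structure Kernel {c d : D.Obj} (f : c ⟶ d) where
  mon : D.Mon
  obj_eq : mon.obj = c
  emb : U.Emb mon d
  hom_eq : emb.hom = eqToHom obj_eq ≫ f
  cart : IsCartesian emb.cell

/-- Regular covers: the kernel is a normal collapse. -/
def IsRegularCover {c d : D.Obj} (f : c ⟶ d) : Prop :=
  ∃ K : U.Kernel f, U.IsNormalCollapse K.emb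

/-- Effective monoids: the kernels of vertical arrows. -/
def IsEffective (M : D.Mon) : Prop :=
  ∃ (d : D.Obj) (i : U.Emb M d), IsCartesian i.cell

/-- Effective bimodules: those with a cartesian embedding into a proarrow. -/
def IsEffectiveBimod {M N : D.Mon} (B : Bimod M N) : Prop :=
  ∃ (x y : D.Obj) (i : U.Emb M x) (j : U.Emb N y) (P : D.Pro x y)
    (φ : D.Cell i.hom j.hom (.single B.pro) P), U.IsBimodEmb i j B P φ ∧
      IsCartesian i.cell ∧ IsCartesian j.cell ∧ IsCartesian φ

/-- Regularity of a virtual double category with units `U`. In `collapse_restriction`, `R` with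
`φ` is the restriction of `B` along `f` and `g`, as a bimodule between the kernels. -/
structure IsRegular : Prop where
  effective_collapse : ∀ M : D.Mon, U.IsEffective M →
    ∃ (x : D.Obj) (i : U.Emb M x), U.IsNormalCollapse i
  collapse_restriction : ∀ ⦃c d c' d' : D.Obj⦄ (f : c ⟶ d) (g : c' ⟶ d') (B : D.Pro d d'),
    U.IsRegularCover f → U.IsRegularCover g → ∀ (K : U.Kernel f) (K' : U.Kernel g)
      (R : Bimod K.mon K'.mon) (φ : D.Cell K.emb.hom K'.emb.hom (.single R.pro) B),
      U.IsBimodEmb K.emb K'.emb R B φ → IsCartesian φ →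
        U.IsBimodCollapse K.emb K'.emb R B φ

/-- Exactness of a virtual double category with units `U`. -/
structure IsExact : Prop where
  regular : U.IsRegular
  effective : ∀ M : D.Mon, U.IsEffective M
  effective_bimod : ∀ ⦃M N : D.Mon⦄ (B : Bimod M N), U.IsEffectiveBimod B

end Units

end VirtualDoubleCategory

/-!
A monoid in `D.Mod` consists of a monoid of `D` and a bimodule over it that carries a further unit
and multiplication; forgetting the base monoid, these make the underlying proarrow a monoid of `D`,
its flattening, and in the same way a bimodule in `D.Mod` flattens to a bimodule of `D`. The
embedding of a monoid or a bimodule into its flattening is the identity cell on the underlying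
proarrow, so it is cartesian, and it is universal because the underlying cell of an embedding
determines it: on the base monoid it is obtained by acting on the unit.

Monoid and bimodule structures pull back along cartesian cells, so `D.Mod` inherits the restrictions
of `D`; conversely, cartesian cells of `D.Mod` are cartesian in `D`. The units of `D.Mod` are the
monoids as bimodules over themselves, whether or not `D` has units. The collapse of a monoid does
not change the underlying object, so a regular cover of `D.Mod` is invertible on underlying objects;
the embedding of its kernel therefore differs from the flattening by an isomorphism, and this
reduces the second regularity axiom to the collapses above. Everything is invariant under the choice
of units of `D.Mod`, by the comparison cells between two units of an object.
-/

namespace VirtualDoubleCategory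

open VDShape (CellSeq)

local notation:65 φ " ⨟ " ψ:66 => VDOps.comp _ (CellSeq.single φ) ψ (by simp [*]) (by simp [*])

variable {D : VirtualDoubleCategory.{u, v, w, z}}

theorem comp_single_congr {a b c d x y : D.Obj} {h : a ⟶ c} {k : b ⟶ d} {p : D.Path a b}
    {A : D.Pro c d} {φ φ' : D.Cell h k p A} (H : φ = φ') {f : c ⟶ x} {g : d ⟶ y} {B : D.Pro x y}
    (ψ : D.Cell f g (.single A) B) {f' : a ⟶ x} {g' : b ⟶ y} (ef : f' = h ≫ f)
    (eg : g' = k ≫ g) : (φ ⨟ ψ : D.Cell f' g' p B) = φ' ⨟ ψ := by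
  rw [H]

theorem comp_comp_idCell {a b c d x y : D.Obj} {h : a ⟶ c} {k : b ⟶ d} {f : c ⟶ x} {g : d ⟶ y}
    {p : D.Path a b} {q : D.Path c d} {B : D.Pro x y} (Φ : D.CellSeq h k p q) (ψ : D.Cell f g q B)
    {f' f'' : a ⟶ x} {g' g'' : b ⟶ y} (e₁ : f' = h ≫ f) (e₂ : g' = k ≫ g) (e₃ : f'' = f' ≫ 𝟙 x)
    (e₄ : g'' = g' ≫ 𝟙 y) :
    (D.comp Φ ψ e₁ e₂ ⨟ D.idCell B : D.Cell f'' g'' p B) =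
      D.comp Φ ψ (by simp [*]) (by simp [*]) := by
  obtain rfl := e₃.trans (Category.comp_id _)
  obtain rfl := e₄.trans (Category.comp_id _)
  exact D.comp_id _

theorem comp_idCell_eq {a b c d : D.Obj} {f f' : a ⟶ c} {g g' : b ⟶ d} {A : D.Pro a b}
    {B : D.Pro c d} (φ : D.Cell f g (.single A) B) (e₁ : f' = f ≫ 𝟙 c) (e₂ : g' = g ≫ 𝟙 d) :
    (φ ⨟ D.idCell B : D.Cell f' g' _ B) = D.idCell A ⨟ φ := by
  obtain rfl := e₁.trans (Category.comp_id _)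
  obtain rfl := e₂.trans (Category.comp_id _)
  exact (D.comp_id φ).trans (D.id_comp φ).symm

section Assoc

variable {a b a₁ b₁ a₂ b₂ a₃ b₃ : D.Obj} {f₁ : a ⟶ a₁} {g₁ : b ⟶ b₁} {f₂ : a₁ ⟶ a₂}
  {g₂ : b₁ ⟶ b₂} {f₃ : a₂ ⟶ a₃} {g₃ : b₂ ⟶ b₃} {p : D.Path a b} {q : D.Path a₁ b₁}
  {A : D.Pro a₂ b₂} {B : D.Pro a₃ b₃} {f₂₃ : a₁ ⟶ a₃} {g₂₃ : b₁ ⟶ b₃} {f : a ⟶ a₃} {g : b ⟶ b₃}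
  {f₁₂ : a ⟶ a₂} {g₁₂ : b ⟶ b₂} {Φ : D.CellSeq f₁ g₁ p q} {ψ : D.Cell f₂ g₂ q A}
  {χ : D.Cell f₃ g₃ (.single A) B} {e₁ : f₂₃ = f₂ ≫ f₃} {e₂ : g₂₃ = g₂ ≫ g₃}
  {e₃ : f = f₁ ≫ f₂₃} {e₄ : g = g₁ ≫ g₂₃} {e₅ : f₁₂ = f₁ ≫ f₂} {e₆ : g₁₂ = g₁ ≫ g₂}
  {e₇ : f = f₁₂ ≫ f₃} {e₈ : g = g₁₂ ≫ g₃}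

theorem comp_single_of_comp_eq {ω : D.Cell f₂₃ g₂₃ q B} (h : D.comp (.single ψ) χ e₁ e₂ = ω) :
    D.comp (.single (D.comp Φ ψ e₅ e₆)) χ e₇ e₈ = D.comp Φ ω e₃ e₄ :=
  h ▸ (comp_single Φ ψ χ e₁ e₂ e₃ e₄ e₅ e₆).symm

theorem comp_of_comp_eq {ω : D.Cell f₁₂ g₁₂ p A} (h : D.comp Φ ψ e₅ e₆ = ω) :
    D.comp Φ (D.comp (.single ψ) χ e₁ e₂) e₃ e₄ = D.comp (.single ω) χ e₇ e₈ :=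
  h ▸ comp_single Φ ψ χ e₁ e₂ e₃ e₄ e₅ e₆

end Assoc

/-! ### Cartesian cells -/

/-- An invertible cell, over a pair of isomorphisms of objects: an isomorphism between proarrows
that may have different ends. -/
structure CellIso {a b c d : D.Obj} (e : a ≅ c) (e' : b ≅ d) (A : D.Pro a b) (B : D.Pro c d) where
  hom : D.Cell e.hom e'.hom (.single A) B
  inv : D.Cell e.inv e'.inv (.single B) A
  hom_inv_id : hom ⨟ inv = D.idCell A
  inv_hom_id : inv ⨟ hom = D.idCell B

/-- The identity cell as an invertible cell. -/
def CellIso.refl {a b : D.Obj} (A : D.Pro a b) : CellIso (D := D) (.refl a) (.refl b) A A where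
  hom := D.idCell A
  inv := D.idCell A
  hom_inv_id := D.comp_id _
  inv_hom_id := D.comp_id _

theorem CellIso.isCartesian {a b c d : D.Obj} {e : a ≅ c} {e' : b ≅ d} {A : D.Pro a b}
    {B : D.Pro c d} (Φ : CellIso (D := D) e e' A B) : IsCartesian Φ.hom := by
  refine fun x y h k p => ⟨fun χ χ' H => ?_, fun γ => ⟨γ ⨟ Φ.inv, ?_⟩⟩
  · have cancel (χ : D.Cell h k p A) :
        (D.comp (.single χ) Φ.hom rfl rfl ⨟ Φ.inv : D.Cell h k p A) = χ :=
      (comp_single_of_comp_eq Φ.hom_inv_id).trans (D.comp_id χ)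
    exact (cancel χ).symm.trans ((comp_single_congr H Φ.inv (by simp) (by simp)).trans (cancel χ'))
  · exact (comp_single_of_comp_eq Φ.inv_hom_id).trans (D.comp_id γ)

theorem isCartesian_idCell {a b : D.Obj} (A : D.Pro a b) : IsCartesian (D.idCell A) :=
  (CellIso.refl A).isCartesian

namespace IsCartesian

variable {a b c d : D.Obj} {f : a ⟶ c} {g : b ⟶ d} {A : D.Pro a b} {B : D.Pro c d}
  {φ : D.Cell f g (.single A) B}

theorem existsUnique (hφ : IsCartesian φ) {a' b' : D.Obj} {h : a' ⟶ a} {k : b' ⟶ b}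
    {p : D.Path a' b'} {f' : a' ⟶ c} {g' : b' ⟶ d} (ef : f' = h ≫ f) (eg : g' = k ≫ g)
    (γ : D.Cell f' g' p B) : ∃! χ : D.Cell h k p A, χ ⨟ φ = γ := by
  subst ef eg
  exact (hφ h k p).existsUnique γ

theorem hom_ext (hφ : IsCartesian φ) {a' b' : D.Obj} {h : a' ⟶ a} {k : b' ⟶ b}
    {p : D.Path a' b'} {χ χ' : D.Cell h k p A} {f' : a' ⟶ c} {g' : b' ⟶ d} (ef : f' = h ≫ f)
    (eg : g' = k ≫ g) (H : (χ ⨟ φ : D.Cell f' g' p B) = χ' ⨟ φ) : χ = χ' :=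
  (hφ.existsUnique ef eg _).unique H rfl

theorem comp (hφ : IsCartesian φ) {x y : D.Obj} {f' : c ⟶ x} {g' : d ⟶ y}
    {C : D.Pro x y} {ψ : D.Cell f' g' (.single B) C} (hψ : IsCartesian ψ) {f'' : a ⟶ x}
    {g'' : b ⟶ y} (ef : f'' = f ≫ f') (eg : g'' = g ≫ g') :
    IsCartesian (φ ⨟ ψ : D.Cell f'' g'' _ C) := by
  subst ef eg
  refine fun x y h k p => ⟨fun χ χ' H => ?_, fun γ => ?_⟩
  · refine hφ.hom_ext rfl rfl (hψ.hom_ext (Category.assoc ..).symm (Category.assoc ..).symm ?_)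
    exact (comp_single_of_comp_eq rfl).trans (H.trans (comp_single_of_comp_eq rfl).symm)
  · obtain ⟨γ', h₁, -⟩ := hψ.existsUnique (Category.assoc ..).symm (Category.assoc ..).symm γ
    obtain ⟨χ, h₂, -⟩ := hφ.existsUnique rfl rfl γ'
    exact ⟨χ, (comp_of_comp_eq h₂).trans h₁⟩

theorem exists_cellIso (hφ : IsCartesian φ) [IsIso f] [IsIso g] :
    ∃ Φ : CellIso (D := D) (asIso f) (asIso g) A B, Φ.hom = φ := by
  obtain ⟨ψ, hψ, -⟩ := hφ.existsUnique (asIso f).inv_hom_id.symm (asIso g).inv_hom_id.symm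
    (D.idCell B)
  refine ⟨⟨φ, ψ, hφ.hom_ext (Category.id_comp _).symm (Category.id_comp _).symm ?_, hψ⟩, rfl⟩
  exact (comp_single_of_comp_eq hψ).trans ((D.comp_id φ).trans (D.id_comp φ).symm)

theorem existsUnique_factor (hφ : IsCartesian φ) [IsIso f] [IsIso g] {x y : D.Obj}
    {f₁ : c ⟶ x} {g₁ : d ⟶ y} {f₂ : a ⟶ x} {g₂ : b ⟶ y} {Q : D.Pro x y} (ef : f₂ = f ≫ f₁)
    (eg : g₂ = g ≫ g₁) (ψ : D.Cell f₂ g₂ (.single A) Q) :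
    ∃! χ : D.Cell f₁ g₁ (.single B) Q, φ ⨟ χ = ψ := by
  obtain ⟨Φ, rfl⟩ := hφ.exists_cellIso
  have e : f₁ = inv f ≫ f₂ := by simp [ef]
  have e' : g₁ = inv g ≫ g₂ := by simp [eg]
  refine ⟨D.comp (.single Φ.inv) ψ e e', ?_, ?_⟩
  · exact (comp_of_comp_eq Φ.hom_inv_id).trans (D.id_comp ψ)
  · rintro χ rfl
    exact ((comp_of_comp_eq Φ.inv_hom_id).trans (D.id_comp χ)).symm

theorem exists_cellIso_comp_eq (hφ : IsCartesian φ) {A' : D.Pro a b}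
    {φ' : D.Cell f g (.single A') B} (hφ' : IsCartesian φ') :
    ∃ σ : CellIso (D := D) (.refl a) (.refl b) A A', σ.hom ⨟ φ' = φ := by
  have ef := (Category.id_comp f).symm
  have eg := (Category.id_comp g).symm
  obtain ⟨σ, hσ, -⟩ := hφ'.existsUnique ef eg φ
  obtain ⟨τ, hτ, -⟩ := hφ.existsUnique ef eg φ'
  refine ⟨⟨σ, τ, hφ.hom_ext ef eg ?_, hφ'.hom_ext ef eg ?_⟩, hσ⟩
  · exact (comp_single_of_comp_eq hτ).trans (hσ.trans (D.id_comp φ).symm)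
  · exact (comp_single_of_comp_eq hσ).trans (hτ.trans (D.id_comp φ').symm)

end IsCartesian

/-! ### Actions on cells -/

section PairIdCell

variable {a b c a' b' c' : D.Obj} {x : a ⟶ a'} {y : b ⟶ b'} {t : c ⟶ c'} {p : D.Path a b}
  {q : D.Path b c} {s : D.Path a c} {A : D.Pro a' b'} {B : D.Pro b' c'} {C : D.Pro a' c'}

theorem comp_pair_idCell {p' : D.Path a' b'} {s' : D.Path a' c'} (Φ : D.CellSeq x y p p')
    (β : D.Cell y t q B) (ψ : D.Cell (𝟙 a') (𝟙 b') p' A) (χ : D.Cell (𝟙 a') (𝟙 c') (.pair A B) C)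
    (X : D.CellSeq x t s s') (es : s = p.append q) (es' : s' = p'.append (.single B))
    (hX : X.toList = Φ.toList ++ (CellSeq.single β).toList) :
    D.comp (f' := x) (g' := t) X
        (D.comp (f' := 𝟙 a') (g' := 𝟙 c') (.pair ψ (D.idCell B) es') χ (by simp) (by simp))
        (by simp) (by simp) =
      D.comp (.pair (D.comp (f' := x) (g' := y) Φ ψ (by simp) (by simp)) β es) χ
        (by simp) (by simp) :=
  (comp_pair X Φ (.single β) ψ _ χ es es' hX _ _ _ _ _ _ (Category.comp_id t).symm).trans
    (pair_congr rfl (D.comp_id β) _ _ _ _)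

theorem comp_idCell_pair {q' : D.Path b' c'} {s' : D.Path a' c'} (α : D.Cell x y p A)
    (Φ : D.CellSeq y t q q') (ψ : D.Cell (𝟙 b') (𝟙 c') q' B)
    (χ : D.Cell (𝟙 a') (𝟙 c') (.pair A B) C) (X : D.CellSeq x t s s') (es : s = p.append q)
    (es' : s' = (ProPath.single A).append q')
    (hX : X.toList = (CellSeq.single α).toList ++ Φ.toList) :
    D.comp (f' := x) (g' := t) X
        (D.comp (f' := 𝟙 a') (g' := 𝟙 c') (.pair (D.idCell A) ψ es') χ (by simp) (by simp))
        (by simp) (by simp) =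
      D.comp (.pair α (D.comp (f' := y) (g' := t) Φ ψ (by simp) (by simp)) es) χ
        (by simp) (by simp) :=
  (comp_pair X (.single α) Φ _ ψ χ es es' hX _ _ _ _ (Category.comp_id x).symm _ _).trans
    (pair_congr (D.comp_id α) rfl _ _ _ _)

end PairIdCell

/-- The unit cell of a monoid, precomposed with a vertical arrow: the unit of the monoid of cells
into `M` with both frames equal to `x`. -/
def Mon.unitAt (M : D.Mon) {a : D.Obj} (x : a ⟶ M.obj) : D.Cell x x (.nil a) M.pro :=
  D.comp (.nil x) M.unit (Category.comp_id x).symm (Category.comp_id x).symm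

theorem Mon.comp_unitAt (M : D.Mon) {a b : D.Obj} (h : a ⟶ b) (x : b ⟶ M.obj) {y : a ⟶ M.obj}
    (e : y = h ≫ x) : D.comp (.nil h) (M.unitAt x) e e = M.unitAt y := by
  subst e
  exact comp_comp _ _ _ _ _ _ _ _ rfl rfl (VDOps.compSeq_nil _ _ _ _)

namespace Bimod

variable {M N : D.Mon} {a b c d : D.Obj}

/-- The left action of a bimodule on cells: cells into `M` act on adjacent cells into `B`. -/
def smul (B : Bimod M N) {x : a ⟶ M.obj} {y : b ⟶ M.obj} {t : c ⟶ N.obj} {p : D.Path a b}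
    {q : D.Path b c} {s : D.Path a c} (μ : D.Cell x y p M.pro) (β : D.Cell y t q B.pro)
    (e : s = p.append q := by rfl) : D.Cell x t s B.pro :=
  D.comp (.pair μ β e) B.l (Category.comp_id x).symm (Category.comp_id t).symm

/-- The right action of a bimodule on cells: cells into `N` act on adjacent cells into `B`. -/
def rsmul (B : Bimod M N) {x : a ⟶ M.obj} {y : b ⟶ N.obj} {t : c ⟶ N.obj} {p : D.Path a b}
    {q : D.Path b c} {s : D.Path a c} (β : D.Cell x y p B.pro) (ν : D.Cell y t q N.pro)
    (e : s = p.append q := by rfl) : D.Cell x t s B.pro :=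
  D.comp (.pair β ν e) B.r (Category.comp_id x).symm (Category.comp_id t).symm

variable (B : Bimod M N)

section Comp

variable {a' b' c' : D.Obj} {h : a ⟶ a'} {k : b ⟶ b'} {l : c ⟶ c'} {p : D.Path a b}
  {q : D.Path b c} {s : D.Path a c} {p' : D.Path a' b'} {q' : D.Path b' c'} {s' : D.Path a' c'}
  (X : D.CellSeq h l s s') (Φ : D.CellSeq h k p p') (Φ' : D.CellSeq k l q q')

theorem comp_smul {x : a' ⟶ M.obj} {y : b' ⟶ M.obj} {t : c' ⟶ N.obj} (μ : D.Cell x y p' M.pro)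
    (β : D.Cell y t q' B.pro) (e : s' = p'.append q') (es : s = p.append q)
    (hX : X.toList = Φ.toList ++ Φ'.toList) {x' : a ⟶ M.obj} {t' : c ⟶ N.obj} {y' : b ⟶ M.obj}
    (ex : x' = h ≫ x) (et : t' = l ≫ t) (ey : y' = k ≫ y) :
    D.comp X (B.smul μ β e) ex et = B.smul (D.comp Φ μ ex ey) (D.comp Φ' β ey et) es :=
  comp_pair X Φ Φ' μ β B.l es e hX _ _ _ _ _ _ _

theorem comp_rsmul {x : a' ⟶ M.obj} {y : b' ⟶ N.obj} {t : c' ⟶ N.obj} (β : D.Cell x y p' B.pro)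
    (ν : D.Cell y t q' N.pro) (e : s' = p'.append q') (es : s = p.append q)
    (hX : X.toList = Φ.toList ++ Φ'.toList) {x' : a ⟶ M.obj} {t' : c ⟶ N.obj} {y' : b ⟶ N.obj}
    (ex : x' = h ≫ x) (et : t' = l ≫ t) (ey : y' = k ≫ y) :
    D.comp X (B.rsmul β ν e) ex et = B.rsmul (D.comp Φ β ex ey) (D.comp Φ' ν ey et) es :=
  comp_pair X Φ Φ' β ν B.r es e hX _ _ _ _ _ _ _

end Comp

section Congr

variable {p : D.Path a b} {q : D.Path b c} {s : D.Path a c}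

theorem smul_congr {x : a ⟶ M.obj} {y : b ⟶ M.obj} {t : c ⟶ N.obj} {μ μ' : D.Cell x y p M.pro}
    {β β' : D.Cell y t q B.pro} (hμ : μ = μ') (hβ : β = β') (e : s = p.append q) :
    B.smul μ β e = B.smul μ' β' e := by
  rw [hμ, hβ]

theorem rsmul_congr {x : a ⟶ M.obj} {y : b ⟶ N.obj} {t : c ⟶ N.obj} {β β' : D.Cell x y p B.pro}
    {ν ν' : D.Cell y t q N.pro} (hβ : β = β') (hν : ν = ν') (e : s = p.append q) :
    B.rsmul β ν e = B.rsmul β' ν' e := by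
  rw [hβ, hν]

end Congr

theorem smul_unitAt {x : a ⟶ M.obj} {t : c ⟶ N.obj} {q : D.Path a c} (β : D.Cell x t q B.pro) :
    B.smul (M.unitAt x) β = β := by
  refine .trans ?_ ((congrArg (D.comp (.single β) · (Category.comp_id x).symm
    (Category.comp_id t).symm) B.unit_l).trans (D.comp_id β))
  exact (comp_pair_idCell (.nil x) β M.unit B.l _ rfl rfl rfl).symm

theorem rsmul_unitAt {x : a ⟶ M.obj} {t : c ⟶ N.obj} {q : D.Path a c} (β : D.Cell x t q B.pro)
    (e : q = q.append (.nil c) := (ProPath.append_nil q).symm) :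
    B.rsmul β (N.unitAt t) e = β := by
  refine .trans ?_ ((congrArg (D.comp (.single β) · (Category.comp_id x).symm
    (Category.comp_id t).symm) B.unit_r).trans (D.comp_id β))
  exact (comp_idCell_pair β (.nil t) N.unit B.r _ e rfl rfl).symm

section Assoc

variable {p : D.Path a b} {q : D.Path b c} {r : D.Path c d} {pq : D.Path a c} {qr : D.Path b d}
  {s : D.Path a d}

theorem smul_smul {x : a ⟶ M.obj} {y : b ⟶ M.obj} {t : c ⟶ M.obj} {l : d ⟶ N.obj}
    (μ : D.Cell x y p M.pro) (μ' : D.Cell y t q M.pro) (β : D.Cell t l r B.pro)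
    (e₁ : pq = p.append q) (e₂ : s = pq.append r) (e₃ : qr = q.append r) (e₄ : s = p.append qr) :
    B.smul (M.self.smul μ μ' e₁) β e₂ = B.smul μ (B.smul μ' β e₃) e₄ := by
  subst e₁ e₃ e₄
  let X : D.CellSeq x l (p.append (q.append r)) (.cons M.pro (.pair M.pro B.pro)) :=
    .cons μ (.pair μ' β) rfl
  refine (comp_pair_idCell (.pair μ μ') β M.mul B.l X e₂ rfl rfl).symm.trans ?_
  exact (congrArg (D.comp X · _ _) B.assoc_l).trans
    (comp_idCell_pair μ (.pair μ' β) B.l B.l X rfl rfl rfl)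

theorem rsmul_rsmul {x : a ⟶ M.obj} {y : b ⟶ N.obj} {t : c ⟶ N.obj} {l : d ⟶ N.obj}
    (β : D.Cell x y p B.pro) (ν : D.Cell y t q N.pro) (ν' : D.Cell t l r N.pro)
    (e₁ : pq = p.append q) (e₂ : s = pq.append r) (e₃ : qr = q.append r) (e₄ : s = p.append qr) :
    B.rsmul (B.rsmul β ν e₁) ν' e₂ = B.rsmul β (N.self.smul ν ν' e₃) e₄ := by
  subst e₁ e₃ e₄
  let X : D.CellSeq x l (p.append (q.append r)) (.cons B.pro (.pair N.pro N.pro)) :=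
    .cons β (.pair ν ν') rfl
  refine (comp_pair_idCell (.pair β ν) ν' B.r B.r X e₂ rfl rfl).symm.trans ?_
  exact (congrArg (D.comp X · _ _) B.assoc_r.symm).trans
    (comp_idCell_pair β (.pair ν ν') N.mul B.r X rfl rfl rfl)

theorem rsmul_smul {x : a ⟶ M.obj} {y : b ⟶ M.obj} {t : c ⟶ N.obj} {l : d ⟶ N.obj}
    (μ : D.Cell x y p M.pro) (β : D.Cell y t q B.pro) (ν : D.Cell t l r N.pro)
    (e₁ : pq = p.append q) (e₂ : s = pq.append r) (e₃ : qr = q.append r) (e₄ : s = p.append qr) :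
    B.rsmul (B.smul μ β e₁) ν e₂ = B.smul μ (B.rsmul β ν e₃) e₄ := by
  subst e₁ e₃ e₄
  let X : D.CellSeq x l (p.append (q.append r)) (.cons M.pro (.pair B.pro N.pro)) :=
    .cons μ (.pair β ν) rfl
  refine (comp_pair_idCell (.pair μ β) ν B.l B.r X e₂ rfl rfl).symm.trans ?_
  exact (congrArg (D.comp X · _ _) B.assoc_lr).trans
    (comp_idCell_pair μ (.pair β ν) B.r B.l X rfl rfl rfl)

end Assoc

end Bimod

/-! ### Bimodule homomorphisms -/

section Hom

variable {M N M' N' : D.Mon} {f : Mon.Hom M M'} {g : Mon.Hom N N'}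

theorem isBimodHom_single_iff {A : Bimod M N} {C : Bimod M' N'}
    {φ : D.Cell f.hom g.hom (.single A.pro) C.pro} : IsBimodHom f g (.single A) C φ ↔
      A.l ⨟ φ = C.smul f.cell φ ∧ A.r ⨟ φ = C.rsmul φ g.cell := by
  refine ⟨fun h => ⟨(comp_congr rfl _ _ _).trans (h.left A _ rfl),
    (comp_congr rfl _ _ _).trans (h.right (.nil _) A rfl)⟩,
    fun ⟨left, right⟩ => ⟨fun _ _ e => ?_, fun q _ e => ?_, fun q _ _ _ e => ?_, trivial⟩⟩
  · cases e
    exact (comp_congr rfl _ _ _).trans left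
  · cases q with
    | nil =>
      cases e
      exact (comp_congr rfl _ _ _).trans right
    | cons _ q => cases q <;> cases e
  · cases q with
    | nil => cases e
    | cons _ q => cases q <;> cases e

theorem isBimodHom_pair {L : D.Mon} {A : Bimod M L} {B : Bimod L N} {C : Bimod M' N'}
    {φ : D.Cell f.hom g.hom (.pair A.pro B.pro) C.pro}
    (left : D.comp (p := .cons M.pro (.pair A.pro B.pro)) (.pair A.l (D.idCell B.pro)) φ
      (Category.id_comp _).symm (Category.id_comp _).symm = C.smul f.cell φ)
    (right : D.comp (p := .cons A.pro (.pair B.pro N.pro)) (.pair (D.idCell A.pro) B.r) φ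
      (Category.id_comp _).symm (Category.id_comp _).symm = C.rsmul φ g.cell)
    (inner : D.comp (p := .cons A.pro (.pair L.pro B.pro)) (.pair A.r (D.idCell B.pro)) φ
        (Category.id_comp _).symm (Category.id_comp _).symm =
      D.comp (.pair (D.idCell A.pro) B.l) φ (Category.id_comp _).symm (Category.id_comp _).symm) :
    IsBimodHom f g (.pair A B) C φ where
  left {L} B' q e := by
    cases e
    exact (comp_congr rfl _ _ _).trans left
  right {L} q B' e := by
    cases q with
    | nil => cases e
    | cons _ q =>
      cases q with
      | nil =>
        cases e
        exact (comp_congr rfl _ _ _).trans right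
      | cons _ q => cases q <;> cases e
  inner {K L K'} q B₁ B₂ r e := by
    cases q with
    | nil =>
      cases e
      exact (comp_congr rfl _ _ _).trans (inner.trans (comp_congr rfl _ _ _))
    | cons _ q =>
      cases q with
      | nil => cases e
      | cons _ q => cases q <;> cases e
  nil := trivial

section Map

variable {A : Bimod M N} {C : Bimod M' N'} {φ : D.Cell f.hom g.hom (.single A.pro) C.pro}
  {a b c : D.Obj} {p : D.Path a b} {q : D.Path b c} {s : D.Path a c}

theorem IsBimodHom.map_smul (hφ : IsBimodHom f g (.single A) C φ) {x : a ⟶ M.obj} {y : b ⟶ M.obj}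
    {t : c ⟶ N.obj} (μ : D.Cell x y p M.pro) (α : D.Cell y t q A.pro) (e : s = p.append q)
    {x' : a ⟶ M'.obj} {y' : b ⟶ M'.obj} {t' : c ⟶ N'.obj} (ex : x' = x ≫ f.hom)
    (ey : y' = y ≫ f.hom) (et : t' = t ≫ g.hom) :
    (A.smul μ α e ⨟ φ : D.Cell x' t' s C.pro) =
      C.smul (μ ⨟ f.cell : D.Cell x' y' p M'.pro) (α ⨟ φ) e :=
  hφ.left_comp rfl μ α (.nil t) e e (ProPath.append_nil _).symm _ (.single α) rfl rfl ex et ey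

theorem IsBimodHom.map_rsmul (hφ : IsBimodHom f g (.single A) C φ) {x : a ⟶ M.obj} {y : b ⟶ N.obj}
    {t : c ⟶ N.obj} (α : D.Cell x y p A.pro) (ν : D.Cell y t q N.pro) (e : s = p.append q)
    {x' : a ⟶ M'.obj} {y' : b ⟶ N'.obj} {t' : c ⟶ N'.obj} (ex : x' = x ≫ f.hom)
    (ey : y' = y ≫ g.hom) (et : t' = t ≫ g.hom) :
    (A.rsmul α ν e ⨟ φ : D.Cell x' t' s C.pro) =
      C.rsmul (α ⨟ φ : D.Cell x' y' p C.pro) (ν ⨟ g.cell) e :=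
  hφ.right_comp (t₀ := .nil _) rfl (.nil x) α ν e rfl e _ (.single α) rfl rfl ex et ey

end Map

namespace Mon.Hom

variable (f)

theorem isBimodHom : IsBimodHom f f (.single M.self) M'.self f.cell :=
  isBimodHom_single_iff.2 ⟨f.mul_cell, f.mul_cell⟩

theorem map_unitAt {a : D.Obj} (x : a ⟶ M.obj) {y : a ⟶ M'.obj} (e : y = x ≫ f.hom) :
    M.unitAt x ⨟ f.cell = M'.unitAt y :=
  (comp_single_of_comp_eq f.unit_cell).trans (M'.comp_unitAt x f.hom e)

theorem map_mul {a b c : D.Obj} {x : a ⟶ M.obj} {y : b ⟶ M.obj} {t : c ⟶ M.obj} {p : D.Path a b}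
    {q : D.Path b c} {s : D.Path a c} (μ : D.Cell x y p M.pro) (ν : D.Cell y t q M.pro)
    (e : s = p.append q) {x' : a ⟶ M'.obj} {y' : b ⟶ M'.obj} {t' : c ⟶ M'.obj}
    (ex : x' = x ≫ f.hom) (ey : y' = y ≫ f.hom) (et : t' = t ≫ f.hom) :
    (M.self.smul μ ν e ⨟ f.cell : D.Cell x' t' s M'.pro) =
      M'.self.smul (μ ⨟ f.cell : D.Cell x' y' p M'.pro) (ν ⨟ f.cell) e :=
  f.isBimodHom.map_smul μ ν e ex ey et

end Mon.Hom

end Hom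

/-! ### Units -/

namespace Bimod

variable {M N : D.Mon} (B : Bimod M N)

/-- The left action of a bimodule, as a cell of `D.Mod`. -/
def lCell : D.Mod.Cell (𝟙 M : M ⟶ M) (𝟙 N : N ⟶ N) (.pair M.self B) B :=
  ⟨B.l, isBimodHom_pair B.assoc_l B.assoc_lr.symm B.assoc_l⟩

/-- The right action of a bimodule, as a cell of `D.Mod`. -/
def rCell : D.Mod.Cell (𝟙 M : M ⟶ M) (𝟙 N : N ⟶ N) (.pair B N.self) B :=
  ⟨B.r, isBimodHom_pair B.assoc_lr B.assoc_r B.assoc_r.symm⟩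

end Bimod

namespace Mon

/-- The cell of a monoid homomorphism, as a cell of `D.Mod` between monoids regarded as bimodules
over themselves. -/
def selfCell {M N : D.Mod.Obj} (f : M ⟶ N) :
    D.Mod.Cell f f (.single (Mon.self M)) (Mon.self N) :=
  ⟨Hom.cell f, Hom.isBimodHom f⟩

/-- The unit of a monoid, as a cell of `D.Mod`; it exhibits the monoid as a unit of itself. -/
def unitCell (M : D.Mod.Obj) : D.Mod.Cell (𝟙 M) (𝟙 M) (.nil M) (self M) :=
  ⟨M.unit,
    { left := fun _ _ e => by cases e
      right := fun q _ e => by cases q <;> cases e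
      inner := fun q _ _ _ e => by cases q <;> cases e
      nil := (Mon.mul_unit M).trans (Mon.unit_mul M).symm }⟩

end Mon

local notation:65 Φ:66 " ⊚ " χ:65 => VDOps.comp _ Φ χ (symm (Category.id_comp _)) (symm (Category.id_comp _))

theorem idSeq_toList_comp {a b c d : D.Obj} {f : a ⟶ c} {g : b ⟶ d} {p : D.Path a b}
    {B : D.Pro c d} (φ : D.Cell f g p B) (X : D.CellSeq (𝟙 a) (𝟙 b) p p)
    (hX : X.toList = (D.idSeq p).toList) : X ⊚ φ = φ :=
  (comp_congr hX _ _ _).trans (D.id_comp φ)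

section Whisker

variable {a b c d x y : D.Obj} {f : a ⟶ x} {g : d ⟶ y} {C : D.Pro x y} (q : D.Path a b)
  (r : D.Path c d) {S S' S'' : D.Path a d} {s s' s'' : D.Path b c}

theorem comp_comp_of_whisker {Φ : D.CellSeq (𝟙 b) (𝟙 c) s s'} {Ψ : D.CellSeq (𝟙 b) (𝟙 c) s' s''}
    {Ω : D.CellSeq (𝟙 b) (𝟙 c) s s''} (hΩ : (VDOps.compSeq Φ Ψ (Category.id_comp _).symm
      (Category.id_comp _).symm).toList = Ω.toList) {es : S = q.append (s.append r)}
    {es' : S' = q.append (s'.append r)} {es'' : S'' = q.append (s''.append r)}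
    {X : D.CellSeq (𝟙 a) (𝟙 d) S S'} (hX : X.toList = (D.whisker q Φ r es es').toList)
    {Y : D.CellSeq (𝟙 a) (𝟙 d) S' S''} (hY : Y.toList = (D.whisker q Ψ r es' es'').toList)
    (χ : D.Cell f g S'' C) : X ⊚ (Y ⊚ χ) = D.whisker q Ω r es es'' ⊚ χ := by
  refine comp_comp _ _ _ _ _ _ _ _ (Category.id_comp _).symm (Category.id_comp _).symm ?_
  obtain rfl := VDShape.CellSeq.ext_toList hX
  rw [whisker_compSeq Y (D.idSeq q) Ψ (D.idSeq r) Φ es es' es'' (hY.trans (toList_whisker ..)),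
    toList_whisker, hΩ]

-- When `Φ` inserts the unit cell of a monoid next to `B`, its retraction `ρ` is the action on `B`,
-- and `h` holds because homomorphisms equalize the actions of an intermediate monoid.
theorem bijective_comp_of_retraction {B : D.Pro b c} {Φ : D.CellSeq (𝟙 b) (𝟙 c) (.single B) s}
    {ρ : D.Cell (𝟙 b) (𝟙 c) s B} {Ω : D.CellSeq (𝟙 b) (𝟙 c) s s} (hρ : Φ ⊚ ρ = D.idCell B)
    (hΩ : (VDOps.compSeq (.single ρ) Φ (Category.id_comp _).symm
      (Category.id_comp _).symm).toList = Ω.toList)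
    {eS : S = q.append ((ProPath.single B).append r)} {es : S' = q.append (s.append r)}
    {X : D.CellSeq (𝟙 a) (𝟙 d) S S'}
    (hX : X.toList = (D.whisker q Φ r eS es).toList)
    (h : ∀ χ : D.Cell f g S' C, D.whisker q Ω r es es ⊚ χ = χ) :
    Function.Bijective fun χ : D.Cell f g S' C => (X ⊚ χ : D.Cell f g S C) := by
  refine Function.bijective_iff_has_inverse.2
    ⟨fun γ => D.whisker q (.single ρ) r es eS ⊚ γ, fun χ => ?_, fun γ => ?_⟩
  · exact (comp_comp_of_whisker q r hΩ rfl hX χ).trans (h χ)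
  · refine (comp_comp_of_whisker q r (Ω := .single (D.idCell B)) ?_ hX rfl γ).trans ?_
    · rw [VDOps.toList_compSeq_single, hρ]
    · subst eS
      exact idSeq_toList_comp γ _
        ((toList_whisker ..).trans (VDOps.toList_idSeq_append q ((ProPath.single B).append r)).symm)

end Whisker

theorem toList_undSeq_whisker {L M N K : D.Mod.Obj} (q : D.Mod.Path L M) {s t : D.Mod.Path M N}
    (Ξ : D.Mod.CellSeq (𝟙 M) (𝟙 N) s t) (r : D.Mod.Path N K) {s' t' : D.Mod.Path L K}
    (es : s' = q.append (s.append r)) (et : t' = q.append (t.append r)) :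
    (undSeq (D.Mod.whisker q Ξ r es et)).toList =
      (D.idSeq (und q)).toList ++ ((undSeq Ξ).toList ++ (D.idSeq (und r)).toList) := by
  subst es et
  rw [toList_undSeq_append _ (D.Mod.idSeq q) (Ξ.append (D.Mod.idSeq r)) rfl rfl
    (by simp [VDOps.whisker]), toList_undSeq_append _ Ξ (D.Mod.idSeq r) rfl rfl (by simp),
    undSeq_idSeq, undSeq_idSeq]

theorem _root_.ProPath.cases_append_single {O : Type*} {P : O → O → Type*}
    {motive : ∀ {a b : O}, ProPath P a b → Prop} (nil : ∀ a, motive (.nil a))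
    (append : ∀ {a b c : O} (q : ProPath P a b) (B : P b c), motive (q.append (.single B))) :
    ∀ {a b : O} (p : ProPath P a b), motive p
  | _, _, .nil a => nil a
  | _, _, .cons A p => p.cases_append_single
      (motive := fun {x _} p => ∀ {a' : O} (A : P a' x), motive (.cons A p))
      (fun _ _ A => append (.nil _) A) (fun q B _ A => append (.cons A q) B) A

namespace Mon

theorem bijective_comp_unitCell {M c d : D.Mod.Obj} (f : M ⟶ c) (g : M ⟶ d) (C : D.Mod.Pro c d) :
    Function.Bijective fun χ : D.Mod.Cell f g (.single (self M)) C =>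
      (D.Mod.whisker (.nil M) (.single (unitCell M)) (.nil M) rfl rfl ⊚ χ :
        D.Mod.Cell f g (.nil M) C) := by
  refine Function.bijective_iff_has_inverse.2 ⟨fun γ => D.Mod.comp (.pair (selfCell f) γ)
    (Bimod.lCell C) (Category.comp_id f).symm (Category.comp_id g).symm, fun χ => Subtype.ext ?_,
    fun γ => Subtype.ext ?_⟩
  · have hχ := χ.2.map_smul (D.idCell M.pro) M.unit rfl (Category.id_comp _).symm
      (Category.id_comp _).symm (Category.id_comp _).symm
    refine .trans (congrArg (C.smul · _) (D.id_comp _).symm) (hχ.symm.trans ?_)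
    refine idSeq_toList_comp χ.1 (.single (M.self.smul (D.idCell M.pro) M.unit)) ?_
    exact congrArg (fun ω => [VDShape.AnyCell.mk ω]) M.mul_unit
  · refine (C.comp_smul (.single M.unit) (.single M.unit) (.nil (𝟙 _)) (Hom.cell f) γ.1 rfl rfl rfl
      (Category.id_comp _).symm (Category.id_comp _).symm (Category.id_comp _).symm).trans ?_
    exact (C.smul_congr (Hom.unit_cell f) (D.id_comp γ.1) _).trans (C.smul_unitAt γ.1)

theorem bijective_comp_unitCell_cons {M N b c d : D.Mod.Obj} (B : D.Mod.Pro M N)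
    (r : D.Mod.Path N b) (f : M ⟶ c) (g : b ⟶ d) (C : D.Mod.Pro c d) :
    Function.Bijective fun χ : D.Mod.Cell f g (.cons (self M) (.cons B r)) C =>
      (D.Mod.whisker (.nil M) (.single (unitCell M)) (.cons B r) rfl rfl ⊚ χ :
        D.Mod.Cell f g (.cons B r) C) := by
  let Φ : D.Mod.CellSeq (𝟙 M) (𝟙 N) (.single B) (.pair (self M) B) :=
    .pair (unitCell M) (D.Mod.idCell B)
  have hρ : Φ ⊚ Bimod.lCell B = D.Mod.idCell B := Subtype.ext B.unit_l
  refine bijective_comp_of_retraction (D := D.Mod) (.nil M) r (Ω := .pair (unitCell M)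
    (Bimod.lCell B)) hρ ?_ rfl fun χ => Subtype.ext ?_
  · refine (toList_compSeq_pair (D := D.Mod) _ (.nil _) (.single (Bimod.lCell B)) (unitCell M)
      (D.Mod.idCell B) rfl rfl rfl _ (Category.id_comp _).symm _).trans ?_
    exact congrArg₂ (fun x y => [VDShape.AnyCell.mk x, VDShape.AnyCell.mk y])
      (D.Mod.id_comp (unitCell M)) (D.Mod.comp_id (Bimod.lCell B))
  · let ι : D.Cell (𝟙 M.obj) (𝟙 M.obj) (.single M.pro) M.pro :=
      M.self.rsmul M.unit (D.idCell M.pro)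
    let X : D.CellSeq (𝟙 M.obj) (𝟙 _) (.cons M.pro (und (.cons B r)))
        (und (.cons (self M) (.cons B r))) := .cons ι (D.idSeq (und (.cons B r))) rfl
    refine .trans (Eq.symm ?_) (idSeq_toList_comp χ.1 X
      (congrArg (fun ω => VDShape.AnyCell.mk ω :: (D.idSeq (und (.cons B r))).toList) M.unit_mul))
    refine χ.2.inner_comp (t₀ := .nil _) rfl (.nil _) M.unit (D.idCell _) (D.idCell B.pro)
      (D.idSeq (und r)) rfl rfl rfl _ _ rfl ((toList_undSeq_whisker _ _ _ _ _).trans ?_) _ _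
    exact congrArg (fun ω => ⟨M.unit⟩ :: VDShape.AnyCell.mk ω :: (D.idSeq (und r)).toList)
      (D.id_comp B.l).symm

theorem bijective_comp_unitCell_append_single {L K M N c d : D.Mod.Obj} (q : D.Mod.Path L K)
    (B : D.Mod.Pro K M) (r : D.Mod.Path M N) (f : L ⟶ c) (g : N ⟶ d) (C : D.Mod.Pro c d) :
    Function.Bijective fun
        χ : D.Mod.Cell f g ((q.append (.single B)).append (.cons (self M) r)) C =>
      (D.Mod.whisker (q.append (.single B)) (.single (unitCell M)) r rfl rfl ⊚ χ :
        D.Mod.Cell f g ((q.append (.single B)).append r) C) := by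
  have eS : (q.append (.single B)).append r = q.append ((ProPath.single B).append r) :=
    ProPath.append_assoc _ _ _
  have es : (q.append (.single B)).append (.cons (self M) r) =
      q.append ((ProPath.pair B (self M)).append r) := ProPath.append_assoc _ _ _
  let Φ : D.Mod.CellSeq (𝟙 K) (𝟙 M) (.single B) (.pair B (self M)) :=
    .pair (D.Mod.idCell B) (unitCell M)
  have hρ : Φ ⊚ Bimod.rCell B = D.Mod.idCell B := Subtype.ext B.unit_r
  refine bijective_comp_of_retraction (D := D.Mod) q r (Ω := .pair (Bimod.rCell B) (unitCell M))
    hρ ?_ (eS := eS) (es := es) ?_ fun χ => Subtype.ext ?_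
  · refine (toList_compSeq_pair (D := D.Mod) _ (.single (Bimod.rCell B)) (.nil _) (D.Mod.idCell B)
      (unitCell M) rfl rfl rfl _ (Category.id_comp _).symm _).trans ?_
    exact congrArg₂ (fun x y => [VDShape.AnyCell.mk x, VDShape.AnyCell.mk y])
      (D.Mod.comp_id (Bimod.rCell B)) (D.Mod.id_comp (unitCell M))
  · refine ((toList_whisker _ _ _ _ _).trans ?_).trans (toList_whisker _ _ _ _ _).symm
    rw [VDOps.toList_idSeq_append, List.append_assoc]
    rfl
  · refine Eq.trans ?_ (idSeq_toList_comp χ.1 (undSeq (D.Mod.whisker q (s := .pair B M.self)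
      (.pair (D.Mod.idCell B) (D.Mod.idCell M.self)) r es es)) ?_)
    · refine χ.2.inner_comp (ProPath.append_assoc _ _ _) (D.idSeq (und q)) (D.idCell B.pro)
        (D.idCell M.pro) M.unit (D.idSeq (und r)) ?_ rfl rfl _ _ ?_ ?_ _ _
      · rw [ProPath.append_assoc, und_append]
        rfl
      · refine (toList_undSeq_whisker _ _ _ _ _).trans ?_
        exact congrArg (fun ω => (D.idSeq (und q)).toList ++ VDShape.AnyCell.mk ω :: ⟨M.unit⟩ ::
          (D.idSeq (und r)).toList) (D.id_comp B.r).symm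
      · refine (toList_undSeq_whisker _ _ _ _ _).trans ?_
        exact congrArg (fun ω => (D.idSeq (und q)).toList ++ ⟨D.idCell B.pro⟩ ::
          VDShape.AnyCell.mk ω :: (D.idSeq (und r)).toList) M.mul_unit.symm
    · refine (toList_undSeq_whisker _ _ _ _ _).trans ?_
      rw [ProPath.append_assoc, toList_idSeq_und_append]
      rfl

theorem isOpcartesian_unitCell (M : D.Mod.Obj) : IsOpcartesian (unitCell M) := by
  intro a b c d q
  induction q using ProPath.cases_append_single with
  | nil M =>
    intro r f g C
    cases r with
    | nil => exact bijective_comp_unitCell f g C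
    | cons B r => exact bijective_comp_unitCell_cons B r f g C
  | append q B => exact fun r f g C => bijective_comp_unitCell_append_single q B r f g C

end Mon

/-! ### Restrictions -/

section Transfer

variable {M N M' N' : D.Mon} {f : Mon.Hom M M'} {g : Mon.Hom N N'} {C : Bimod M' N'}
  {R : D.Pro M.obj N.obj} {φ : D.Cell f.hom g.hom (.single R) C.pro} {a b c : D.Obj}
  {p : D.Path a b} {q : D.Path b c} {s : D.Path a c}

theorem comp_pair_comp_of_eq_smul {l : D.Cell (𝟙 _) (𝟙 _) (.pair M.pro R) R}
    (hl : l ⨟ φ = C.smul f.cell φ) {x : a ⟶ M.obj} {y : b ⟶ M.obj} {t : c ⟶ N.obj}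
    (μ : D.Cell x y p M.pro) (α : D.Cell y t q R) (e : s = p.append q) {x₁ : a ⟶ M.obj}
    {t₁ : c ⟶ N.obj} (ex₁ : x₁ = x ≫ 𝟙 _) (et₁ : t₁ = t ≫ 𝟙 _) {x' : a ⟶ M'.obj}
    {y' : b ⟶ M'.obj} {t' : c ⟶ N'.obj} (ex : x' = x ≫ f.hom) (ey : y' = y ≫ f.hom)
    (et : t' = t ≫ g.hom) :
    (D.comp (.pair μ α e) l ex₁ et₁ ⨟ φ : D.Cell x' t' s C.pro) =
      C.smul (μ ⨟ f.cell : D.Cell x' y' p M'.pro) (α ⨟ φ) e :=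
  (comp_single_of_comp_eq hl).trans
    (C.comp_smul (.pair μ α e) (.single μ) (.single α) f.cell φ rfl e rfl ex et ey)

theorem comp_pair_comp_of_eq_rsmul {r : D.Cell (𝟙 _) (𝟙 _) (.pair R N.pro) R}
    (hr : r ⨟ φ = C.rsmul φ g.cell) {x : a ⟶ M.obj} {y : b ⟶ N.obj} {t : c ⟶ N.obj}
    (α : D.Cell x y p R) (ν : D.Cell y t q N.pro) (e : s = p.append q) {x₁ : a ⟶ M.obj}
    {t₁ : c ⟶ N.obj} (ex₁ : x₁ = x ≫ 𝟙 _) (et₁ : t₁ = t ≫ 𝟙 _) {x' : a ⟶ M'.obj}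
    {y' : b ⟶ N'.obj} {t' : c ⟶ N'.obj} (ex : x' = x ≫ f.hom) (ey : y' = y ≫ g.hom)
    (et : t' = t ≫ g.hom) :
    (D.comp (.pair α ν e) r ex₁ et₁ ⨟ φ : D.Cell x' t' s C.pro) =
      C.rsmul (α ⨟ φ : D.Cell x' y' p C.pro) (ν ⨟ g.cell) e :=
  (comp_single_of_comp_eq hr).trans
    (C.comp_rsmul (.pair α ν e) (.single α) (.single ν) φ g.cell rfl e rfl ex et ey)

/-- The bimodule carried by a restriction of the underlying proarrow of a bimodule: an action of `C`
on a cartesian cell factors uniquely through that cell. -/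
def Bimod.ofIsCartesian (hφ : IsCartesian φ) {l : D.Cell (𝟙 _) (𝟙 _) (.pair M.pro R) R}
    {r : D.Cell (𝟙 _) (𝟙 _) (.pair R N.pro) R} (hl : l ⨟ φ = C.smul f.cell φ)
    (hr : r ⨟ φ = C.rsmul φ g.cell) : Bimod M N :=
  have ef : f.hom = 𝟙 _ ≫ f.hom := (Category.id_comp _).symm
  have eg : g.hom = 𝟙 _ ≫ g.hom := (Category.id_comp _).symm
  have id_f := D.id_comp f.cell
  have id_g := D.id_comp g.cell
  have id_φ := D.id_comp φ
  have left {p q s} (μ : D.Cell (𝟙 M.obj) (𝟙 M.obj) p M.pro) (α : D.Cell (𝟙 _) (𝟙 _) q R)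
      (e : s = p.append q) := comp_pair_comp_of_eq_smul hl μ α e (Category.comp_id _).symm
    (Category.comp_id _).symm ef ef eg
  have right {p q s} (α : D.Cell (𝟙 _) (𝟙 _) p R) (ν : D.Cell (𝟙 N.obj) (𝟙 N.obj) q N.pro)
      (e : s = p.append q) := comp_pair_comp_of_eq_rsmul hr α ν e (Category.comp_id _).symm
    (Category.comp_id _).symm ef eg eg
  { pro := R
    l := l
    r := r
    unit_l := hφ.hom_ext ef eg <| (left _ _ rfl).trans <|
      (C.smul_congr f.unit_cell id_φ rfl).trans <| (C.smul_unitAt φ).trans id_φ.symm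
    unit_r := hφ.hom_ext ef eg <| (right _ _ rfl).trans <|
      (C.rsmul_congr id_φ g.unit_cell rfl).trans <| (C.rsmul_unitAt φ).trans id_φ.symm
    assoc_l := hφ.hom_ext ef eg <| (left _ _ rfl).trans <|
      (C.smul_congr f.mul_cell id_φ rfl).trans <| (C.smul_smul _ _ _ rfl rfl rfl rfl).trans
        ((left _ _ rfl).trans (C.smul_congr id_f hl rfl)).symm
    assoc_r := hφ.hom_ext ef eg <| (right _ _ rfl).trans <|
      (C.rsmul_congr id_φ g.mul_cell rfl).trans <|
        (C.rsmul_rsmul _ _ _ rfl rfl rfl rfl).symm.trans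
          ((right _ _ rfl).trans (C.rsmul_congr hr id_g rfl)).symm
    assoc_lr := hφ.hom_ext ef eg <| (right _ _ rfl).trans <|
      (C.rsmul_congr hl id_g rfl).trans <| (C.rsmul_smul _ _ _ rfl rfl rfl rfl).trans
        ((left _ _ rfl).trans (C.smul_congr id_f hr rfl)).symm }

end Transfer

section Restriction

variable {M N M' N' : D.Mod.Obj} {f : M ⟶ M'} {g : N ⟶ N'}

theorem IsBimodHom.of_comp {A : Bimod M N} {C : Bimod M' N'}
    {φ : D.Cell (Mon.Hom.hom f) (Mon.Hom.hom g) (.single A.pro) C.pro}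
    (hφ : IsBimodHom f g (.single A) C φ) (hc : IsCartesian φ) {L K : D.Mod.Obj} {h : L ⟶ M}
    {k : K ⟶ N} {p : D.Mod.Path L K} {χ : D.Cell (Mon.Hom.hom h) (Mon.Hom.hom k) (und p) A.pro}
    (hχ : IsBimodHom (h ≫ f) (k ≫ g) p C (D.comp (.single χ) φ rfl rfl)) :
    IsBimodHom h k p A χ where
  left B q e := hc.hom_ext rfl rfl ((comp_single_of_comp_eq rfl).trans
    ((hχ.left B q e).trans (hφ.map_smul (Mon.Hom.cell h) χ rfl rfl rfl rfl).symm))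
  right q B e := hc.hom_ext rfl rfl ((comp_single_of_comp_eq rfl).trans
    ((hχ.right q B e).trans (hφ.map_rsmul χ (Mon.Hom.cell k) rfl rfl rfl rfl).symm))
  inner q B B' r e := hc.hom_ext rfl rfl ((comp_single_of_comp_eq rfl).trans
    ((hχ.inner q B B' r e).trans (comp_single_of_comp_eq rfl).symm))
  nil := by
    cases p with
    | cons => trivial
    | nil =>
      refine hc.hom_ext rfl rfl ((hφ.map_smul (Mon.Hom.cell h) χ rfl rfl rfl rfl).trans ?_)
      exact hχ.nil.trans (hφ.map_rsmul χ (Mon.Hom.cell k) rfl rfl rfl rfl).symm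

theorem isCartesian_mod {A : D.Mod.Pro M N} {C : D.Mod.Pro M' N'} {φ : D.Mod.Cell f g (.single A) C}
    (hφ : IsCartesian φ.1) : IsCartesian (D := D.Mod) φ := by
  refine fun L K h k p => ⟨fun χ χ' H => ?_, fun γ => ?_⟩
  · exact Subtype.ext (hφ.hom_ext rfl rfl (congrArg Subtype.val H))
  · obtain ⟨χ, hχ, -⟩ := hφ.existsUnique rfl rfl γ.1
    exact ⟨⟨χ, φ.2.of_comp hφ (hχ ▸ γ.2)⟩, Subtype.ext hχ⟩

variable (f g) in
theorem exists_restriction_mod (h : D.HasRestrictions) (C : D.Mod.Pro M' N') :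
    ∃ (A : D.Mod.Pro M N) (ψ : D.Mod.Cell f g (.single A) C), IsCartesian ψ.1 := by
  obtain ⟨R, φ, hφ⟩ := h (Mon.Hom.hom f) (Mon.Hom.hom g) C.pro
  have ef := (Category.id_comp (Mon.Hom.hom f)).symm
  have eg := (Category.id_comp (Mon.Hom.hom g)).symm
  obtain ⟨l, hl, -⟩ := hφ.existsUnique ef eg (C.smul (Mon.Hom.cell f) φ)
  obtain ⟨r, hr, -⟩ := hφ.existsUnique ef eg (C.rsmul φ (Mon.Hom.cell g))
  exact ⟨.ofIsCartesian hφ hl hr, ⟨φ, isBimodHom_single_iff.2 ⟨hl, hr⟩⟩, hφ⟩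

theorem hasRestrictions_mod (h : D.HasRestrictions) : D.Mod.HasRestrictions := fun _ _ _ _ f g C =>
  have ⟨A, ψ, hψ⟩ := exists_restriction_mod f g h C
  ⟨A, ψ, isCartesian_mod hψ⟩

theorem IsCartesian.val (h : D.HasRestrictions) {A : D.Mod.Pro M N} {C : D.Mod.Pro M' N'}
    {φ : D.Mod.Cell f g (.single A) C} (hφ : IsCartesian (D := D.Mod) φ) : IsCartesian φ.1 := by
  obtain ⟨A', ψ, hψ⟩ := exists_restriction_mod f g h C
  obtain ⟨σ, rfl⟩ := hφ.exists_cellIso_comp_eq (isCartesian_mod hψ)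
  let σ' : CellIso (D := D) (.refl M.obj) (.refl N.obj) A.pro A'.pro :=
    ⟨σ.hom.1, σ.inv.1, congrArg Subtype.val σ.hom_inv_id, congrArg Subtype.val σ.inv_hom_id⟩
  exact σ'.isCartesian.comp hψ (Category.id_comp _).symm (Category.id_comp _).symm

theorem isVirtualEquipment_mod (h : D.HasRestrictions) : D.Mod.IsVirtualEquipment where
  hasUnits M := ⟨_, _, Mon.isOpcartesian_unitCell M⟩
  hasRestrictions := hasRestrictions_mod h

end Restriction

/-! ### The unit bimodules as units of the virtual double category of monoids -/

variable (D) in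
/-- The units of `D.Mod` given by the monoids regarded as bimodules over themselves. -/
def modUnits : D.Mod.Units where
  pro M := Mon.self M
  cell := Mon.unitCell
  opcart := Mon.isOpcartesian_unitCell

section ModUnits

variable {M N : D.Mod.Obj} (P : D.Mod.Pro M N)

theorem lact_modUnits : D.modUnits.lact P = P.lCell :=
  (D.modUnits.exists_lact P).unique (D.modUnits.lact_spec P) (Subtype.ext P.unit_l)

theorem ract_modUnits : D.modUnits.ract P = P.rCell :=
  (D.modUnits.exists_ract P).unique (D.modUnits.ract_spec P) (Subtype.ext P.unit_r)

theorem trivCell_modUnits (f : M ⟶ N) : D.modUnits.trivCell f = Mon.selfCell f :=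
  (D.modUnits.exists_trivCell f).unique (D.modUnits.trivCell_spec f)
    (Subtype.ext (Mon.Hom.unit_cell f))

variable {a b c : D.Mod.Obj} {A : D.Mod.Pro a b} {B : D.Mod.Pro b c}

theorem val_smul_trivBimod {f : a ⟶ M} {h : b ⟶ M} {g : c ⟶ N}
    (μ : D.Mod.Cell f h (.single A) (Mon.self M)) (φ : D.Mod.Cell h g (.single B) P) :
    ((D.modUnits.trivBimod P).smul μ φ).1 = P.smul μ.1 φ.1 :=
  congrArg (fun χ : D.Mod.Cell (𝟙 M) (𝟙 N) (.pair (Mon.self M) P) P =>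
    (D.Mod.comp (.pair μ φ) χ (Category.comp_id f).symm (Category.comp_id g).symm).1)
    (lact_modUnits P)

theorem val_rsmul_trivBimod {f : a ⟶ M} {h : b ⟶ N} {g : c ⟶ N}
    (φ : D.Mod.Cell f h (.single A) P) (ν : D.Mod.Cell h g (.single B) (Mon.self N)) :
    ((D.modUnits.trivBimod P).rsmul φ ν).1 = P.rsmul φ.1 ν.1 :=
  congrArg (fun χ : D.Mod.Cell (𝟙 M) (𝟙 N) (.pair P (Mon.self N)) P =>
    (D.Mod.comp (.pair φ ν) χ (Category.comp_id f).symm (Category.comp_id g).symm).1)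
    (ract_modUnits P)

end ModUnits

theorem isBimodEmb_modUnits_iff {A A' : D.Mod.Mon} {x y : D.Mod.Obj} {i : D.modUnits.Emb A x}
    {j : D.modUnits.Emb A' y} {B : Bimod A A'} {P : D.Mod.Pro x y}
    {φ : D.Mod.Cell i.hom j.hom (.single B.pro) P} : D.modUnits.IsBimodEmb i j B P φ ↔
      D.comp (.single B.l.1) φ.1 (Category.id_comp _).symm (Category.id_comp _).symm =
        P.smul i.cell.1 φ.1 ∧
      D.comp (.single B.r.1) φ.1 (Category.id_comp _).symm (Category.id_comp _).symm =
        P.rsmul φ.1 j.cell.1 :=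
  (isBimodHom_single_iff (D := D.Mod)).trans (and_congr
    (Subtype.ext_iff.trans (Eq.congr_right (val_smul_trivBimod P i.cell φ)))
    (Subtype.ext_iff.trans (Eq.congr_right (val_rsmul_trivBimod P φ j.cell))))

/-! ### Flattening monoids and bimodules in the virtual double category of monoids -/

/-- The proarrow of a monoid in `D.Mod`, as a bimodule in `D` over the base monoid `A.obj`. -/
abbrev Mon.base (A : D.Mod.Mon) : Bimod (D := D) A.obj A.obj := A.pro

/-- The proarrow of a bimodule in `D.Mod`, as a bimodule in `D` over the base monoids. -/
abbrev Bimod.base {A A' : D.Mod.Mon} (B : Bimod A A') : Bimod (D := D) A.obj A'.obj := B.pro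

/-- The monoid in `D` on the underlying proarrow of a monoid in `D.Mod`. It is the object into which
`A` collapses. -/
def Mon.flat (A : D.Mod.Mon) : D.Mod.Obj where
  obj := Mon.obj (Mon.obj A)
  pro := A.base.pro
  unit := A.unit.1
  mul := A.mul.1
  unit_mul := congrArg Subtype.val A.unit_mul
  mul_unit := congrArg Subtype.val A.mul_unit
  mul_assoc := congrArg Subtype.val A.mul_assoc

/-- The bimodule in `D`, over the flattened monoids, on the underlying proarrow of a bimodule in
`D.Mod`. It is the proarrow of `D.Mod` into which `B` collapses. -/
def Bimod.flat {A A' : D.Mod.Mon} (B : Bimod A A') : D.Mod.Pro A.flat A'.flat where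
  pro := B.base.pro
  l := B.l.1
  r := B.r.1
  unit_l := congrArg Subtype.val B.unit_l
  unit_r := congrArg Subtype.val B.unit_r
  assoc_l := congrArg Subtype.val B.assoc_l
  assoc_r := congrArg Subtype.val B.assoc_r
  assoc_lr := congrArg Subtype.val B.assoc_lr

/-- The cell of the homomorphism from the base monoid of `A` to its flattening: it acts by the base
monoid on the unit of `A`. -/
def Mon.flatMapCell (A : D.Mod.Mon) :
    D.Cell (𝟙 (Mon.obj A.obj)) (𝟙 _) (.single (Mon.pro A.obj)) A.base.pro :=
  A.base.smul (D.idCell _) A.unit.1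

theorem Mon.flatMapCell_eq (A : D.Mod.Mon) :
    A.flatMapCell = A.base.rsmul A.unit.1 (D.idCell _) :=
  A.unit.2.nil

namespace Bimod

variable {A A' : D.Mod.Mon} (B : Bimod A A') {a b c d : D.Obj} {p : D.Path a b} {q : D.Path b c}

section Assoc

variable {r : D.Path c d} {pq : D.Path a c} {qr : D.Path b d} {s : D.Path a d}

theorem flat_smul_smul {x : a ⟶ Mon.obj A.obj} {y : b ⟶ Mon.obj A.obj} {t : c ⟶ Mon.obj A.obj}
    {l : d ⟶ Mon.obj A'.obj} (μ : D.Cell x y p (Mon.pro A.obj)) (α : D.Cell y t q A.base.pro)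
    (β : D.Cell t l r B.base.pro) (e₁ : pq = p.append q) (e₂ : s = pq.append r)
    (e₃ : qr = q.append r) (e₄ : s = p.append qr) :
    B.flat.smul (A.base.smul μ α e₁) β e₂ = B.base.smul μ (B.flat.smul α β e₃) e₄ :=
  (B.l.2.left_comp rfl μ α (.single β) e₄ e₁ e₃ (.pair _ β e₂) (.pair α β e₃) rfl rfl
    (Category.comp_id _).symm (Category.comp_id _).symm (Category.comp_id _).symm).trans
    (Bimod.smul_congr _ (D.comp_id μ) rfl _)

theorem flat_rsmul_rsmul {x : a ⟶ Mon.obj A.obj} {y : b ⟶ Mon.obj A'.obj}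
    {t : c ⟶ Mon.obj A'.obj} {l : d ⟶ Mon.obj A'.obj} (β : D.Cell x y p B.base.pro)
    (α : D.Cell y t q A'.base.pro) (ν : D.Cell t l r (Mon.pro A'.obj)) (e₁ : pq = p.append q)
    (e₂ : s = pq.append r) (e₃ : qr = q.append r) (e₄ : s = p.append qr) :
    B.flat.rsmul β (A'.base.rsmul α ν e₃) e₄ = B.base.rsmul (B.flat.rsmul β α e₁) ν e₂ :=
  (B.r.2.right_comp (t₀ := .single B.pro) rfl (.single β) α ν e₂ e₁ e₃ (.pair β _ e₄)
    (.pair β α e₁) rfl rfl (Category.comp_id _).symm (Category.comp_id _).symm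
    (Category.comp_id _).symm).trans (Bimod.rsmul_congr _ rfl (D.comp_id ν) _)

end Assoc

variable {s : D.Path a c}

theorem flat_smul_flatMapCell {x : a ⟶ Mon.obj A.obj} {y : b ⟶ Mon.obj A.obj}
    {l : c ⟶ Mon.obj A'.obj} (μ : D.Cell x y p (Mon.pro A.obj)) (β : D.Cell y l q B.base.pro)
    (e : s = p.append q) :
    B.flat.smul (D.comp (.single μ) A.flatMapCell (Category.comp_id x).symm
      (Category.comp_id y).symm) β e = B.base.smul μ β e := by
  have h : D.comp (.single μ) A.flatMapCell (Category.comp_id x).symm (Category.comp_id y).symm =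
      A.base.smul μ (A.flat.unitAt y) (ProPath.append_nil _).symm := by
    refine (Bimod.comp_smul _ _ (.single μ) (.nil y) _ _ _ (ProPath.append_nil _).symm rfl
      (Category.comp_id _).symm (Category.comp_id _).symm (Category.comp_id _).symm).trans ?_
    exact Bimod.smul_congr _ (D.comp_id μ) rfl _
  refine (B.flat.smul_congr h rfl e).trans ((B.flat_smul_smul μ _ β _ _ rfl e).trans ?_)
  exact Bimod.smul_congr _ rfl (B.flat.smul_unitAt β) _

theorem flat_rsmul_flatMapCell {x : a ⟶ Mon.obj A.obj} {y : b ⟶ Mon.obj A'.obj}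
    {l : c ⟶ Mon.obj A'.obj} (β : D.Cell x y p B.base.pro) (ν : D.Cell y l q (Mon.pro A'.obj))
    (e : s = p.append q) :
    B.flat.rsmul β (D.comp (.single ν) A'.flatMapCell (Category.comp_id y).symm
      (Category.comp_id l).symm) e = B.base.rsmul β ν e := by
  have h : D.comp (.single ν) A'.flatMapCell (Category.comp_id y).symm (Category.comp_id l).symm =
      A'.base.rsmul (A'.flat.unitAt y) ν := by
    rw [A'.flatMapCell_eq]
    refine (Bimod.comp_rsmul _ _ (.nil y) (.single ν) _ _ _ rfl rfl (Category.comp_id _).symm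
      (Category.comp_id _).symm (Category.comp_id _).symm).trans ?_
    exact Bimod.rsmul_congr _ rfl (D.comp_id ν) _
  refine (B.flat.rsmul_congr rfl h e).trans
    ((B.flat_rsmul_rsmul β _ ν (ProPath.append_nil _).symm e _ _).trans ?_)
  exact Bimod.rsmul_congr _ (B.flat.rsmul_unitAt β) rfl _

end Bimod

namespace Mon

variable (A : D.Mod.Mon)

theorem unit_comp_flatMapCell :
    D.comp (.single (Mon.unit A.obj)) A.flatMapCell (Category.comp_id _).symm
      (Category.comp_id _).symm = A.unit.1 := by
  refine (Bimod.comp_smul _ _ (.single (Mon.unit A.obj)) (.nil _) _ _ _ rfl rfl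
    (Category.id_comp _).symm (Category.id_comp _).symm (Category.id_comp _).symm).trans ?_
  refine (Bimod.smul_congr _ ?_ (D.id_comp A.unit.1) rfl).trans (Bimod.smul_unitAt _ A.unit.1)
  exact (D.comp_id (Mon.unit A.obj)).trans (D.id_comp (Mon.unit A.obj)).symm

theorem mul_comp_flatMapCell :
    D.comp (.single (Mon.mul A.obj)) A.flatMapCell (Category.comp_id _).symm
      (Category.comp_id _).symm = A.flat.self.smul A.flatMapCell A.flatMapCell := by
  have hmul : (Mon.mul A.obj ⨟ D.idCell (Mon.pro A.obj)) =
      (Mon.self A.obj).smul (D.idCell _) (D.idCell _) :=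
    (D.comp_id (Mon.mul A.obj)).trans (D.id_comp (Mon.mul A.obj)).symm
  refine (Bimod.comp_smul _ _ (.single (Mon.mul A.obj)) (.nil _) _ _ _ rfl rfl
    (Category.id_comp _).symm (Category.id_comp _).symm (Category.id_comp _).symm).trans ?_
  refine (Bimod.smul_congr _ hmul (D.id_comp A.unit.1) rfl).trans ?_
  refine (Bimod.smul_smul _ _ _ _ _ _ rfl rfl).trans ?_
  refine (Bimod.flat_smul_flatMapCell A.self (D.idCell _) A.flatMapCell rfl).symm.trans ?_
  exact A.flat.self.smul_congr (D.id_comp A.flatMapCell) rfl rfl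

/-- The homomorphism from the base monoid of `A` to its flattening, over an identity arrow. -/
def flatMap : A.obj ⟶ A.flat :=
  show Mon.Hom _ _ from
  { hom := 𝟙 _
    cell := A.flatMapCell
    unit_cell := A.unit_comp_flatMapCell.trans (D.id_comp A.unit.1).symm
    mul_cell := A.mul_comp_flatMapCell }

end Mon

/-- The identity cell of the underlying proarrow of `B`, as a cell of `D.Mod` from the base bimodule
of `B` to its flattening. -/
def Bimod.flatCell {A A' : D.Mod.Mon} (B : Bimod A A') :
    D.Mod.Cell A.flatMap A'.flatMap (.single B.pro) B.flat :=
  ⟨D.idCell _, (isBimodHom_single_iff (A := B.base) (C := B.flat)).2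
    ⟨(D.comp_id _).trans <| (D.id_comp B.base.l).symm.trans <|
      (B.flat_smul_flatMapCell (D.idCell _) (D.idCell _) rfl).symm.trans
        (B.flat.smul_congr (D.id_comp _) rfl rfl),
    (D.comp_id _).trans <| (D.id_comp B.base.r).symm.trans <|
      (B.flat_rsmul_flatMapCell (D.idCell _) (D.idCell _) rfl).symm.trans
        (B.flat.rsmul_congr rfl (D.id_comp _) rfl)⟩⟩

/-! ### Collapses in the virtual double category of monoids -/

theorem isBimodHom_of_idCell_comp {M N M' N' : D.Mon} {f : Mon.Hom M M'} {g : Mon.Hom N N'}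
    {A : Bimod M N} {C : Bimod M' N'} {φ : D.Cell f.hom g.hom (.single A.pro) C.pro}
    {f' : M.obj ⟶ M'.obj} {g' : N.obj ⟶ N'.obj} (ef : f' = 𝟙 M.obj ≫ f.hom)
    (eg : g' = 𝟙 N.obj ≫ g.hom) {φ' : D.Cell f' g' (.single A.pro) C.pro}
    {μ : D.Cell f' f' (.single M.pro) M'.pro} {ν : D.Cell g' g' (.single N.pro) N'.pro}
    (hφ : D.comp (.single (D.idCell A.pro)) φ ef eg = φ')
    (hμ : D.comp (.single (D.idCell M.pro)) f.cell ef ef = μ)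
    (hν : D.comp (.single (D.idCell N.pro)) g.cell eg eg = ν) (left : A.l ⨟ φ' = C.smul μ φ')
    (right : A.r ⨟ φ' = C.rsmul φ' ν) : IsBimodHom f g (.single A) C φ := by
  obtain rfl := ef.trans (Category.id_comp f.hom)
  obtain rfl := eg.trans (Category.id_comp g.hom)
  obtain rfl := (D.id_comp φ).symm.trans hφ
  obtain rfl := (D.id_comp f.cell).symm.trans hμ
  obtain rfl := (D.id_comp g.cell).symm.trans hν
  exact isBimodHom_single_iff.2 ⟨left, right⟩

namespace Mon

/-- The embedding of a monoid in `D.Mod` into its flattening. -/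
noncomputable def flatEmb (A : D.Mod.Mon) : D.modUnits.Emb A A.flat where
  hom := A.flatMap
  cell := A.self.flatCell
  unit_cell := Subtype.ext ((D.comp_id A.unit.1).trans (D.id_comp A.unit.1).symm)
  mul_cell := Subtype.ext <| ((D.comp_id A.mul.1).trans (D.id_comp A.mul.1).symm).trans
    (val_smul_trivBimod (Mon.self A.flat) A.self.flatCell A.self.flatCell).symm

theorem isCartesian_flatEmb (A : D.Mod.Mon) : IsCartesian (D := D.Mod) A.flatEmb.cell :=
  isCartesian_mod (isCartesian_idCell A.base.pro)

variable {A : D.Mod.Mon} {y : D.Mod.Obj}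

/-- The homomorphism from the flattening of `A` that is induced by an embedding of `A`, with the
same underlying cell. -/
def flatDesc (j : D.modUnits.Emb A y) : A.flat ⟶ y :=
  show Mon.Hom _ _ from
  { hom := Mon.Hom.hom (M := A.obj) (N := y) j.hom
    cell := j.cell.1
    unit_cell := congrArg Subtype.val j.unit_cell
    mul_cell := (congrArg Subtype.val j.mul_cell).trans
      (val_smul_trivBimod (Mon.self y) j.cell j.cell) }

theorem flatEmb_comp_cell (f : A.flat ⟶ y) :
    (A.flatEmb.comp f).cell.1 = D.comp (.single (D.idCell A.base.pro)) (Mon.Hom.cell f) rfl rfl :=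
  congrArg (fun χ : D.Mod.Cell f f (.single A.flat.self) (Mon.self y) =>
    D.comp (.single (D.idCell A.base.pro)) χ.1 rfl rfl) (trivCell_modUnits f)

theorem flatMapCell_comp (j : D.modUnits.Emb A y) :
    D.comp (.single A.flatMapCell) j.cell.1 (Category.id_comp _).symm (Category.id_comp _).symm =
      Mon.Hom.cell (M := A.obj) (N := y) j.hom := by
  refine (j.cell.2.map_smul (D.idCell (Mon.pro A.obj)) A.unit.1 rfl (Category.id_comp _).symm
    (Category.id_comp _).symm (Category.id_comp _).symm).trans ?_
  refine (Bimod.smul_congr _ (D.id_comp _) (congrArg Subtype.val j.unit_cell) rfl).trans ?_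
  exact (Mon.self y).rsmul_unitAt _

theorem flatEmb_comp_flatDesc (j : D.modUnits.Emb A y) : A.flatEmb.comp (flatDesc j) = j := by
  have e : Mon.Hom.hom j.hom = (𝟙 A.obj.obj ≫ Mon.Hom.hom j.hom) ≫ 𝟙 (Mon.obj y) :=
    ((Category.comp_id _).trans (Category.id_comp _)).symm
  refine Mon.Hom.ext' (D := D.Mod) (Mon.Hom.ext' (D := D) (Category.id_comp _) ?_)
    (Subtype.ext ?_)
  · exact (comp_comp_idCell _ _ _ _ e e).trans (flatMapCell_comp j)
  · refine (comp_single_congr (flatEmb_comp_cell _) _ e e).trans ?_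
    exact (comp_comp_idCell _ _ _ _ e e).trans (D.id_comp j.cell.1)

theorem isCollapse_flatEmb (A : D.Mod.Mon) : D.modUnits.IsCollapse A.flatEmb := by
  refine fun y j => ⟨flatDesc j, flatEmb_comp_flatDesc j, ?_⟩
  rintro f rfl
  have e : 𝟙 A.flat.obj ≫ Mon.Hom.hom (M := A.flat) f =
      Mon.Hom.hom (M := A.flat) f ≫ 𝟙 y.obj :=
    (Category.id_comp _).trans (Category.comp_id _).symm
  refine Mon.Hom.ext' (Category.id_comp (Mon.Hom.hom f)).symm ?_
  exact (comp_idCell_eq _ e e).trans (flatEmb_comp_cell f).symm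

end Mon

namespace Bimod

variable {A A' : D.Mod.Mon} (B : Bimod A A')

theorem isCartesian_flatCell : IsCartesian (D := D.Mod) B.flatCell :=
  isCartesian_mod (isCartesian_idCell B.base.pro)

theorem isBimodEmb_flatCell :
    D.modUnits.IsBimodEmb A.flatEmb A'.flatEmb B B.flat B.flatCell :=
  isBimodEmb_modUnits_iff.2 ⟨(D.comp_id B.l.1).trans (D.id_comp B.l.1).symm,
    (D.comp_id B.r.1).trans (D.id_comp B.r.1).symm⟩

theorem isBimodHom_flat_of_isBimodEmb {x y : D.Mod.Obj} (f : A.flat ⟶ x) (g : A'.flat ⟶ y)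
    {Q : D.Mod.Pro x y}
    {ψ : D.Mod.Cell (A.flatEmb.hom ≫ f) (A'.flatEmb.hom ≫ g) (.single B.pro) Q}
    (hψ : D.modUnits.IsBimodEmb (A.flatEmb.comp f) (A'.flatEmb.comp g) B Q ψ)
    {χ : D.Cell (Mon.Hom.hom f) (Mon.Hom.hom g) (.single B.base.pro) Q.pro}
    (hχ : D.comp (.single (D.idCell B.base.pro)) χ rfl rfl = ψ.1) :
    IsBimodHom f g (.single B.flat) Q χ := by
  obtain ⟨left, right⟩ := isBimodEmb_modUnits_iff.1 hψ
  exact isBimodHom_of_idCell_comp (A := B.flat) rfl rfl hχ (Mon.flatEmb_comp_cell f).symm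
    (Mon.flatEmb_comp_cell g).symm left right

theorem isBimodCollapse_flatCell :
    D.modUnits.IsBimodCollapse A.flatEmb A'.flatEmb B B.flat B.flatCell where
  left := A.isCollapse_flatEmb
  right := A'.isCollapse_flatEmb
  emb := B.isBimodEmb_flatCell
  universal x' y' f g Q ψ hψ := by
    obtain ⟨χ, hχ, unique⟩ := (isCartesian_idCell B.base.pro).existsUnique_factor rfl rfl ψ.1
    refine ⟨⟨χ, B.isBimodHom_flat_of_isBimodEmb f g hψ hχ⟩, Subtype.ext hχ, fun χ' h => ?_⟩
    exact Subtype.ext (unique _ (congrArg Subtype.val h))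

end Bimod

theorem Mon.isNormalCollapse_flatEmb (A : D.Mod.Mon) : D.modUnits.IsNormalCollapse A.flatEmb :=
  ⟨A.isCollapse_flatEmb, A.self.isBimodCollapse_flatCell⟩

/-! ### Collapses and isomorphisms -/

theorem IsCartesian.of_idCell_comp {a b c d : D.Obj} {f f' : a ⟶ c} {g g' : b ⟶ d} {A : D.Pro a b}
    {B : D.Pro c d} {φ : D.Cell f g (.single A) B} {ef : f' = 𝟙 a ≫ f} {eg : g' = 𝟙 b ≫ g}
    (h : IsCartesian (D.comp (.single (D.idCell A)) φ ef eg)) : IsCartesian φ := by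
  obtain rfl := ef.trans (Category.id_comp f)
  obtain rfl := eg.trans (Category.id_comp g)
  exact (congrArg IsCartesian (D.id_comp φ)).mp h

namespace Mon

theorem isIso_hom {M N : D.Mod.Obj} (a : M ⟶ N) [IsIso a] : IsIso (Mon.Hom.hom a) :=
  ⟨Mon.Hom.hom (inv a), congrArg Mon.Hom.hom (IsIso.hom_inv_id a),
    congrArg Mon.Hom.hom (IsIso.inv_hom_id a)⟩

theorem isIso_of_isCartesian {M N : D.Mod.Obj} (a : M ⟶ N) [IsIso (Mon.Hom.hom a)]
    (ha : IsCartesian (Mon.Hom.cell a)) : IsIso a := by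
  obtain ⟨⟨_, τ, hom_inv_id, inv_hom_id⟩, rfl⟩ := ha.exists_cellIso
  have e := (IsIso.hom_inv_id (Mon.Hom.hom a)).symm
  have e' := (IsIso.inv_hom_id (Mon.Hom.hom a)).symm
  have cancel {p : D.Path (Mon.obj N) (Mon.obj N)} (ν : D.Cell (𝟙 _) (𝟙 _) p (Mon.pro N)) :
      D.comp (.single (D.comp (.single ν) τ (Category.id_comp _).symm (Category.id_comp _).symm))
        (Mon.Hom.cell a) e' e' = ν :=
    (comp_single_of_comp_eq inv_hom_id).trans (D.comp_id ν)
  let b : N ⟶ M := show Mon.Hom _ _ from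
    { hom := inv (Mon.Hom.hom a)
      cell := τ
      unit_cell := by
        refine ha.hom_ext e' e' ((cancel (Mon.unit N)).trans ?_)
        exact (D.id_comp _).symm.trans (Mon.Hom.map_unitAt a _ e').symm
      mul_cell := by
        refine ha.hom_ext e' e' ((cancel (Mon.mul N)).trans ?_)
        refine Eq.trans ?_ (Mon.Hom.map_mul a τ τ rfl e' e' e').symm
        refine Eq.trans ?_ ((Mon.self N).smul_congr inv_hom_id inv_hom_id rfl).symm
        exact (D.id_comp _).symm }
  have e₁ := e.trans (Category.comp_id _).symm
  have e₂ := e'.trans (Category.comp_id _).symm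
  exact ⟨b, Mon.Hom.ext' e.symm ((comp_comp_idCell _ _ _ _ e₁ e₁).trans hom_inv_id),
    Mon.Hom.ext' e'.symm ((comp_comp_idCell _ _ _ _ e₂ e₂).trans inv_hom_id)⟩

end Mon

namespace Units

variable {U : D.Units}

theorem trivMap_comp {x y t : D.Obj} (f : x ⟶ y) (g : y ⟶ t) :
    U.trivMap (f ≫ g) = U.trivMap f ≫ U.trivMap g := by
  have h : U.trivCell (f ≫ g) = D.comp (.single (U.trivCell f)) (U.trivCell g) rfl rfl :=
    (U.exists_trivCell (f ≫ g)).unique (U.trivCell_spec _)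
      (Mon.Hom.unit_cell (show Mon.Hom _ _ from U.trivMap f ≫ U.trivMap g))
  exact Mon.Hom.ext' rfl ((D.comp_id _).trans h)

theorem trivMap_id (x : D.Obj) : U.trivMap (𝟙 x) = 𝟙 (U.triv x) := by
  have h : U.trivCell (𝟙 x) = D.idCell (U.pro x) :=
    (U.exists_trivCell (𝟙 x)).unique (U.trivCell_spec _) ((D.comp_id _).trans (D.id_comp _).symm)
  exact Mon.Hom.ext' rfl ((D.comp_id _).trans h)

variable {M N : D.Mon} {x y : D.Obj} {i : U.Emb M x} {j : U.Emb N y}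

theorem Emb.comp_comp {x' x'' : D.Obj} (i : U.Emb M x) (f : x ⟶ x') (g : x' ⟶ x'') :
    (i.comp f).comp g = i.comp (f ≫ g) := by
  have h : (i ≫ U.trivMap f) ≫ U.trivMap g = i ≫ U.trivMap (f ≫ g) := by
    rw [trivMap_comp, Category.assoc]
  exact h

theorem Emb.comp_id (i : U.Emb M x) : i.comp (𝟙 x) = i := by
  have h : i ≫ U.trivMap (𝟙 x) = i := by rw [trivMap_id, Category.comp_id]
  exact h

theorem IsCollapse.isIso {x' : D.Obj} (hi : U.IsCollapse i) (a : x ⟶ x')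
    (ha : U.IsCollapse (i.comp a)) : IsIso a := by
  obtain ⟨b, hb, -⟩ := ha i
  refine ⟨b, (hi i).unique ?_ i.comp_id, (ha (i.comp a)).unique ?_ (i.comp a).comp_id⟩
  · exact (i.comp_comp a b).symm.trans hb
  · rw [← Emb.comp_comp, hb]

theorem IsCollapse.comp {x' : D.Obj} (hi : U.IsCollapse i) (a : x ⟶ x') [IsIso a] :
    U.IsCollapse (i.comp a) := by
  intro t j
  obtain ⟨f, hf, unique⟩ := hi j
  refine ⟨inv a ≫ f, ?_, fun g hg => ?_⟩
  · simpa [Emb.comp_comp] using hf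
  · rw [← unique (a ≫ g) ((i.comp_comp a g).symm.trans hg), IsIso.inv_hom_id_assoc]

namespace IsBimodCollapse

variable {B : Bimod M N} {P : D.Pro x y} {φ : D.Cell i.hom j.hom (.single B.pro) P}
  {x' y' : D.Obj} {f : x ⟶ x'} {g : y ⟶ y'} {i' : U.Emb M x'} {j' : U.Emb N y'} {Q : D.Pro x' y'}

theorem existsUnique (h : U.IsBimodCollapse i j B P φ) (hi : i' = i.comp f) (hj : j' = j.comp g)
    (ei : i'.hom = i.hom ≫ f) (ej : j'.hom = j.hom ≫ g)
    {ψ : D.Cell i'.hom j'.hom (.single B.pro) Q} (hψ : U.IsBimodEmb i' j' B Q ψ) :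
    ∃! χ : D.Cell f g (.single P) Q, D.comp (.single φ) χ ei ej = ψ := by
  subst hi hj
  exact h.universal f g Q ψ hψ

theorem comp (h : U.IsBimodCollapse i j B P φ) [IsIso f] [IsIso g] (hi : i' = i.comp f)
    (hj : j' = j.comp g) (ei : i'.hom = i.hom ≫ f) (ej : j'.hom = j.hom ≫ g)
    {χ : D.Cell f g (.single P) Q} (hχ : IsCartesian χ)
    (he : U.IsBimodEmb i' j' B Q (D.comp (.single φ) χ ei ej)) :
    U.IsBimodCollapse i' j' B Q (D.comp (.single φ) χ ei ej) where
  left := hi ▸ h.left.comp f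
  right := hj ▸ h.right.comp g
  emb := he
  universal x'' y'' f' g' R ψ hψ := by
    subst hi hj
    obtain ⟨ω, hω, unique⟩ := h.existsUnique (Emb.comp_comp _ _ _) (Emb.comp_comp _ _ _)
      (Category.assoc _ _ _) (Category.assoc _ _ _) hψ
    obtain ⟨θ, hθ, unique'⟩ := hχ.existsUnique_factor rfl rfl ω
    refine ⟨θ, (comp_single_of_comp_eq hθ).trans hω, fun θ' h' => unique' _ (unique _ ?_)⟩
    exact (comp_single_of_comp_eq rfl).symm.trans h'

end IsBimodCollapse

end Units

/-! ### Regular covers in the virtual double category of monoids -/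

theorem isIso_hom_of_isRegularCover {c d : D.Mod.Obj} {f : c ⟶ d}
    (hf : D.modUnits.IsRegularCover f) : IsIso (Mon.Hom.hom f) := by
  obtain ⟨⟨A, rfl, i, hom_eq, _⟩, hi, -⟩ := hf
  obtain ⟨a, rfl, -⟩ := A.isCollapse_flatEmb i
  have := A.isCollapse_flatEmb.isIso a hi
  obtain rfl : A.flatMap ≫ a = f := hom_eq.trans (Category.id_comp f)
  have := Mon.isIso_hom a
  exact inferInstanceAs (IsIso (𝟙 _ ≫ Mon.Hom.hom a))

theorem Units.Kernel.isIso_flatDesc (h : D.HasRestrictions) {c d : D.Mod.Obj} {f : c ⟶ d}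
    (hf : D.modUnits.IsRegularCover f) (K : D.modUnits.Kernel f) : IsIso (Mon.flatDesc K.emb) := by
  have := isIso_hom_of_isRegularCover hf
  obtain ⟨A, rfl, i, hom_eq, hc⟩ := K
  have : IsIso (Mon.Hom.hom (Mon.flatDesc i)) := by
    obtain rfl : i.hom = f := hom_eq.trans (Category.id_comp f)
    exact this
  exact Mon.isIso_of_isCartesian _ (hc.val h)

theorem isBimodCollapse_of_isCartesian (h : D.HasRestrictions) {A A' : D.Mod.Mon} {x y : D.Mod.Obj}
    {i : D.modUnits.Emb A x} {j : D.modUnits.Emb A' y} [IsIso (Mon.flatDesc i)]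
    [IsIso (Mon.flatDesc j)] {R : Bimod A A'} {B : D.Mod.Pro x y}
    {φ : D.Mod.Cell i.hom j.hom (.single R.pro) B} (he : D.modUnits.IsBimodEmb i j R B φ)
    (hφ : IsCartesian (D := D.Mod) φ) : D.modUnits.IsBimodCollapse i j R B φ := by
  have hi := (Mon.flatEmb_comp_flatDesc i).symm
  have hj := (Mon.flatEmb_comp_flatDesc j).symm
  have ei := congrArg Mon.Hom.hom hi
  have ej := congrArg Mon.Hom.hom hj
  obtain ⟨χ, rfl, -⟩ := R.isBimodCollapse_flatCell.existsUnique hi hj ei ej he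
  exact R.isBimodCollapse_flatCell.comp hi hj ei ej
    (isCartesian_mod (IsCartesian.of_idCell_comp (hφ.val h))) he

theorem isRegular_modUnits (h : D.HasRestrictions) : D.modUnits.IsRegular where
  effective_collapse A _ := ⟨_, _, A.isNormalCollapse_flatEmb⟩
  collapse_restriction c d c' d' f g B hf hg K K' R φ he hφ := by
    have := K.isIso_flatDesc h hf
    have := K'.isIso_flatDesc h hg
    exact isBimodCollapse_of_isCartesian h he hφ

namespace Units

/-! ### Independence of the choice of units -/

section Comparison

variable (U V : D.Units)

theorem exists_comparison (x : D.Obj) :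
    ∃! χ : D.Cell (𝟙 x) (𝟙 x) (.single (U.pro x)) (V.pro x), U.cell x ⨟ χ = V.cell x :=
  (U.opcart x).existsUnique (.nil x) (.nil x) rfl rfl _ rfl _

/-- The comparison between two units of an object, compatible with their unit cells. It transports
cells from one choice of units to another. -/
noncomputable def comparison (x : D.Obj) : D.Cell (𝟙 x) (𝟙 x) (.single (U.pro x)) (V.pro x) :=
  (U.exists_comparison V x).choose

theorem cell_comp_comparison (x : D.Obj) : U.cell x ⨟ U.comparison V x = V.cell x :=
  (U.exists_comparison V x).choose_spec.1

theorem comparison_comp_comparison (x : D.Obj) :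
    U.comparison V x ⨟ V.comparison U x = D.idCell (U.pro x) := by
  refine (U.exists_comparison U x).unique ?_ (D.comp_id _)
  exact (comp_of_comp_eq (U.cell_comp_comparison V x)).trans (V.cell_comp_comparison U x)

theorem isCartesian_comparison (x : D.Obj) : IsCartesian (U.comparison V x) :=
  CellIso.isCartesian (e := .refl x) (e' := .refl x) ⟨U.comparison V x, V.comparison U x,
    U.comparison_comp_comparison V x, V.comparison_comp_comparison U x⟩

theorem lact_comparison {x y : D.Obj} (P : D.Pro x y) :
    D.comp (.pair (U.comparison V x) (D.idCell P)) (V.lact P) (Category.comp_id _).symm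
      (Category.comp_id _).symm = U.lact P := by
  refine (U.exists_lact P).unique ?_ (U.lact_spec P)
  refine ((V.trivBimod P).comp_smul _ (.single (U.cell x)) (.single (D.idCell P)) _ _ rfl rfl rfl
    (Category.id_comp _).symm (Category.id_comp _).symm (Category.id_comp _).symm).trans ?_
  exact ((V.trivBimod P).smul_congr (U.cell_comp_comparison V x) (D.id_comp _) _).trans
    (V.lact_spec P)

theorem ract_comparison {x y : D.Obj} (P : D.Pro x y) :
    D.comp (.pair (D.idCell P) (U.comparison V y)) (V.ract P) (Category.comp_id _).symm
      (Category.comp_id _).symm = U.ract P := by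
  refine (U.exists_ract P).unique ?_ (U.ract_spec P)
  refine ((V.trivBimod P).comp_rsmul (.pair (D.idCell P) (U.cell y)) (.single (D.idCell P))
    (.single (U.cell y)) _ _ rfl rfl rfl
    (Category.id_comp _).symm (Category.id_comp _).symm (Category.id_comp _).symm).trans ?_
  exact ((V.trivBimod P).rsmul_congr (D.id_comp _) (U.cell_comp_comparison V y) _).trans
    (V.ract_spec P)

/-- The comparison between two units of `x`, as a homomorphism of trivial monoids. -/
noncomputable def comparisonHom (x : D.Obj) : Mon.Hom (U.triv x) (V.triv x) where
  hom := 𝟙 x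
  cell := U.comparison V x
  unit_cell := (U.cell_comp_comparison V x).trans (D.id_comp _).symm
  mul_cell := by
    refine ((U.opcart x).existsUnique (.nil x) (.single (U.pro x)) rfl rfl
      (.pair (U.cell x) (D.idCell (U.pro x))) rfl (U.comparison V x)).unique ?_ ?_
    · exact (comp_of_comp_eq (U.lact_spec _)).trans (D.id_comp _)
    · refine ((V.triv x).self.comp_smul _ (.single (U.cell x)) (.single (D.idCell _)) _ _ rfl rfl
        rfl (Category.id_comp _).symm (Category.id_comp _).symm (Category.id_comp _).symm).trans ?_
      refine ((V.triv x).self.smul_congr (U.cell_comp_comparison V x) (D.id_comp _) _).trans ?_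
      exact V.lact_comp _ _ (D.id_comp _)

theorem trivCell_comp_comparison {x y : D.Obj} (f : x ⟶ y) :
    (U.trivCell f ⨟ U.comparison V y : D.Cell f f _ _) = U.comparison V x ⨟ V.trivCell f := by
  refine ((U.opcart x).existsUnique (.nil x) (.nil x) rfl rfl (.single (U.cell x)) rfl
    (D.comp (.nil f) (V.cell y) (Category.comp_id _).symm (Category.comp_id _).symm)).unique ?_ ?_
  · have e := (Category.comp_id f).symm
    refine (comp_of_comp_eq (e₇ := e) (e₈ := e) (U.trivCell_spec f)).trans ?_
    exact (U.comparisonHom V y).map_unitAt f e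
  · exact (comp_of_comp_eq (U.cell_comp_comparison V x)).trans (V.trivCell_spec f)

end Comparison

section Change

variable {U : D.Units} (V : D.Units) {M N : D.Mon} {x y : D.Obj}

/-- The embedding with respect to the units `V` that corresponds to one with respect to `U`. It is
not defined as a composite of homomorphisms, in order to have the same vertical arrow. -/
noncomputable def Emb.change (i : U.Emb M x) : V.Emb M x where
  hom := i.hom
  cell := D.comp (.single i.cell) (U.comparison V x) (Category.comp_id _).symm
    (Category.comp_id _).symm
  unit_cell := (comp_of_comp_eq i.unit_cell).trans
    ((U.comparisonHom V x).map_unitAt i.hom (Category.comp_id _).symm)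
  mul_cell := (comp_of_comp_eq i.mul_cell).trans
    ((U.comparisonHom V x).map_mul i.cell i.cell rfl (Category.comp_id _).symm
      (Category.comp_id _).symm (Category.comp_id _).symm)

theorem Emb.change_change (i : U.Emb M x) : (i.change V).change U = i := by
  refine Mon.Hom.ext' rfl ((D.comp_id _).trans ?_)
  exact (comp_single_of_comp_eq (U.comparison_comp_comparison V x)).trans (D.comp_id i.cell)

theorem Emb.change_comp_cell (i : U.Emb M x) (f : x ⟶ y) :
    ((i.change V).comp f).cell = ((i.comp f).change V).cell :=
  (comp_single_of_comp_eq (e₃ := rfl) (e₄ := rfl) rfl).trans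
    (comp_single_of_comp_eq (U.trivCell_comp_comparison V f)).symm

theorem Emb.change_comp (i : U.Emb M x) (f : x ⟶ y) :
    (i.change V).comp f = (i.comp f).change V :=
  Mon.Hom.ext' rfl ((D.comp_id _).trans (i.change_comp_cell V f))

theorem Emb.isCartesian_change {i : U.Emb M x} (hi : IsCartesian i.cell) :
    IsCartesian (i.change V).cell :=
  hi.comp (U.isCartesian_comparison V x) (Category.comp_id _).symm (Category.comp_id _).symm

theorem IsCollapse.change {i : U.Emb M x} (hi : U.IsCollapse i) : V.IsCollapse (i.change V) := by
  intro y j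
  obtain ⟨f, hf, unique⟩ := hi (j.change U)
  refine ⟨f, ?_, fun g hg => unique g ?_⟩
  · exact (i.change_comp V f).trans ((congrArg (Emb.change V) hf).trans (j.change_change U))
  · rw [← hg, Emb.change_comp, Emb.change_change]

theorem trivBimod_smul_change {a b c : D.Obj} (P : D.Pro x y) {f : a ⟶ x} {g : b ⟶ x} {h : c ⟶ y}
    {p : D.Path a b} {q : D.Path b c} {s : D.Path a c} (μ : D.Cell f g p (U.pro x))
    (β : D.Cell g h q P) (e : s = p.append q) :
    (V.trivBimod P).smul (D.comp (.single μ) (U.comparison V x) (Category.comp_id f).symm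
      (Category.comp_id g).symm) β e = (U.trivBimod P).smul μ β e := by
  refine Eq.trans (Eq.symm ?_) (congrArg (fun χ => D.comp (.pair μ β e) χ (Category.comp_id f).symm
    (Category.comp_id h).symm) (U.lact_comparison V P))
  exact ((V.trivBimod P).comp_smul _ (.single μ) (.single β) _ _ rfl e rfl (Category.comp_id f).symm
    (Category.comp_id h).symm (Category.comp_id g).symm).trans
    ((V.trivBimod P).smul_congr rfl (D.comp_id β) _)

theorem trivBimod_rsmul_change {a b c : D.Obj} (P : D.Pro x y) {f : a ⟶ x} {g : b ⟶ y} {h : c ⟶ y}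
    {p : D.Path a b} {q : D.Path b c} {s : D.Path a c} (β : D.Cell f g p P)
    (μ : D.Cell g h q (U.pro y)) (e : s = p.append q) :
    (V.trivBimod P).rsmul β (D.comp (.single μ) (U.comparison V y) (Category.comp_id g).symm
      (Category.comp_id h).symm) e = (U.trivBimod P).rsmul β μ e := by
  refine Eq.trans (Eq.symm ?_) (congrArg (fun χ => D.comp (.pair β μ e) χ (Category.comp_id f).symm
    (Category.comp_id h).symm) (U.ract_comparison V P))
  exact ((V.trivBimod P).comp_rsmul _ (.single β) (.single μ) _ _ rfl e rfl
    (Category.comp_id f).symm (Category.comp_id h).symm (Category.comp_id g).symm).trans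
    ((V.trivBimod P).rsmul_congr (D.comp_id β) rfl _)

variable {i : U.Emb M x} {j : U.Emb N y} {B : Bimod M N} {P : D.Pro x y}
  {φ : D.Cell i.hom j.hom (.single B.pro) P}

theorem isBimodEmb_change_iff :
    V.IsBimodEmb (i.change V) (j.change V) B P φ ↔ U.IsBimodEmb i j B P φ :=
  isBimodHom_single_iff.trans ((and_congr
    (Eq.congr_right (trivBimod_smul_change V P i.cell φ rfl))
    (Eq.congr_right (trivBimod_rsmul_change V P φ j.cell rfl))).trans
    (isBimodHom_single_iff (f := i) (g := j) (A := B) (C := U.trivBimod P)).symm)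

namespace IsBimodCollapse

theorem change (h : U.IsBimodCollapse i j B P φ) :
    V.IsBimodCollapse (i.change V) (j.change V) B P φ where
  left := h.left.change V
  right := h.right.change V
  emb := (isBimodEmb_change_iff V).2 h.emb
  universal x' y' f g Q ψ hψ := by
    refine h.universal f g Q ψ ((isBimodEmb_change_iff V).1 ?_)
    obtain ⟨left, right⟩ := isBimodHom_single_iff.1 hψ
    exact isBimodHom_single_iff.2
      ⟨left.trans (Bimod.smul_congr _ (i.change_comp_cell V f) rfl rfl),
        right.trans (Bimod.rsmul_congr _ rfl (j.change_comp_cell V g) rfl)⟩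

theorem congr {i' : U.Emb M x} {j' : U.Emb N y} {φ' : D.Cell i'.hom j'.hom (.single B.pro) P}
    (hi : i = i') (hj : j = j') (hφ : φ ≍ φ') (h : U.IsBimodCollapse i j B P φ) :
    U.IsBimodCollapse i' j' B P φ' := by
  subst hi hj hφ
  exact h

theorem of_change (h : V.IsBimodCollapse (i.change V) (j.change V) B P φ) :
    U.IsBimodCollapse i j B P φ :=
  (h.change U).congr (i.change_change V) (j.change_change V) .rfl

end IsBimodCollapse

theorem isBimodEmb_self (i : U.Emb M x) : U.IsBimodEmb i i M.self (U.pro x) i.cell :=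
  isBimodHom_single_iff.2 ⟨i.mul_cell, i.mul_cell.trans (congrArg (fun χ =>
    D.comp (.pair i.cell i.cell) χ (Category.comp_id _).symm (Category.comp_id _).symm)
    (U.ract_eq_lact x).symm)⟩

theorem IsNormalCollapse.change (h : U.IsNormalCollapse i) : V.IsNormalCollapse (i.change V) := by
  refine ⟨h.1.change V, ?_⟩
  have e : i.change V = (i.change V).comp (𝟙 x) := (i.change V).comp_id.symm
  exact (h.2.change V).comp e e (Category.comp_id _).symm (Category.comp_id _).symm
    (U.isCartesian_comparison V x) (isBimodEmb_self _)

/-- The kernel with respect to the units `V` that corresponds to one with respect to `U`, with the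
same monoid. -/
noncomputable def Kernel.change {c d : D.Obj} {f : c ⟶ d} (K : U.Kernel f) : V.Kernel f where
  mon := K.mon
  obj_eq := K.obj_eq
  emb := K.emb.change V
  hom_eq := K.hom_eq
  cart := Emb.isCartesian_change V K.cart

theorem IsRegularCover.change {c d : D.Obj} {f : c ⟶ d} (h : U.IsRegularCover f) :
    V.IsRegularCover f := by
  obtain ⟨K, hK⟩ := h
  exact ⟨K.change V, hK.change V⟩

theorem IsEffective.change (h : U.IsEffective M) : V.IsEffective M := by
  obtain ⟨d, i, hi⟩ := h
  exact ⟨d, i.change V, Emb.isCartesian_change V hi⟩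

theorem IsRegular.change (h : U.IsRegular) : V.IsRegular where
  effective_collapse M hM := by
    obtain ⟨x, i, hi⟩ := h.effective_collapse M (hM.change U)
    exact ⟨x, i.change V, hi.change V⟩
  collapse_restriction _ _ _ _ f g B hf hg K K' R φ he hφ :=
    (h.collapse_restriction f g B (hf.change U) (hg.change U) (K.change U) (K'.change U) R φ
      ((isBimodEmb_change_iff U).2 he) hφ).of_change U

end Change

end Units

end VirtualDoubleCategory

open VirtualDoubleCategory in
theorem mainTheorem3_general (D : VirtualDoubleCategory.{u, v, w, z}) (hD : D.HasRestrictions) :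
    D.Mod.IsVirtualEquipment ∧ ∀ U : D.Mod.Units, U.IsExact ∧
      (∀ M : D.Mod.Mon, ∃ (x : D.Mod.Obj) (i : U.Emb M x), U.IsCollapse i ∧ IsCartesian i.cell) ∧
      ∀ (M N : D.Mod.Mon) (B : Bimod M N),
        ∃ (x y : D.Mod.Obj) (i : U.Emb M x) (j : U.Emb N y) (P : D.Mod.Pro x y)
          (φ : D.Mod.Cell i.hom j.hom (.single B.pro) P), U.IsBimodCollapse i j B P φ ∧
            IsCartesian i.cell ∧ IsCartesian j.cell ∧ IsCartesian φ := by
  refine ⟨isVirtualEquipment_mod hD, fun U => ?_⟩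
  have cartesian (M : D.Mod.Mon) : IsCartesian (M.flatEmb.change U).cell :=
    Units.Emb.isCartesian_change U M.isCartesian_flatEmb
  have collapse {M N : D.Mod.Mon} (B : Bimod M N) := B.isBimodCollapse_flatCell.change U
  exact ⟨{ regular := (isRegular_modUnits hD).change U
           effective M := ⟨_, _, cartesian M⟩
           effective_bimod M N B := ⟨_, _, _, _, _, _, (collapse B).emb, cartesian M,
             cartesian N, B.isCartesian_flatCell⟩ },
    fun M => ⟨_, _, M.isCollapse_flatEmb.change U, cartesian M⟩,
    fun M N B =>
      ⟨_, _, _, _, _, _, collapse B, cartesian M, cartesian N, B.isCartesian_flatCell⟩⟩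

theorem mainTheorem3 (D : VirtualDoubleCategory.{u, v, w, z}) (hD : D.IsVirtualEquipment) :
    D.Mod.IsVirtualEquipment ∧ ∀ U : D.Mod.Units, U.IsExact ∧
      (∀ M : D.Mod.Mon, ∃ (x : D.Mod.Obj) (i : U.Emb M x),
        U.IsCollapse i ∧ VirtualDoubleCategory.IsCartesian i.cell) ∧
      ∀ (M N : D.Mod.Mon) (B : VirtualDoubleCategory.Bimod M N),
        ∃ (x y : D.Mod.Obj) (i : U.Emb M x) (j : U.Emb N y) (P : D.Mod.Pro x y)
          (φ : D.Mod.Cell i.hom j.hom (.single B.pro) P), U.IsBimodCollapse i j B P φ ∧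
            VirtualDoubleCategory.IsCartesian i.cell ∧ VirtualDoubleCategory.IsCartesian j.cell ∧
            VirtualDoubleCategory.IsCartesian φ :=
  mainTheorem3_general D hD.hasRestrictions
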